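/- Let $n\in\mathbb N$, $m\in\mathbb R$ and $\langle t\rangle=(1+t^2)^{1/2}$. Let $c\in S^{-m}$, i.e. $c\in C^\infty(\mathbb R^n\times\mathbb R^n;\mathbb C)$ and for all multi-indices $\alpha,\beta$ there is $C_{\alpha,\beta}>0$ with $|D_x^\alpha D_\xi^\beta c(x,\xi)|\le C_{\alpha,\beta}(1+|\xi|)^{-m-|\beta|}$ for all $x,\xi\in\mathbb R^n$. Let $$C(z_1,z_2)=\int_{\mathbb R^n} e^{i(z_1-z_2)\cdot\xi}\,c(z_1,\xi)\,d\xi ,$$ understood as an oscillatory integral: for a function $g$ on $\mathbb R^n\times\mathbb R^n$, $$\int g\,C\,dz_1dz_2:=\lim_{\varepsilon\to0^+}\int g(z_1,z_2)\Big(\int e^{i(z_1-z_2)\cdot\xi}\chi(\varepsilon\xi)\,c(z_1,\xi)\,d\xi\Big)dz_1dz_2 ,$$ where $\chi\in C_c^\infty(\mathbb R^n)$, $\chi(0)=1$; the integral is said to exist with value $v$ if, for every such $\chi$, the integrals over $(z_1,z_2)$ on the right converge absolutely for all $\varepsilon>0$ and the limit is $v$. Let $D,U\subset\mathbb R^n$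 be bounded sets such that the distribution $C$ is supported in $\overline D\times\overline D$ and such that, for all $x,y\in\overline U$, the segment $[x,y]$ does not meet $\overline D$ (for instance $U$ convex and $\overline U\cap\overline D=\emptyset$). Then for all $x,y\in U$ and $k_1,k_2>0$ the oscillatory integral $$\mathbb I(x,y,k_1,k_2)=\int e^{ik_1(|x-z_1|+|z_1-y|)-ik_2(|x-z_2|+|z_2-y|)}\,C(z_1,z_2)\,dz_1dz_2$$ exists, and for every $N\in\mathbb N$ and every $\kappa>0$ there is a constant $C_N>0$ (which may depend on $\kappa$) such that $$|\mathbb I(x,y,k_1,k_2)|\le C_N\,\langle k_1-k_2\rangle^{-N}(k_1+k_2)^{-m}$$ for all $x,y\in U$ and all $k_1,k_2>0$, where in the case $m<0$ the additional restriction $k_1+k_2\ge\kappa$ is made. -/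

import Mathlib

open MeasureTheory Filter Topology
open scoped ContDiff

noncomputable section

namespace NearField

/-- The symbol class `S^r` on `ℝⁿ × ℝⁿ`: smooth functions `σ(x, ξ)` such that, for all orders `j`
in `x` and `l` in `ξ`, the mixed derivatives `D_x^j D_ξ^l σ` are bounded by a constant times
`(1 + |ξ|)^(r - l)`. The `j`-th derivative in `x` of the `l`-th derivative in `ξ` collects all
partial derivatives `D_x^α D_ξ^β σ` with `|α| = j` and `|β| = l`. -/
structure IsSymbol {n : ℕ} (r : ℝ)
    (σ : EuclideanSpace ℝ (Fin n) → EuclideanSpace ℝ (Fin n) → ℂ) : Prop where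
  contDiff : ContDiff ℝ ∞
    (fun p : EuclideanSpace ℝ (Fin n) × EuclideanSpace ℝ (Fin n) => σ p.1 p.2)
  bound : ∀ j l : ℕ, ∃ C : ℝ, 0 < C ∧ ∀ x ξ : EuclideanSpace ℝ (Fin n),
    ‖iteratedFDeriv ℝ j (fun x' => iteratedFDeriv ℝ l (fun ξ' => σ x' ξ') ξ) x‖
      ≤ C * (1 + ‖ξ‖) ^ (r - (l : ℝ))

/-- Cut-off functions `χ ∈ C_c^∞(ℝⁿ)` with `χ(0) = 1`. -/
structure IsCutoff {n : ℕ} (χ : EuclideanSpace ℝ (Fin n) → ℝ) : Prop where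
  contDiff : ContDiff ℝ ∞ χ
  hasCompactSupport : HasCompactSupport χ
  map_zero : χ 0 = 1

/-- The regularized kernel `C_ε(z₁, z₂) = ∫ e^{i (z₁ - z₂)·ξ} χ(ε ξ) c(z₁, ξ) dξ`. -/
def regKernel {n : ℕ} (c : EuclideanSpace ℝ (Fin n) → EuclideanSpace ℝ (Fin n) → ℂ)
    (χ : EuclideanSpace ℝ (Fin n) → ℝ) (ε : ℝ) (z₁ z₂ : EuclideanSpace ℝ (Fin n)) : ℂ :=
  ∫ ξ : EuclideanSpace ℝ (Fin n),
    Complex.exp (Complex.I * ((inner ℝ (z₁ - z₂) ξ : ℝ) : ℂ)) * ((χ (ε • ξ) : ℝ) : ℂ) * c z₁ ξ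

/-- `v` is the value of the oscillatory integral `∫ g(z₁, z₂) C(z₁, z₂) dz₁ dz₂`, where
`C(z₁, z₂) = ∫ e^{i (z₁ - z₂)·ξ} c(z₁, ξ) dξ`: for every cut-off `χ`, the absolutely convergent
integrals of `g` against the regularized kernels `C_ε` tend to `v` as `ε → 0⁺`. -/
def HasOscIntegral {n : ℕ} (c : EuclideanSpace ℝ (Fin n) → EuclideanSpace ℝ (Fin n) → ℂ)
    (g : EuclideanSpace ℝ (Fin n) × EuclideanSpace ℝ (Fin n) → ℂ) (v : ℂ) : Prop :=
  ∀ χ : EuclideanSpace ℝ (Fin n) → ℝ, IsCutoff χ →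
    (∀ ε : ℝ, 0 < ε → Integrable
      (fun z : EuclideanSpace ℝ (Fin n) × EuclideanSpace ℝ (Fin n) =>
        g z * regKernel c χ ε z.1 z.2)) ∧
    Tendsto (fun ε : ℝ => ∫ z : EuclideanSpace ℝ (Fin n) × EuclideanSpace ℝ (Fin n),
      g z * regKernel c χ ε z.1 z.2) (𝓝[>] 0) (𝓝 v)

/-- The distribution `C(z₁, z₂) = ∫ e^{i (z₁ - z₂)·ξ} c(z₁, ξ) dξ` on `ℝⁿ × ℝⁿ` is supported in
the closed set `F`: it vanishes on every test function whose support does not meet `F`. -/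
def KernelSupportedIn {n : ℕ} (c : EuclideanSpace ℝ (Fin n) → EuclideanSpace ℝ (Fin n) → ℂ)
    (F : Set (EuclideanSpace ℝ (Fin n) × EuclideanSpace ℝ (Fin n))) : Prop :=
  ∀ ψ : EuclideanSpace ℝ (Fin n) × EuclideanSpace ℝ (Fin n) → ℂ,
    ContDiff ℝ ∞ ψ → HasCompactSupport ψ → Disjoint (tsupport ψ) F → HasOscIntegral c ψ 0

/-- The oscillating factor
`exp (i k₁ (|x - z₁| + |z₁ - y|) - i k₂ (|x - z₂| + |z₂ - y|))`, as a function of `(z₁, z₂)`. -/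
def travelTimeFactor {n : ℕ} (x y : EuclideanSpace ℝ (Fin n)) (k₁ k₂ : ℝ)
    (z : EuclideanSpace ℝ (Fin n) × EuclideanSpace ℝ (Fin n)) : ℂ :=
  Complex.exp (Complex.I *
    ((k₁ * (‖x - z.1‖ + ‖z.1 - y‖) - k₂ * (‖x - z.2‖ + ‖z.2 - y‖) : ℝ) : ℂ))

/-- The Japanese bracket `⟨t⟩ = (1 + t²)^{1/2}` of a real number. -/
def japaneseBracket (t : ℝ) : ℝ := Real.sqrt (1 + t ^ 2)

end NearField

end

/-! Write `φ(z) = |x - z| + |z - y|` and `r = -m`. The regularized integral has the phase `k₁ φ(z₁)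
- k₂ φ(z₂) + (z₁ - z₂)·ξ`. The gradient of `φ` is a sum of two unit vectors, which cancel only on
the segment from `x` to `y`. Since these segments miss `closure D`, compactness bounds `|∇φ|` below
near `closure D`, uniformly in `x` and `y` (`exists_travelTimeModel`). Every decay estimate is then
an instance of non-stationary phase, made uniform over families of phases and amplitudes
(`nonstationary_phase`).

The decay in `k₁ - k₂` comes from a change of variables. Put `z₂ = z + w` and `φ(z + w) - φ(z) =
Φ(z, w)·w` with `Φ` smooth; then `ξ = ζ - k₂ Φ(z, w)` turns the phase into `(k₁ - k₂) φ(z) - w·ζ`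
(`phase_shift`). It is non-stationary in `(z, w)` with strength `|k₁ - k₂| + |ζ|`, which gives the
decay and convergence in `ζ` together (`high_frequency`). The price is that the symbol is evaluated
at `ζ - k₂ Φ`, so derivatives in `(z, w)` produce powers of `k₂`. Where `|ξ|` is at least a multiple
of `k₂` these are absorbed by the symbol estimates, and for `k₂ ≤ 1` they are harmless. In the
remaining region `|ξ| ≤ δ k₂` with `k₂ ≥ 1` the original phase is non-stationary in `(z₁, z₂)` with
strength `k₁ + k₂`, because `ξ` is too small to cancel the travel time gradients (`low_frequency`).
Together these bound the integral by `(1 + |k₁ - k₂|)^(-N) max(1, k₂)^r`, and powers of `1 + |k₁ -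
k₂|` convert `max(1, k₂)` into `k₁ + k₂` (`exists_max_rpow_le`).

Existence needs the supports. The support hypothesis on the kernel forces `c(z, ·) = 0` for `z`
outside `closure D` (`symbol_eq_zero`), so all integrals are compactly supported in `z₁`. In `z₂`
only the limiting distribution is compactly supported, not the regularized kernels. A cut-off
`θ(z₂)` is inserted: the part with `1 - θ` tends to zero (`tendsto_integral_mul_regKernel_tail`),
while the part with `θ` is `p(z₁) u(z₂)` with `u` a test function, whose limit is an absolutely
convergent integral against the Fourier transform of `u` (`tendsto_integral_mul_regKernel`). The
estimates are proved uniformly in small `ε` and passed to this limit. -/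

namespace NearField

/-! ### Calculus of families of smooth functions with uniform derivative bounds -/

section Families

variable {ι κ V V' G G' H : Type*} [NormedAddCommGroup V] [NormedSpace ℝ V]
  [NormedAddCommGroup V'] [NormedSpace ℝ V'] [NormedAddCommGroup G] [NormedSpace ℝ G]
  [NormedAddCommGroup G'] [NormedSpace ℝ G'] [NormedAddCommGroup H] [NormedSpace ℝ H]

/-- A family of smooth functions all of whose derivatives are bounded, uniformly in the family,
by constant multiples of one weight. -/
structure WeightedFamily (W : ι → V → ℝ) (F : ι → V → G) : Prop where
  contDiff : ∀ i, ContDiff ℝ ∞ (F i)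
  bound : ∀ j : ℕ, ∃ C : ℝ, 0 ≤ C ∧ ∀ i v, ‖iteratedFDeriv ℝ j (F i) v‖ ≤ C * W i v

/-- A family of smooth functions all of whose derivatives are uniformly bounded. -/
abbrev BoundedFamily (F : ι → V → G) : Prop := WeightedFamily (fun _ _ => 1) F

/-- A family of smooth functions whose derivatives of positive order are uniformly bounded. -/
structure BoundedDerivFamily (F : ι → V → G) : Prop where
  contDiff : ∀ i, ContDiff ℝ ∞ (F i)
  bound : ∀ j : ℕ, 1 ≤ j → ∃ C : ℝ, 0 ≤ C ∧ ∀ i v, ‖iteratedFDeriv ℝ j (F i) v‖ ≤ C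

theorem natCast_le_infty (j : ℕ) : (j : WithTop ℕ∞) ≤ ∞ := by
  exact_mod_cast (le_top : (j : ℕ∞) ≤ ⊤)

theorem WeightedFamily.reindex {W : ι → V → ℝ} {F : ι → V → G} (h : WeightedFamily W F)
    (e : κ → ι) : WeightedFamily (fun i => W (e i)) (fun i => F (e i)) :=
  ⟨fun i => h.contDiff _, fun j => by
    obtain ⟨C, hC, h⟩ := h.bound j
    exact ⟨C, hC, fun i v => h _ _⟩⟩

theorem WeightedFamily.mono {W W' : ι → V → ℝ} {F : ι → V → G} (h : WeightedFamily W F)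
    {B : ℝ} (hB : 0 ≤ B) (hW : ∀ i v, W i v ≤ B * W' i v) : WeightedFamily W' F :=
  ⟨h.contDiff, fun j => by
    obtain ⟨C, hC, h⟩ := h.bound j
    refine ⟨C * B, by positivity, fun i v => (h i v).trans ?_⟩
    rw [mul_assoc]
    exact mul_le_mul_of_nonneg_left (hW i v) hC⟩

theorem WeightedFamily.norm_le {W : ι → V → ℝ} {F : ι → V → G} (h : WeightedFamily W F) :
    ∃ C : ℝ, 0 ≤ C ∧ ∀ i v, ‖F i v‖ ≤ C * W i v := by
  obtain ⟨C, hC, h⟩ := h.bound 0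
  exact ⟨C, hC, fun i v => by simpa using h i v⟩

theorem BoundedFamily.norm_le {F : ι → V → G} (h : BoundedFamily F) :
    ∃ C : ℝ, 0 ≤ C ∧ ∀ i v, ‖F i v‖ ≤ C := by
  simpa using WeightedFamily.norm_le h

theorem BoundedFamily.boundedDeriv {F : ι → V → G} (h : BoundedFamily F) :
    BoundedDerivFamily F :=
  ⟨h.contDiff, fun j _ => by simpa using h.bound j⟩

theorem WeightedFamily.add {W : ι → V → ℝ} {F F' : ι → V → G} (h : WeightedFamily W F)
    (h' : WeightedFamily W F') : WeightedFamily W (fun i v => F i v + F' i v) :=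
  ⟨fun i => (h.contDiff i).add (h'.contDiff i), fun j => by
    obtain ⟨C, hC, hb⟩ := h.bound j
    obtain ⟨C', hC', hb'⟩ := h'.bound j
    refine ⟨C + C', by positivity, fun i v => ?_⟩
    have := iteratedFDeriv_add_apply (x := v)
      ((h.contDiff i).contDiffAt.of_le (natCast_le_infty j))
      ((h'.contDiff i).contDiffAt.of_le (natCast_le_infty j))
    have e : (fun v => F i v + F' i v) = F i + F' i := rfl
    rw [e, this, add_mul]
    exact (norm_add_le _ _).trans (add_le_add (hb i v) (hb' i v))⟩

theorem BoundedDerivFamily.add {F F' : ι → V → G} (h : BoundedDerivFamily F)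
    (h' : BoundedDerivFamily F') : BoundedDerivFamily (fun i v => F i v + F' i v) :=
  ⟨fun i => (h.contDiff i).add (h'.contDiff i), fun j hj => by
    obtain ⟨C, hC, hb⟩ := h.bound j hj
    obtain ⟨C', hC', hb'⟩ := h'.bound j hj
    refine ⟨C + C', by positivity, fun i v => ?_⟩
    have := iteratedFDeriv_add_apply (x := v)
      ((h.contDiff i).contDiffAt.of_le (natCast_le_infty j))
      ((h'.contDiff i).contDiffAt.of_le (natCast_le_infty j))
    have e : (fun v => F i v + F' i v) = F i + F' i := rfl
    rw [e, this]
    exact (norm_add_le _ _).trans (add_le_add (hb i v) (hb' i v))⟩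

theorem WeightedFamily.clm {W : ι → V → ℝ} {F : ι → V → G} (h : WeightedFamily W F)
    (L : G →L[ℝ] G') : WeightedFamily W (fun i v => L (F i v)) :=
  ⟨fun i => L.contDiff.comp (h.contDiff i), fun j => by
    obtain ⟨C, hC, hb⟩ := h.bound j
    refine ⟨‖L‖ * C, by positivity, fun i v => ?_⟩
    refine (L.norm_iteratedFDeriv_comp_left (h.contDiff i).contDiffAt
      (natCast_le_infty j)).trans ?_
    rw [mul_assoc]
    exact mul_le_mul_of_nonneg_left (hb i v) (norm_nonneg _)⟩

theorem BoundedDerivFamily.clm {F : ι → V → G} (h : BoundedDerivFamily F)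
    (L : G →L[ℝ] G') : BoundedDerivFamily (fun i v => L (F i v)) :=
  ⟨fun i => L.contDiff.comp (h.contDiff i), fun j hj => by
    obtain ⟨C, hC, hb⟩ := h.bound j hj
    refine ⟨‖L‖ * C, by positivity, fun i v => ?_⟩
    exact (L.norm_iteratedFDeriv_comp_left (h.contDiff i).contDiffAt
      (natCast_le_infty j)).trans (mul_le_mul_of_nonneg_left (hb i v) (norm_nonneg _))⟩

theorem WeightedFamily.sum {W : ι → V → ℝ} {σ : Type*} (s : Finset σ) {F : σ → ι → V → G}
    (h : ∀ a ∈ s, WeightedFamily W (F a)) :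
    WeightedFamily W (fun i v => ∑ a ∈ s, F a i v) := by
  classical
  induction s using Finset.induction_on with
  | empty =>
    refine ⟨fun i => by simpa using contDiff_const, fun j => ⟨0, le_rfl, fun i v => ?_⟩⟩
    simp only [Finset.sum_empty]
    rw [iteratedFDeriv_fun_zero]
    simp
  | insert a s ha ih =>
    simp only [Finset.sum_insert ha]
    exact (h a (by simp)).add (ih fun b hb => h b (by simp [hb]))

/-- Leibniz rule for families; the first factor only needs to be controlled on the support of the
second one. -/
theorem WeightedFamily.bilin_of_tsupport (B : G →L[ℝ] G' →L[ℝ] H) {W W' : ι → V → ℝ}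
    {F : ι → V → G} {F' : ι → V → G'} (hW : ∀ i v, 0 ≤ W i v) (hW' : ∀ i v, 0 ≤ W' i v)
    (hF : ∀ i, ContDiff ℝ ∞ (F i))
    (h : ∀ j : ℕ, ∃ C : ℝ, 0 ≤ C ∧ ∀ i, ∀ v ∈ tsupport (F' i),
      ‖iteratedFDeriv ℝ j (F i) v‖ ≤ C * W i v)
    (h' : WeightedFamily W' F') :
    WeightedFamily (fun i v => W i v * W' i v) (fun i v => B (F i v) (F' i v)) := by
  refine ⟨fun i => B.isBoundedBilinearMap.contDiff.comp ((hF i).prodMk (h'.contDiff i)),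
    fun j => ?_⟩
  choose C hC hb using h
  choose C' hC' hb' using h'.bound
  refine ⟨‖B‖ * ∑ l ∈ Finset.range (j + 1), (j.choose l : ℝ) * C l * C' (j - l), ?_,
    fun i v => ?_⟩
  · exact mul_nonneg B.opNorm_nonneg (Finset.sum_nonneg fun l _ =>
      mul_nonneg (mul_nonneg (by positivity) (hC _)) (hC' _))
  refine (B.norm_iteratedFDeriv_le_of_bilinear (hF i) (h'.contDiff i) v
    (natCast_le_infty j)).trans ?_
  rw [mul_assoc, Finset.sum_mul]
  refine mul_le_mul_of_nonneg_left (Finset.sum_le_sum fun l _ => ?_) B.opNorm_nonneg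
  -- Off the support of `F' i` all its derivatives vanish, so the uncontrolled derivatives of `F i`
  -- are multiplied by zero.
  by_cases hv : v ∈ tsupport (F' i)
  · calc (j.choose l : ℝ) * ‖iteratedFDeriv ℝ l (F i) v‖ * ‖iteratedFDeriv ℝ (j - l) (F' i) v‖
        ≤ (j.choose l : ℝ) * (C l * W i v) * (C' (j - l) * W' i v) := by
          have := hb l i v hv
          have := hb' (j - l) i v
          have := hC l
          have := hW i v
          gcongr
      _ = _ := by ring
  · have : iteratedFDeriv ℝ (j - l) (F' i) v = 0 := by
      by_contra h0
      exact hv (support_iteratedFDeriv_subset (𝕜 := ℝ) (j - l) h0)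
    rw [this, norm_zero, mul_zero]
    have := hW i v
    have := hW' i v
    have := hC l
    have := hC' (j - l)
    positivity

theorem WeightedFamily.bilin (B : G →L[ℝ] G' →L[ℝ] H) {W W' : ι → V → ℝ}
    {F : ι → V → G} {F' : ι → V → G'} (hW : ∀ i v, 0 ≤ W i v) (hW' : ∀ i v, 0 ≤ W' i v)
    (h : WeightedFamily W F) (h' : WeightedFamily W' F') :
    WeightedFamily (fun i v => W i v * W' i v) (fun i v => B (F i v) (F' i v)) := by
  refine WeightedFamily.bilin_of_tsupport B hW hW' h.contDiff (fun j => ?_) h'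
  obtain ⟨C, hC, hb⟩ := h.bound j
  exact ⟨C, hC, fun i v _ => hb i v⟩

theorem BoundedFamily.bilin (B : G →L[ℝ] G' →L[ℝ] H)
    {F : ι → V → G} {F' : ι → V → G'} (h : BoundedFamily F) (h' : BoundedFamily F') :
    BoundedFamily (fun i v => B (F i v) (F' i v)) := by
  simpa [BoundedFamily] using WeightedFamily.bilin B (fun _ _ => zero_le_one)
    (fun _ _ => zero_le_one) h h'

theorem BoundedFamily.smul {F : ι → V → ℝ} {F' : ι → V → G} (h : BoundedFamily F)
    (h' : BoundedFamily F') : BoundedFamily (fun i v => F i v • F' i v) :=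
  BoundedFamily.bilin (ContinuousLinearMap.lsmul ℝ ℝ) h h'

theorem BoundedFamily.clm_apply {F : ι → V → G →L[ℝ] G'} {F' : ι → V → G} (h : BoundedFamily F)
    (h' : BoundedFamily F') : BoundedFamily (fun i v => F i v (F' i v)) :=
  BoundedFamily.bilin (ContinuousLinearMap.id ℝ (G →L[ℝ] G')) h h'

theorem WeightedFamily.fderiv {W : ι → V → ℝ} {F : ι → V → G} (h : WeightedFamily W F) :
    WeightedFamily W (fun i => fderiv ℝ (F i)) :=
  ⟨fun i => (h.contDiff i).fderiv_right (by simp), fun j => by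
    obtain ⟨C, hC, hb⟩ := h.bound (j + 1)
    exact ⟨C, hC, fun i v => by rw [norm_iteratedFDeriv_fderiv]; exact hb i v⟩⟩

/-- Chain rule for families. -/
theorem WeightedFamily.comp {W : ι → V' → ℝ} {F : ι → V' → G} {g : ι → V → V'}
    (hW : ∀ i v, 0 ≤ W i v) (h : WeightedFamily W F) (hg : BoundedDerivFamily g) :
    WeightedFamily (fun i v => W i (g i v)) (fun i v => F i (g i v)) := by
  refine ⟨fun i => (h.contDiff i).comp (hg.contDiff i), fun j => ?_⟩
  choose C hC hb using h.bound
  have hg' : ∀ l : ℕ, ∃ D : ℝ, 0 ≤ D ∧ (1 ≤ l → ∀ i v, ‖iteratedFDeriv ℝ l (g i) v‖ ≤ D) := by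
    intro l
    by_cases hl : 1 ≤ l
    · obtain ⟨D, hD, hb⟩ := hg.bound l hl
      exact ⟨D, hD, fun _ => hb⟩
    · exact ⟨0, le_rfl, fun h => absurd h hl⟩
  choose D hD hD' using hg'
  set C₀ := ∑ l ∈ Finset.range (j + 1), C l with hC₀
  -- The composition estimate wants the `l`-th derivative of `g` below `D₀ ^ l`. The summand `1`
  -- makes `D₀ ≤ D₀ ^ l` for `l ≥ 1`.
  set D₀ := 1 + ∑ l ∈ Finset.range (j + 1), D l with hD₀
  have hC₀' : 0 ≤ C₀ := Finset.sum_nonneg fun l _ => hC l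
  have hD₀' : 1 ≤ D₀ := le_add_of_nonneg_right (Finset.sum_nonneg fun l _ => hD l)
  refine ⟨(j.factorial : ℝ) * C₀ * D₀ ^ j, by positivity, fun i v => ?_⟩
  refine (norm_iteratedFDeriv_comp_le (h.contDiff i) (hg.contDiff i) (natCast_le_infty j) v
    (C := C₀ * W i (g i v)) (D := D₀) ?_ ?_).trans (le_of_eq (by ring))
  · intro l hl
    refine (hb l i _).trans (mul_le_mul_of_nonneg_right ?_ (hW _ _))
    exact Finset.single_le_sum (f := C) (fun l _ => hC l) (by simp; omega)
  · intro l hl hlj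
    refine (hD' l hl i v).trans ?_
    calc D l ≤ D₀ := by
          have := Finset.single_le_sum (f := D) (s := Finset.range (j + 1)) (fun l _ => hD l)
            (show l ∈ Finset.range (j + 1) by simp; omega)
          linarith
      _ ≤ D₀ ^ l := le_self_pow₀ hD₀' (by omega)

theorem BoundedFamily.comp {F : ι → V' → G} {g : ι → V → V'}
    (h : BoundedFamily F) (hg : BoundedDerivFamily g) :
    BoundedFamily (fun i v => F i (g i v)) :=
  WeightedFamily.comp (fun _ _ => zero_le_one) h hg

theorem boundedFamily_of_hasCompactSupport {f : V → G} (hf : ContDiff ℝ ∞ f)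
    (hf' : HasCompactSupport f) : BoundedFamily (fun _ : ι => f) := by
  refine ⟨fun _ => hf, fun j => ?_⟩
  obtain ⟨C, hC⟩ := (hf.continuous_iteratedFDeriv
    (natCast_le_infty j)).bounded_above_of_compact_support
    (hf'.iteratedFDeriv j)
  exact ⟨max C 0, le_max_right _ _, fun _ v => by simpa using Or.inl (hC v)⟩

theorem boundedFamily_const (a : ι → G) {C : ℝ} (ha : ∀ i, ‖a i‖ ≤ C) :
    BoundedFamily (fun i (_ : V) => a i) := by
  refine ⟨fun i => contDiff_const, fun j => ⟨|C|, abs_nonneg _, fun i v => ?_⟩⟩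
  rcases Nat.eq_zero_or_pos j with rfl | hj
  · simpa using (ha i).trans (le_abs_self C)
  · rw [iteratedFDeriv_const_of_ne hj.ne']
    simp

/-- The shifts `b i` may be unbounded in `i`, since they disappear after one derivative. This is why
inner functions of compositions are only asked for bounds on derivatives of positive order. -/
theorem boundedDerivFamily_affine (L : ι → V →L[ℝ] G) (b : ι → G) {C : ℝ}
    (hL : ∀ i, ‖L i‖ ≤ C) : BoundedDerivFamily (fun i v => L i v + b i) := by
  refine ⟨fun i => (L i).contDiff.add contDiff_const, fun j hj => ?_⟩
  have hd : ∀ i, _root_.fderiv ℝ (fun v => L i v + b i) = fun _ => L i := by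
    intro i
    ext1 v
    exact ((L i).hasFDerivAt.add_const _).fderiv
  obtain ⟨l, rfl⟩ : ∃ l, j = l + 1 := ⟨j - 1, by omega⟩
  obtain ⟨C', hC', hb⟩ := (boundedFamily_const (V := V) L hL).bound l
  refine ⟨C', hC', fun i v => ?_⟩
  rw [← norm_iteratedFDeriv_fderiv, hd i]
  simpa using hb i v

theorem BoundedDerivFamily.prodMk {F : ι → V → G} {F' : ι → V → G'} (h : BoundedDerivFamily F)
    (h' : BoundedDerivFamily F') : BoundedDerivFamily (fun i v => (F i v, F' i v)) := by
  have := (h.clm (ContinuousLinearMap.inl ℝ G G')).add (h'.clm (ContinuousLinearMap.inr ℝ G G'))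
  simpa using this

theorem BoundedFamily.prodMk {F : ι → V → G} {F' : ι → V → G'} (h : BoundedFamily F)
    (h' : BoundedFamily F') : BoundedFamily (fun i v => (F i v, F' i v)) := by
  have := (WeightedFamily.clm h (ContinuousLinearMap.inl ℝ G G')).add
    (WeightedFamily.clm h' (ContinuousLinearMap.inr ℝ G G'))
  simpa using this

end Families

/-! ### Smooth cut-offs and smooth extensions from compact sets -/

section Cutoffs

variable {V G : Type*} [NormedAddCommGroup V] [NormedSpace ℝ V] [FiniteDimensional ℝ V]
  [NormedAddCommGroup G] [NormedSpace ℝ G]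

theorem exists_contDiff_cutoff {K O : Set V} (hK : IsCompact K) (hO : IsOpen O) (hKO : K ⊆ O) :
    ∃ θ : V → ℝ, ContDiff ℝ ∞ θ ∧ HasCompactSupport θ ∧ tsupport θ ⊆ O ∧
      (∀ᶠ v in 𝓝ˢ K, θ v = 1) ∧ ∀ v, θ v ∈ Set.Icc (0 : ℝ) 1 := by
  obtain ⟨K', hK', hKK', hK'O⟩ := exists_compact_between hK hO hKO
  obtain ⟨f, hf1, hf0, hf⟩ := exists_contMDiffMap_one_nhds_of_subset_interior
    (n := ⊤) (modelWithCornersSelf ℝ V) hK.isClosed hKK'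
  have hsupp : tsupport f ⊆ K' :=
    closure_minimal (fun v hv => by_contra fun h => hv (hf0 v h)) hK'.isClosed
  exact ⟨f, f.contMDiff.contDiff, HasCompactSupport.of_support_subset_isCompact hK'
    ((subset_tsupport _).trans hsupp), hsupp.trans hK'O, hf1, hf⟩

/-- A function smooth on an open set agrees near a given compact subset with a smooth compactly
supported function. -/
theorem exists_contDiff_hasCompactSupport_eq {K O : Set V} (hK : IsCompact K) (hO : IsOpen O)
    (hKO : K ⊆ O) {f : V → G} (hf : ContDiffOn ℝ ∞ f O) :
    ∃ g : V → G, ContDiff ℝ ∞ g ∧ HasCompactSupport g ∧ ∀ᶠ v in 𝓝ˢ K, g v = f v := by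
  obtain ⟨θ, hθ, hθc, hθO, hθ1, -⟩ := exists_contDiff_cutoff hK hO hKO
  refine ⟨fun v => θ v • f v, ?_, hθc.smul_right, hθ1.mono fun v hv => by simp [hv]⟩
  rw [contDiff_iff_contDiffAt]
  intro v
  by_cases hv : v ∈ tsupport θ
  · exact hθ.contDiffAt.smul (hf.contDiffAt (hO.mem_nhds (hθO hv)))
  · have : (fun v => θ v • f v) =ᶠ[𝓝 v] fun _ => 0 := by
      filter_upwards [(isClosed_tsupport θ).isOpen_compl.mem_nhds hv] with w hw
      rw [image_eq_zero_of_notMem_tsupport hw, zero_smul]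
    exact contDiffAt_const.congr_of_eventuallyEq this

end Cutoffs

end NearField

namespace NearField

/-! ### Uniform non-stationary phase -/

section NonstationaryPhase

variable {ι V : Type*} [NormedAddCommGroup V]

theorem hasCompactSupport_of_forall_notMem {G : Type*} [Zero G] {S : Set V} (hS : IsCompact S)
    {A : V → G} (h : ∀ v ∉ S, A v = 0) : HasCompactSupport A :=
  HasCompactSupport.of_support_subset_isCompact hS fun v hv => by_contra fun h' => hv (h v h')

theorem tsupport_subset_of_forall_notMem {G : Type*} [Zero G] {S : Set V} (hS : IsCompact S)
    {A : V → G} (h : ∀ v ∉ S, A v = 0) : tsupport A ⊆ S :=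
  closure_minimal (fun v hv => by_contra fun h' => hv (h v h')) hS.isClosed

theorem norm_integral_phase_mul_le [MeasureSpace V] [(volume : Measure V).IsAddHaarMeasure]
    {S : Set V} (hS : IsCompact S) {Ψ : V → ℝ} {A : V → ℂ} {C : ℝ} (hA : ∀ v, ‖A v‖ ≤ C)
    (hAS : ∀ v ∉ S, A v = 0) :
    ‖∫ v, Complex.exp (Complex.I * (Ψ v : ℂ)) * A v‖ ≤ C * volume.real S := by
  rw [← setIntegral_eq_integral_of_forall_compl_eq_zero (s := S)
    (fun v hv => by rw [hAS v hv, mul_zero])]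
  refine norm_setIntegral_le_of_norm_le_const hS.measure_lt_top fun v _ => ?_
  rw [norm_mul, mul_comm Complex.I, Complex.norm_exp_ofReal_mul_I, one_mul]
  exact hA v

variable [NormedSpace ℝ V]

theorem contDiff_cexp_phase {Ψ : V → ℝ} (hΨ : ContDiff ℝ ∞ Ψ) :
    ContDiff ℝ ∞ (fun v => Complex.exp (Complex.I * (Ψ v : ℂ))) :=
  (contDiff_const.mul (Complex.ofRealCLM.contDiff.comp hΨ)).cexp

theorem fderiv_cexp_phase {Ψ : V → ℝ} (hΨ : ContDiff ℝ ∞ Ψ) (v e : V) :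
    fderiv ℝ (fun v => Complex.exp (Complex.I * (Ψ v : ℂ))) v e =
      Complex.I * (fderiv ℝ Ψ v e : ℂ) * Complex.exp (Complex.I * (Ψ v : ℂ)) := by
  have h1 : HasFDerivAt Ψ (fderiv ℝ Ψ v) v := (hΨ.differentiable (by simp) v).hasFDerivAt
  have h2 : HasFDerivAt (fun v => (Ψ v : ℂ)) (Complex.ofRealCLM.comp (fderiv ℝ Ψ v)) v :=
    Complex.ofRealCLM.hasFDerivAt.comp v h1
  rw [((h2.const_mul Complex.I).cexp).fderiv]
  simp
  ring

variable [MeasureSpace V] [(volume : Measure V).IsAddHaarMeasure]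
variable [FiniteDimensional ℝ V] [BorelSpace V]

theorem integral_phase_mul_fderiv {Ψ : V → ℝ} (hΨ : ContDiff ℝ ∞ Ψ) {B : V → ℂ}
    (hB : ContDiff ℝ ∞ B) (hBc : HasCompactSupport B) (e : V) :
    Integrable (fun v => Complex.exp (Complex.I * (Ψ v : ℂ)) * fderiv ℝ B v e) ∧
    Integrable (fun v => Complex.exp (Complex.I * (Ψ v : ℂ)) *
      (Complex.I * (fderiv ℝ Ψ v e : ℂ) * B v)) ∧
    ∫ v, Complex.exp (Complex.I * (Ψ v : ℂ)) * fderiv ℝ B v e =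
      -∫ v, Complex.exp (Complex.I * (Ψ v : ℂ)) * (Complex.I * (fderiv ℝ Ψ v e : ℂ) * B v) := by
  have hE := contDiff_cexp_phase hΨ
  have hdB : Continuous (fun v => fderiv ℝ B v e) :=
    (hB.continuous_fderiv (by simp)).clm_apply continuous_const
  have hdBc : HasCompactSupport (fun v => fderiv ℝ B v e) := hBc.fderiv_apply ℝ e
  have hdE : Continuous
      (fun v => fderiv ℝ (fun v => Complex.exp (Complex.I * (Ψ v : ℂ))) v e) :=
    (hE.continuous_fderiv (by simp)).clm_apply continuous_const
  have h1 : Integrable (fun v => Complex.exp (Complex.I * (Ψ v : ℂ)) * fderiv ℝ B v e) :=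
    (hE.continuous.mul hdB).integrable_of_hasCompactSupport hdBc.mul_left
  have h2 : Integrable
      (fun v => fderiv ℝ (fun v => Complex.exp (Complex.I * (Ψ v : ℂ))) v e * B v) :=
    (hdE.mul hB.continuous).integrable_of_hasCompactSupport hBc.mul_left
  have h3 : Integrable (fun v => Complex.exp (Complex.I * (Ψ v : ℂ)) * B v) :=
    (hE.continuous.mul hB.continuous).integrable_of_hasCompactSupport hBc.mul_left
  have h4 : (fun v => fderiv ℝ (fun v => Complex.exp (Complex.I * (Ψ v : ℂ))) v e * B v) =
      fun v => Complex.exp (Complex.I * (Ψ v : ℂ)) *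
        (Complex.I * (fderiv ℝ Ψ v e : ℂ) * B v) := by
    ext v
    rw [fderiv_cexp_phase hΨ]
    ring
  have h5 := integral_mul_fderiv_eq_neg_fderiv_mul_of_integrable h2 h1 h3
    (fun v _ => hE.differentiable (by simp) v) (fun v _ => hB.differentiable (by simp) v)
  rw [h4] at h5 h2
  exact ⟨h1, h2, h5⟩

/-- Integration by parts along a vector field, written in coordinates. -/
theorem integral_phase_mul_divergence {S : Set V} (hS : IsCompact S) {Ψ : V → ℝ}
    (hΨ : ContDiff ℝ ∞ Ψ) {A : V → ℂ} (hA : ContDiff ℝ ∞ A) (hAS : ∀ v ∉ S, A v = 0)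
    {σ : Type*} [Fintype σ] (e : Module.Basis σ ℝ V) {Y : V → V} (hY : ContDiff ℝ ∞ Y) :
    ∫ v, Complex.exp (Complex.I * (Ψ v : ℂ)) *
        ∑ s, fderiv ℝ (fun w => e.coord s (Y w) • A w) v (e s) =
      -∫ v, Complex.exp (Complex.I * (Ψ v : ℂ)) *
        (Complex.I * (fderiv ℝ Ψ v (Y v) : ℂ) * A v) := by
  have hBc : ∀ s, HasCompactSupport (fun w => e.coord s (Y w) • A w) := fun s =>
    hasCompactSupport_of_forall_notMem hS fun v hv => by rw [hAS v hv, smul_zero]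
  have hcoord : ∀ s, ContDiff ℝ ∞ (fun w => e.coord s (Y w)) := fun s =>
    (LinearMap.toContinuousLinearMap (e.coord s)).contDiff.comp hY
  have key := fun s => integral_phase_mul_fderiv hΨ (B := fun w => e.coord s (Y w) • A w)
    ((hcoord s).smul hA) (hBc s) (e s)
  have hYv : ∀ v, fderiv ℝ Ψ v (Y v) = ∑ s, e.coord s (Y v) * fderiv ℝ Ψ v (e s) := by
    intro v
    have hYv : Y v = ∑ s, e.coord s (Y v) • e s := by simp
    conv_lhs => rw [hYv]
    simp only [map_sum, map_smul, smul_eq_mul]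
  calc _ = ∑ s, ∫ v, Complex.exp (Complex.I * (Ψ v : ℂ)) *
        fderiv ℝ (fun w => e.coord s (Y w) • A w) v (e s) := by
        simp_rw [Finset.mul_sum]
        exact integral_finsetSum _ fun s _ => (key s).1
    _ = -∑ s, ∫ v, Complex.exp (Complex.I * (Ψ v : ℂ)) *
        (Complex.I * (fderiv ℝ Ψ v (e s) : ℂ) * (e.coord s (Y v) • A v)) := by
        rw [← Finset.sum_neg_distrib]
        exact Finset.sum_congr rfl fun s _ => (key s).2.2
    _ = _ := by
        rw [← integral_finsetSum _ fun s _ => (key s).2.1]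
        congr 1
        refine integral_congr_ae (.of_forall fun v => ?_)
        simp only [hYv, Complex.ofReal_sum, Complex.ofReal_mul, Complex.real_smul,
          Finset.mul_sum, Finset.sum_mul]
        exact Finset.sum_congr rfl fun s _ => by ring

/-- Lets one divide by a function with values in `[a, b]` on a compact set without losing global
smoothness and global bounds. -/
theorem exists_contDiff_inv {a : ℝ} (ha : 0 < a) (b : ℝ) :
    ∃ h : ℝ → ℝ, ContDiff ℝ ∞ h ∧ HasCompactSupport h ∧ ∀ t, a ≤ t → t ≤ b → h t * t = 1 := by
  obtain ⟨h, h1, h2, h3⟩ := exists_contDiff_hasCompactSupport_eq (isCompact_Icc (a := a) (b := b))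
    (isOpen_compl_singleton (x := (0 : ℝ))) (fun t ht => (ha.trans_le ht.1).ne')
    (f := fun t : ℝ => t⁻¹) (fun t ht => (contDiffAt_inv ℝ ht).contDiffWithinAt)
  refine ⟨h, h1, h2, fun t hat htb => ?_⟩
  rw [h3.self_of_nhdsSet t ⟨hat, htb⟩, inv_mul_cancel₀ (ha.trans_le hat).ne']

/-- Nonstationary phase estimate, uniform over families of phases and amplitudes. -/
theorem nonstationary_phase {S : Set V} (hS : IsCompact S) {a : ℝ} (ha : 0 < a) {Λ : ι → ℝ}
    (hΛ : ∀ i, 0 ≤ Λ i) {Ψ : ι → V → ℝ} (hΨ : ∀ i, ContDiff ℝ ∞ (Ψ i))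
    (hdΨ : BoundedFamily (fun i v => (Λ i)⁻¹ • fderiv ℝ (Ψ i) v)) {X : ι → V → V}
    (hX : BoundedFamily X) (hlow : ∀ i, ∀ v ∈ S, a * Λ i ≤ fderiv ℝ (Ψ i) v (X i v)) (N : ℕ) :
    ∀ A : ι → V → ℂ, BoundedFamily A → (∀ i, ∀ v ∉ S, A i v = 0) →
      ∃ C : ℝ, 0 ≤ C ∧ ∀ i,
        Λ i ^ N * ‖∫ v, Complex.exp (Complex.I * (Ψ i v : ℂ)) * A i v‖ ≤ C := by
  -- The normalized derivative of the phase along `X`. For `Λ i > 0` its values on `S` lie in `[a,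
  -- b]`: `hlow` gives the lower end, boundedness of the families the upper one.
  set q : ι → V → ℝ := fun i v => ((Λ i)⁻¹ • fderiv ℝ (Ψ i) v) (X i v) with hq
  have hqb : BoundedFamily q := hdΨ.clm_apply hX
  obtain ⟨b, hb, hqle⟩ := hqb.norm_le
  obtain ⟨h, h1, h2, h3⟩ := exists_contDiff_inv ha b
  have hhq : BoundedFamily (fun i v => h (q i v)) :=
    (boundedFamily_of_hasCompactSupport (ι := ι) h1 h2).comp hqb.boundedDeriv
  have hY : BoundedFamily (fun i v => h (q i v) • X i v) := hhq.smul hX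
  -- The field `Y = h(q) X` is normalized so that the phase grows along it at the exact rate `Λ i`
  -- on `S`.
  have hdY : ∀ i, 0 < Λ i → ∀ v ∈ S, fderiv ℝ (Ψ i) v (h (q i v) • X i v) = Λ i := by
    intro i hi v hv
    have hqv : q i v = (Λ i)⁻¹ * fderiv ℝ (Ψ i) v (X i v) := by simp [hq]
    have hlo : a ≤ q i v := by
      rw [hqv, ← div_eq_inv_mul, le_div_iff₀ hi]
      exact hlow i v hv
    have hhi : q i v ≤ b := (le_abs_self _).trans (hqle i v)
    have := h3 _ hlo hhi
    rw [map_smul, smul_eq_mul]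
    have e : fderiv ℝ (Ψ i) v (X i v) = Λ i * q i v := by
      rw [hqv]; field_simp
    rw [e]
    linear_combination Λ i * this
  let e := Module.finBasis ℝ V
  induction N with
  | zero =>
    intro A hA hAS
    obtain ⟨C, hC, hb⟩ := hA.norm_le
    refine ⟨C * volume.real S, by positivity, fun i => ?_⟩
    simpa using norm_integral_phase_mul_le hS (hb i) (hAS i)
  | succ N ih =>
    intro A hA hAS
    -- This is `div (A Y)` in coordinates. Integration by parts turns `Λ ∫ e^{iΨ} A` into `∫ e^{iΨ}
    -- A'` up to a unimodular factor, and `A'` is again a bounded family vanishing off `S`. The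
    -- induction therefore has to run over all amplitudes at once.
    set A' : ι → V → ℂ := fun i v =>
      ∑ s, fderiv ℝ (fun w => e.coord s (h (q i w) • X i w) • A i w) v (e s) with hA'
    have hA'b : BoundedFamily A' := by
      refine WeightedFamily.sum _ fun s _ => ?_
      have h1 : BoundedFamily (fun i w => e.coord s (h (q i w) • X i w)) :=
        WeightedFamily.clm hY (LinearMap.toContinuousLinearMap (e.coord s))
      exact WeightedFamily.clm (WeightedFamily.fderiv (h1.smul hA))
        (ContinuousLinearMap.apply ℝ ℂ (e s))
    have hA'S : ∀ i, ∀ v ∉ S, A' i v = 0 := by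
      intro i v hv
      refine Finset.sum_eq_zero fun s _ => ?_
      have : fderiv ℝ (fun w => e.coord s (h (q i w) • X i w) • A i w) v = 0 := by
        have : (fun w => e.coord s (h (q i w) • X i w) • A i w) =ᶠ[𝓝 v] fun _ => 0 := by
          filter_upwards [hS.isClosed.isOpen_compl.mem_nhds hv] with w hw
          rw [hAS i w hw, smul_zero]
        rw [this.fderiv_eq]
        simp
      rw [this]
      simp
    obtain ⟨C, hC, hb⟩ := ih A' hA'b hA'S
    refine ⟨C, hC, fun i => ?_⟩
    -- For `Λ i = 0` the factor `Λ i ^ (N + 1)` vanishes and no integration by parts is needed.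
    rcases (hΛ i).eq_or_lt with h0 | hpos
    · rw [← h0]; simpa using hC
    refine le_trans (le_of_eq ?_) (hb i)
    have := integral_phase_mul_divergence hS (hΨ i) (hA.contDiff i) (hAS i) e (hY.contDiff i)
    rw [this, norm_neg, pow_succ, mul_assoc]
    congr 1
    have : ∀ v, Complex.exp (Complex.I * (Ψ i v : ℂ)) *
        (Complex.I * (fderiv ℝ (Ψ i) v (h (q i v) • X i v) : ℂ) * A i v) =
        (Complex.I * (Λ i : ℂ)) * (Complex.exp (Complex.I * (Ψ i v : ℂ)) * A i v) := by
      intro v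
      by_cases hv : v ∈ S
      · rw [hdY i hpos v hv]; ring
      · rw [hAS i v hv]; ring
    simp_rw [this]
    rw [integral_const_mul, norm_mul, norm_mul]
    simp [abs_of_pos hpos]

/-- Orders `0` and `N` combine through `(1 + Λ)^N ≤ 2^(N-1) (1 + Λ^N)`, so that small `Λ` is covered
as well. -/
theorem nonstationary_phase_one_add {S : Set V} (hS : IsCompact S) {a : ℝ} (ha : 0 < a)
    {Λ : ι → ℝ} (hΛ : ∀ i, 0 ≤ Λ i) {Ψ : ι → V → ℝ} (hΨ : ∀ i, ContDiff ℝ ∞ (Ψ i))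
    (hdΨ : BoundedFamily (fun i v => (Λ i)⁻¹ • fderiv ℝ (Ψ i) v)) {X : ι → V → V}
    (hX : BoundedFamily X) (hlow : ∀ i, ∀ v ∈ S, a * Λ i ≤ fderiv ℝ (Ψ i) v (X i v)) (N : ℕ)
    {A : ι → V → ℂ} (hA : BoundedFamily A) (hAS : ∀ i, ∀ v ∉ S, A i v = 0) :
    ∃ C : ℝ, 0 ≤ C ∧ ∀ i,
      (1 + Λ i) ^ N * ‖∫ v, Complex.exp (Complex.I * (Ψ i v : ℂ)) * A i v‖ ≤ C := by
  obtain ⟨C₀, hC₀, h₀⟩ := nonstationary_phase hS ha hΛ hΨ hdΨ hX hlow 0 A hA hAS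
  obtain ⟨C, hC, h⟩ := nonstationary_phase hS ha hΛ hΨ hdΨ hX hlow N A hA hAS
  refine ⟨2 ^ (N - 1) * (C₀ + C), by positivity, fun i => ?_⟩
  have h1 := add_pow_le (zero_le_one' ℝ) (hΛ i) N
  have h2 := h₀ i
  rw [pow_zero] at h2
  calc _ ≤ (2 ^ (N - 1) * (1 ^ N + Λ i ^ N)) *
        ‖∫ v, Complex.exp (Complex.I * (Ψ i v : ℂ)) * A i v‖ := by gcongr
    _ = 2 ^ (N - 1) * (1 * ‖∫ v, Complex.exp (Complex.I * (Ψ i v : ℂ)) * A i v‖ +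
        Λ i ^ N * ‖∫ v, Complex.exp (Complex.I * (Ψ i v : ℂ)) * A i v‖) := by ring
    _ ≤ _ := by gcongr; exact h i

end NonstationaryPhase

end NearField

namespace NearField

/-! ### From mixed partial derivatives to joint derivatives on a product -/

section MixedDerivatives

variable {E E' G : Type*} [NormedAddCommGroup E] [NormedSpace ℝ E]
  [NormedAddCommGroup E'] [NormedSpace ℝ E'] [NormedAddCommGroup G] [NormedSpace ℝ G]

theorem contDiff_iteratedFDeriv {F : E → G} (hF : ContDiff ℝ ∞ F) (l : ℕ) :
    ContDiff ℝ ∞ (iteratedFDeriv ℝ l F) :=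
  hF.iteratedFDeriv_right (m := ∞) (le_of_eq rfl)

theorem contDiff_fderiv_apply {F : E → G} (hF : ContDiff ℝ ∞ F) (v : E) :
    ContDiff ℝ ∞ (fun p => fderiv ℝ F p v) :=
  (hF.fderiv_right (m := ∞) (by simp)).clm_apply contDiff_const

theorem fderiv_fderiv_apply_comm {F : E → G} (hF : ContDiff ℝ ∞ F) (v w p : E) :
    fderiv ℝ (fun q => fderiv ℝ F q v) p w = fderiv ℝ (fun q => fderiv ℝ F q w) p v := by
  have hd : DifferentiableAt ℝ (fderiv ℝ F) p :=
    (hF.fderiv_right (m := ∞) (by simp)).differentiable (by simp) p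
  have e : ∀ u w, fderiv ℝ (fun q => fderiv ℝ F q u) p w = fderiv ℝ (fderiv ℝ F) p w u := by
    intro u w
    rw [fderiv_clm_apply hd (differentiableAt_const u)]
    simp
  rw [e, e]
  exact (hF.contDiffAt.isSymmSndFDerivAt
    (by simpa using (natCast_le_infty 2 : ((2 : ℕ) : WithTop ℕ∞) ≤ ∞))).eq w v

/-- The innermost direction of an iterated derivative can be split off. -/
theorem iteratedFDeriv_succ_apply_fderiv {F : E → G} (hF : ContDiff ℝ ∞ F) (l : ℕ) (p : E)
    (m : Fin (l + 1) → E) :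
    iteratedFDeriv ℝ (l + 1) F p m =
      iteratedFDeriv ℝ l (fun q => fderiv ℝ F q (m (Fin.last l))) p (Fin.init m) := by
  rw [iteratedFDeriv_succ_apply_right]
  have h := (ContinuousLinearMap.apply ℝ G (m (Fin.last l))).iteratedFDeriv_comp_left
    ((hF.fderiv_right (m := ∞) (by simp)).contDiffAt (x := p)) (natCast_le_infty l)
  exact (congrArg (fun t => t (Fin.init m)) h).symm

theorem iteratedFDeriv_apply_multilinear {j l : ℕ}
    {H : E → ContinuousMultilinearMap ℝ (fun _ : Fin l => E') G} (hH : ContDiff ℝ ∞ H) (x : E)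
    (a : Fin j → E) (b : Fin l → E') :
    iteratedFDeriv ℝ j (fun x' => H x' b) x a = iteratedFDeriv ℝ j H x a b := by
  have := (ContinuousMultilinearMap.apply ℝ (fun _ : Fin l => E') G b).iteratedFDeriv_comp_left
    hH.contDiffAt (natCast_le_infty j) (x := x)
  exact congrArg (fun t => t a) this

/-- The partial derivative is the full derivative of `F` at `(x, ξ)` pulled back along the inclusion
of the second factor, hence depends smoothly on `x`. -/
theorem contDiff_iteratedFDeriv_partial_snd {F : E × E' → G} (hF : ContDiff ℝ ∞ F) (l : ℕ)
    (ξ : E') : ContDiff ℝ ∞ (fun x => iteratedFDeriv ℝ l (fun ξ' => F (x, ξ')) ξ) := by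
  have h : ∀ x, iteratedFDeriv ℝ l (fun ξ' => F (x, ξ')) ξ =
      ContinuousMultilinearMap.compContinuousLinearMapL
        (fun _ : Fin l => ContinuousLinearMap.inr ℝ E E') (iteratedFDeriv ℝ l F (x, ξ)) := by
    intro x
    have e : (fun ξ' => F (x, ξ')) =
        (fun p => F ((x, 0) + p)) ∘ (ContinuousLinearMap.inr ℝ E E') := by
      ext ξ'; simp
    have h1 : ContDiff ℝ ∞ (fun p => F ((x, 0) + p)) := hF.comp (contDiff_const.add contDiff_id)
    rw [e, ContinuousLinearMap.iteratedFDeriv_comp_right _ h1 _ (natCast_le_infty l),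
      iteratedFDeriv_comp_add_left]
    simp
  simp_rw [h]
  exact ContinuousLinearMap.contDiff _ |>.comp
    ((contDiff_iteratedFDeriv hF l).comp (contDiff_id.prodMk contDiff_const))

theorem fderiv_partial_fst {F : E × E' → G} (hF : ContDiff ℝ ∞ F) (x : E) (ξ : E') (a : E) :
    fderiv ℝ (fun x' => F (x', ξ)) x a = fderiv ℝ F (x, ξ) (a, 0) := by
  have h : HasFDerivAt (fun x' : E => (x', ξ)) (ContinuousLinearMap.inl ℝ E E') x :=
    (hasFDerivAt_id x).prodMk (hasFDerivAt_const ξ x)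
  have := ((hF.differentiable (by simp) (x, ξ)).hasFDerivAt).comp x h
  rw [HasFDerivAt.fderiv (f := fun x' => F (x', ξ)) this]
  simp

theorem fderiv_partial_snd {F : E × E' → G} (hF : ContDiff ℝ ∞ F) (x : E) (ξ : E') (b : E') :
    fderiv ℝ (fun ξ' => F (x, ξ')) ξ b = fderiv ℝ F (x, ξ) (0, b) := by
  have h : HasFDerivAt (fun ξ' : E' => (x, ξ')) (ContinuousLinearMap.inr ℝ E E') ξ :=
    (hasFDerivAt_const x ξ).prodMk (hasFDerivAt_id ξ)
  have := ((hF.differentiable (by simp) (x, ξ)).hasFDerivAt).comp ξ h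
  rw [HasFDerivAt.fderiv (f := fun ξ' => F (x, ξ')) this]
  simp

theorem iteratedFDeriv_partial_snd_succ {F : E × E' → G} (hF : ContDiff ℝ ∞ F) (l : ℕ) (x : E)
    (ξ : E') (b : Fin (l + 1) → E') :
    iteratedFDeriv ℝ (l + 1) (fun ξ' => F (x, ξ')) ξ b =
      iteratedFDeriv ℝ l (fun ξ' => fderiv ℝ F (x, ξ') (0, b (Fin.last l))) ξ (Fin.init b) := by
  have h : ContDiff ℝ ∞ (fun ξ' => F (x, ξ')) := hF.comp (contDiff_const.prodMk contDiff_id)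
  rw [iteratedFDeriv_succ_apply_fderiv h]
  simp_rw [fderiv_partial_snd hF]

/-- A derivative in the first variable commutes with iterated derivatives in the second one. -/
theorem fderiv_iteratedFDeriv_partial_snd (l : ℕ) :
    ∀ {F : E × E' → G}, ContDiff ℝ ∞ F → ∀ (x : E) (ξ : E') (a : E) (b : Fin l → E'),
      fderiv ℝ (fun x' => iteratedFDeriv ℝ l (fun ξ' => F (x', ξ')) ξ b) x a =
        iteratedFDeriv ℝ l (fun ξ' => fderiv ℝ F (x, ξ') (a, 0)) ξ b := by
  induction l with
  | zero =>
    intro F hF x ξ a b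
    simpa using fderiv_partial_fst hF x ξ a
  | succ l ih =>
    intro F hF x ξ a b
    simp_rw [iteratedFDeriv_partial_snd_succ hF]
    rw [ih (contDiff_fderiv_apply hF _),
      iteratedFDeriv_partial_snd_succ (contDiff_fderiv_apply hF _)]
    congr 2
    ext ξ'
    exact fderiv_fderiv_apply_comm hF _ _ _

/-- The `j`-th derivative in the first variable of the `l`-th derivative in the second variable
has norm at most `M` as a multilinear form. -/
def MixedBound (F : E × E' → G) (j l : ℕ) (p : E × E') (M : ℝ) : Prop :=
  ∀ (a : Fin j → E) (b : Fin l → E'),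
    ‖iteratedFDeriv ℝ j (fun x' => iteratedFDeriv ℝ l (fun ξ' => F (x', ξ')) p.2 b) p.1 a‖ ≤
      M * (∏ i, ‖a i‖) * ∏ i, ‖b i‖

/-- Passing to fixed vectors keeps all functions `G`-valued, so that directions can be peeled off
one at a time afterwards. -/
theorem mixedBound_of_norm_le {F : E × E' → G} (hF : ContDiff ℝ ∞ F) {j l : ℕ} {p : E × E'}
    {M : ℝ}
    (h : ‖iteratedFDeriv ℝ j (fun x' => iteratedFDeriv ℝ l (fun ξ' => F (x', ξ')) p.2) p.1‖ ≤ M) :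
    MixedBound F j l p M := by
  intro a b
  rw [iteratedFDeriv_apply_multilinear (contDiff_iteratedFDeriv_partial_snd hF l p.2)]
  refine (ContinuousMultilinearMap.le_opNorm _ b).trans ?_
  gcongr
  refine (ContinuousMultilinearMap.le_opNorm _ a).trans ?_
  gcongr

theorem MixedBound.fderiv_snd {F : E × E' → G} (hF : ContDiff ℝ ∞ F) {j l : ℕ} {p : E × E'}
    {M : ℝ} (h : MixedBound F j (l + 1) p M) (b₀ : E') :
    MixedBound (fun q => fderiv ℝ F q (0, b₀)) j l p (M * ‖b₀‖) := by
  intro a b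
  -- The new direction goes last, because the last slot of the iterated derivative is the one
  -- applied first.
  have := h a (Fin.snoc b b₀)
  simp_rw [iteratedFDeriv_partial_snd_succ hF] at this
  simp only [Fin.snoc_last, Fin.init_snoc, Fin.prod_univ_castSucc, Fin.snoc_castSucc] at this
  exact this.trans (le_of_eq (by ring))

theorem MixedBound.fderiv_fst {F : E × E' → G} (hF : ContDiff ℝ ∞ F) {j l : ℕ} {p : E × E'}
    {M : ℝ} (h : MixedBound F (j + 1) l p M) (a₀ : E) :
    MixedBound (fun q => fderiv ℝ F q (a₀, 0)) j l p (M * ‖a₀‖) := by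
  intro a b
  have := h (Fin.snoc a a₀) b
  have hs : ContDiff ℝ ∞ (fun x' => iteratedFDeriv ℝ l (fun ξ' => F (x', ξ')) p.2 b) :=
    (ContinuousMultilinearMap.apply ℝ (fun _ : Fin l => E') G b).contDiff.comp
      (contDiff_iteratedFDeriv_partial_snd hF l p.2)
  rw [iteratedFDeriv_succ_apply_fderiv hs] at this
  simp_rw [fderiv_iteratedFDeriv_partial_snd l hF] at this
  simp only [Fin.snoc_last, Fin.init_snoc, Fin.prod_univ_castSucc, Fin.snoc_castSucc] at this
  exact this.trans (le_of_eq (by ring))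

/-- Induction on the order: the innermost direction is split as `(a, 0) + (0, b)`, and each half
consumes one `x`- or one `ξ`-derivative of the mixed bounds. Each splitting costs a factor `2`. -/
theorem norm_iteratedFDeriv_apply_le_of_mixedBound (N : ℕ) :
    ∀ {F : E × E' → G}, ContDiff ℝ ∞ F → ∀ (p : E × E') (M : ℝ), 0 ≤ M →
      (∀ j l, j + l = N → MixedBound F j l p M) → ∀ v : Fin N → E × E',
      ‖iteratedFDeriv ℝ N F p v‖ ≤ 2 ^ N * M * ∏ i, ‖v i‖ := by
  induction N with
  | zero =>
    intro F _ p M _ h v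
    have := h 0 0 rfl ![] ![]
    simpa using this
  | succ N ih =>
    intro F hF p M hM h v
    rw [iteratedFDeriv_succ_apply_fderiv hF]
    obtain ⟨a, b, hv⟩ : ∃ a b, v (Fin.last N) = (a, b) := ⟨_, _, rfl⟩
    rw [hv]
    have e : (fun q => fderiv ℝ F q (a, b)) =
        (fun q => fderiv ℝ F q (a, 0)) + fun q => fderiv ℝ F q (0, b) := by
      ext q
      simp [← map_add]
    rw [e, iteratedFDeriv_add_apply
      ((contDiff_fderiv_apply hF _).contDiffAt.of_le (natCast_le_infty N))
      ((contDiff_fderiv_apply hF _).contDiffAt.of_le (natCast_le_infty N))]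
    have ha := ih (contDiff_fderiv_apply hF (a, (0 : E'))) p (M * ‖a‖) (by positivity)
      (fun j l hjl => (h _ _ (by omega)).fderiv_fst hF a) (Fin.init v)
    have hb := ih (contDiff_fderiv_apply hF ((0 : E), b)) p (M * ‖b‖) (by positivity)
      (fun j l hjl => (h _ _ (by omega)).fderiv_snd hF b) (Fin.init v)
    have ha' : ‖a‖ ≤ ‖v (Fin.last N)‖ := by rw [hv]; exact norm_fst_le (a, b)
    have hb' : ‖b‖ ≤ ‖v (Fin.last N)‖ := by rw [hv]; exact norm_snd_le (a, b)
    have hP : (0 : ℝ) ≤ ∏ i, ‖Fin.init v i‖ := Finset.prod_nonneg fun i _ => norm_nonneg _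
    rw [Fin.prod_univ_castSucc]
    have e2 : ∏ i : Fin N, ‖v i.castSucc‖ = ∏ i, ‖Fin.init v i‖ := rfl
    rw [e2]
    calc _ ≤ 2 ^ N * (M * ‖a‖) * (∏ i, ‖Fin.init v i‖) +
          2 ^ N * (M * ‖b‖) * ∏ i, ‖Fin.init v i‖ := (norm_add_le _ _).trans (add_le_add ha hb)
      _ ≤ 2 ^ N * (M * ‖v (Fin.last N)‖) * (∏ i, ‖Fin.init v i‖) +
          2 ^ N * (M * ‖v (Fin.last N)‖) * ∏ i, ‖Fin.init v i‖ := by gcongr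
      _ = _ := by ring

/-- Joint derivatives are controlled by mixed partial derivatives. -/
theorem norm_iteratedFDeriv_le_of_mixedBound (N : ℕ) {F : E × E' → G} (hF : ContDiff ℝ ∞ F)
    {p : E × E'} {M : ℝ} (hM : 0 ≤ M) (h : ∀ j l, j + l = N → MixedBound F j l p M) :
    ‖iteratedFDeriv ℝ N F p‖ ≤ 2 ^ N * M :=
  ContinuousMultilinearMap.opNorm_le_bound (by positivity)
    (norm_iteratedFDeriv_apply_le_of_mixedBound N hF p M hM h)

/-- Each derivative in the second variable brings out one factor `K`. -/
theorem MixedBound.comp_smul {F : E × E' → G} (hF : ContDiff ℝ ∞ F) {K : ℝ} (hK : 0 ≤ K)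
    {j l : ℕ} {p : E × E'} {M : ℝ} (h : MixedBound F j l (p.1, K • p.2) M) :
    MixedBound (fun q : E × E' => F (q.1, K • q.2)) j l p (K ^ l * M) := by
  intro a b
  have h1 : ∀ x', iteratedFDeriv ℝ l (fun ξ' => F (x', K • ξ')) p.2 b =
      K ^ l • iteratedFDeriv ℝ l (fun ξ' => F (x', ξ')) (K • p.2) b := by
    intro x'
    have h1 : ContDiff ℝ l (fun ξ' => F (x', ξ')) :=
      (hF.comp (contDiff_const.prodMk contDiff_id)).of_le (natCast_le_infty l)
    exact congrArg (fun t => t b)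
      (congrFun (iteratedFDeriv_comp_const_smul (f := fun ξ' => F (x', ξ')) K h1) p.2)
  simp_rw [h1]
  have hs : ContDiff ℝ ∞ (fun x' => iteratedFDeriv ℝ l (fun ξ' => F (x', ξ')) (K • p.2) b) :=
    (ContinuousMultilinearMap.apply ℝ (fun _ : Fin l => E') G b).contDiff.comp
      (contDiff_iteratedFDeriv_partial_snd hF l (K • p.2))
  rw [iteratedFDeriv_const_smul_apply' (hs.contDiffAt.of_le (natCast_le_infty j))]
  rw [smul_apply, norm_smul, Real.norm_of_nonneg (by positivity)]
  calc _ ≤ K ^ l * (M * (∏ i, ‖a i‖) * ∏ i, ‖b i‖) := by gcongr; exact h a b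
    _ = _ := by ring

end MixedDerivatives

/-! ### Rescaled symbols -/

section Symbols

variable {n : ℕ}

/-- The factor `K^l` from dilating the frequency meets the gain `(1 + K|η|)^(-l)` of the symbol
class, and on the region `c₀ K ≤ 1 + K|η|` their product is at most `c₀^(-l)`. The constant is thus
independent of `K`. With `c₀ = K = 1` the region is everything; for large `K` it contains `|η| ≥
c₀`. -/
theorem exists_norm_iteratedFDeriv_symbol_le {r : ℝ}
    {c : EuclideanSpace ℝ (Fin n) → EuclideanSpace ℝ (Fin n) → ℂ} (hc : IsSymbol r c)
    {c₀ : ℝ} (hc₀ : 0 < c₀) (hc₁ : c₀ ≤ 1) (N : ℕ) : ∃ C : ℝ, 0 ≤ C ∧ ∀ K : ℝ, 0 < K →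
      ∀ p : EuclideanSpace ℝ (Fin n) × EuclideanSpace ℝ (Fin n), c₀ * K ≤ 1 + K * ‖p.2‖ →
      ‖iteratedFDeriv ℝ N
        (fun q : EuclideanSpace ℝ (Fin n) × EuclideanSpace ℝ (Fin n) => c q.1 (K • q.2)) p‖ ≤
        C * (1 + K * ‖p.2‖) ^ r := by
  choose C hC hb using hc.bound
  set C₀ := ∑ j ∈ Finset.range (N + 1), ∑ l ∈ Finset.range (N + 1), C j l with hC₀
  have hC₀' : 0 ≤ C₀ := Finset.sum_nonneg fun j _ => Finset.sum_nonneg fun l _ => (hC j l).le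
  refine ⟨2 ^ N * (C₀ * c₀⁻¹ ^ N), by positivity, fun K hK p hp => ?_⟩
  have hpos : 0 < 1 + K * ‖p.2‖ := by positivity
  rw [mul_assoc]
  have hF := hc.contDiff
  set F : EuclideanSpace ℝ (Fin n) × EuclideanSpace ℝ (Fin n) → ℂ := fun p => c p.1 p.2 with hFdef
  have hFK : ContDiff ℝ ∞
      (fun q : EuclideanSpace ℝ (Fin n) × EuclideanSpace ℝ (Fin n) => F (q.1, K • q.2)) :=
    hF.comp (contDiff_fst.prodMk (contDiff_snd.const_smul K))
  refine norm_iteratedFDeriv_le_of_mixedBound N hFK (by positivity) fun j l hjl => ?_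
  have h1 : MixedBound F j l (p.1, K • p.2) (C j l * (1 + ‖K • p.2‖) ^ (r - (l : ℝ))) :=
    mixedBound_of_norm_le hF (hb j l p.1 (K • p.2))
  have h2 := h1.comp_smul hF hK.le
  intro a b
  refine (h2 a b).trans (mul_le_mul_of_nonneg_right (mul_le_mul_of_nonneg_right ?_
    (Finset.prod_nonneg fun i _ => norm_nonneg _)) (Finset.prod_nonneg fun i _ => norm_nonneg _))
  rw [norm_smul, Real.norm_of_nonneg hK.le, Real.rpow_sub hpos, Real.rpow_natCast]
  have h3 : C j l ≤ C₀ := by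
    have h4 : C j l ≤ ∑ l ∈ Finset.range (N + 1), C j l :=
      Finset.single_le_sum (f := fun l => C j l) (fun l _ => (hC j l).le) (by simp; omega)
    exact h4.trans (Finset.single_le_sum (f := fun j => ∑ l ∈ Finset.range (N + 1), C j l)
      (fun j _ => Finset.sum_nonneg fun l _ => (hC j l).le) (by simp; omega))
  have h5 : K ^ l / (1 + K * ‖p.2‖) ^ l ≤ c₀⁻¹ ^ N := by
    rw [← div_pow]
    calc (K / (1 + K * ‖p.2‖)) ^ l ≤ c₀⁻¹ ^ l := by
          gcongr
          rw [div_le_iff₀ hpos, ← div_eq_inv_mul, le_div_iff₀ hc₀]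
          linarith
      _ ≤ c₀⁻¹ ^ N := pow_le_pow_right₀ ((one_le_inv₀ hc₀).2 hc₁) (by omega)
  calc K ^ l * (C j l * ((1 + K * ‖p.2‖) ^ r / (1 + K * ‖p.2‖) ^ l))
      = C j l * (K ^ l / (1 + K * ‖p.2‖) ^ l) * (1 + K * ‖p.2‖) ^ r := by ring
    _ ≤ C₀ * c₀⁻¹ ^ N * (1 + K * ‖p.2‖) ^ r := by
        have := (hC j l).le
        gcongr
    _ = _ := by ring

end Symbols

end NearField

namespace NearField

/-- Euclidean space of dimension `n`. -/
abbrev Eu (n : ℕ) : Type := EuclideanSpace ℝ (Fin n)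

/-! ### Size, decay and continuity of the regularized kernels -/

section KernelBounds

variable {n : ℕ} {r : ℝ} {c : Eu n → Eu n → ℂ} {χ : Eu n → ℝ}

theorem norm_cexp_I_mul_ofReal (t : ℝ) : ‖Complex.exp (Complex.I * (t : ℂ))‖ = 1 := by
  rw [mul_comm, Complex.norm_exp_ofReal_mul_I]

theorem IsSymbol.contDiff_right (hc : IsSymbol r c) (z : Eu n) : ContDiff ℝ ∞ (c z) :=
  hc.contDiff.comp (contDiff_const.prodMk contDiff_id)

theorem IsSymbol.continuous (hc : IsSymbol r c) : Continuous (fun p : Eu n × Eu n => c p.1 p.2) :=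
  hc.contDiff.continuous

theorem IsSymbol.exists_norm_le (hc : IsSymbol r c) :
    ∃ C : ℝ, 0 ≤ C ∧ ∀ z ξ, ‖c z ξ‖ ≤ C * (1 + ‖ξ‖) ^ r := by
  obtain ⟨C, hC, h⟩ := hc.bound 0 0
  exact ⟨C, hC.le, fun z ξ => by simpa using h z ξ⟩

theorem IsSymbol.exists_norm_iteratedFDeriv_le (hc : IsSymbol r c) (l : ℕ) :
    ∃ C : ℝ, 0 ≤ C ∧ ∀ z ξ, ‖iteratedFDeriv ℝ l (c z) ξ‖ ≤ C * (1 + ‖ξ‖) ^ (r - l) := by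
  obtain ⟨C, hC, h⟩ := hc.bound 0 l
  exact ⟨C, hC.le, fun z ξ => by simpa using h z ξ⟩

theorem IsCutoff.exists_radius (hχ : IsCutoff χ) :
    ∃ R : ℝ, 0 < R ∧ ∀ ξ, ξ ∈ tsupport χ → ‖ξ‖ ≤ R := by
  obtain ⟨R, hR⟩ := hχ.hasCompactSupport.isCompact.isBounded.exists_norm_le
  exact ⟨max R 1, by positivity, fun ξ hξ => (hR ξ hξ).trans (le_max_left _ _)⟩

theorem IsCutoff.exists_norm_le (hχ : IsCutoff χ) : ∃ B : ℝ, 0 ≤ B ∧ ∀ ξ, |χ ξ| ≤ B := by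
  obtain ⟨B, hB⟩ := hχ.contDiff.continuous.bounded_above_of_compact_support hχ.hasCompactSupport
  exact ⟨B, (norm_nonneg _).trans (hB 0), hB⟩

/-- The regularized symbol `χ(ε ξ) c(z, ξ)`. -/
def regSymbol {n : ℕ} (c : Eu n → Eu n → ℂ) (χ : Eu n → ℝ) (ε : ℝ) (z ξ : Eu n) : ℂ :=
  ((χ (ε • ξ) : ℝ) : ℂ) * c z ξ

theorem regKernel_eq (ε : ℝ) (z₁ z₂ : Eu n) :
    regKernel c χ ε z₁ z₂ = ∫ ξ : Eu n,
      Complex.exp (Complex.I * ((inner ℝ (z₁ - z₂) ξ : ℝ) : ℂ)) * regSymbol c χ ε z₁ ξ := by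
  simp only [regKernel, regSymbol, mul_assoc]

theorem contDiff_cutoff_smul (hχ : IsCutoff χ) (ε : ℝ) : ContDiff ℝ ∞ (fun ξ => χ (ε • ξ)) :=
  hχ.contDiff.comp (contDiff_id.const_smul ε)

theorem contDiff_regSymbol (hc : IsSymbol r c) (hχ : IsCutoff χ) (ε : ℝ) :
    ContDiff ℝ ∞ (fun p : Eu n × Eu n => regSymbol c χ ε p.1 p.2) :=
  (Complex.ofRealCLM.contDiff.comp ((contDiff_cutoff_smul hχ ε).comp contDiff_snd)).mul hc.contDiff

theorem contDiff_regSymbol_right (hc : IsSymbol r c) (hχ : IsCutoff χ) (ε : ℝ) (z : Eu n) :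
    ContDiff ℝ ∞ (regSymbol c χ ε z) :=
  (contDiff_regSymbol hc hχ ε).comp (contDiff_const.prodMk contDiff_id)

theorem regSymbol_eq_zero {R : ℝ} (hR : ∀ ξ, ξ ∈ tsupport χ → ‖ξ‖ ≤ R) {ε : ℝ} (hε : 0 < ε)
    (z : Eu n) {ξ : Eu n} (hξ : ξ ∉ Metric.closedBall 0 (R / ε)) : regSymbol c χ ε z ξ = 0 := by
  have : χ (ε • ξ) = 0 := by
    by_contra h
    apply hξ
    have := hR _ (subset_tsupport χ h)
    rw [norm_smul, Real.norm_of_nonneg hε.le] at this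
    rw [mem_closedBall_zero_iff, le_div_iff₀ hε]
    linarith
  simp [regSymbol, this]

/-- The dilates `χ(ε ξ)` are symbols of order `0` uniformly in `ε ≤ ε₀`: on the support `ε|ξ| ≤ R`,
so `ε (1 + |ξ|) ≤ ε₀ + R` and each factor `ε` is worth one power of `(1 + |ξ|)^(-1)`. -/
theorem exists_norm_iteratedFDeriv_regSymbol_le (hc : IsSymbol r c) (hχ : IsCutoff χ) {ε₀ : ℝ}
    (hε₀ : 0 < ε₀) (N : ℕ) : ∃ C : ℝ, 0 ≤ C ∧ ∀ ε, 0 < ε → ε ≤ ε₀ → ∀ z ξ : Eu n,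
      ‖iteratedFDeriv ℝ N (regSymbol c χ ε z) ξ‖ ≤ C * (1 + ‖ξ‖) ^ (r - N) := by
  obtain ⟨R, hR, hRχ⟩ := hχ.exists_radius
  have hχb : ∀ i : ℕ, ∃ B : ℝ, 0 ≤ B ∧ ∀ ξ, ‖iteratedFDeriv ℝ i χ ξ‖ ≤ B := fun i => by
    obtain ⟨B, hB, h⟩ := (boundedFamily_of_hasCompactSupport (ι := Unit) hχ.contDiff
      hχ.hasCompactSupport).bound i
    exact ⟨B, hB, fun ξ => by simpa using h () ξ⟩
  choose B hB hBχ using hχb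
  choose C hC hCc using hc.exists_norm_iteratedFDeriv_le
  refine ⟨∑ i ∈ Finset.range (N + 1), (N.choose i : ℝ) * (B i * (ε₀ + R) ^ i) * C (N - i),
    Finset.sum_nonneg fun i _ => ?_, fun ε hε hεε₀ z ξ => ?_⟩
  · have := hB i
    have := hC (N - i)
    positivity
  have hχs : ContDiff ℝ ∞ (fun ξ => χ (ε • ξ)) := contDiff_cutoff_smul hχ ε
  have e : regSymbol c χ ε z = fun ξ => ContinuousLinearMap.lsmul ℝ ℝ (χ (ε • ξ)) (c z ξ) := by
    ext ξ
    simp [regSymbol]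
  have hn : ‖(ContinuousLinearMap.lsmul ℝ ℝ : ℝ →L[ℝ] ℂ →L[ℝ] ℂ)‖ ≤ 1 :=
    ContinuousLinearMap.opNorm_lsmul_le
  rw [e]
  refine (ContinuousLinearMap.norm_iteratedFDeriv_le_of_bilinear_of_le_one _ hχs
    (hc.contDiff_right z) ξ (natCast_le_infty N) hn).trans ?_
  rw [Finset.sum_mul]
  refine Finset.sum_le_sum fun i hi => ?_
  have hpos : 0 < 1 + ‖ξ‖ := by positivity
  have h1 : ‖iteratedFDeriv ℝ i (fun ξ => χ (ε • ξ)) ξ‖ ≤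
      B i * (ε₀ + R) ^ i * (1 + ‖ξ‖) ^ (-(i : ℝ)) := by
    rw [congrFun (iteratedFDeriv_comp_const_smul (f := χ) ε
      (hχ.contDiff.of_le (natCast_le_infty i))) ξ]
    by_cases hξ : ε • ξ ∈ tsupport χ
    · have h2 := hRχ _ hξ
      rw [norm_smul, Real.norm_of_nonneg hε.le] at h2
      rw [norm_smul, Real.norm_of_nonneg (by positivity), Real.rpow_neg hpos.le,
        Real.rpow_natCast, ← div_eq_mul_inv, le_div_iff₀ (by positivity)]
      calc ε ^ i * ‖iteratedFDeriv ℝ i χ (ε • ξ)‖ * (1 + ‖ξ‖) ^ i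
          = ‖iteratedFDeriv ℝ i χ (ε • ξ)‖ * (ε * (1 + ‖ξ‖)) ^ i := by rw [mul_pow]; ring
        _ ≤ B i * (ε₀ + R) ^ i := by
            have := hB i
            gcongr
            · exact hBχ i _
            · linarith
    · have : iteratedFDeriv ℝ i χ (ε • ξ) = 0 := by
        by_contra h0
        exact hξ (support_iteratedFDeriv_subset (𝕜 := ℝ) i h0)
      rw [this]
      have := hB i
      simp only [smul_zero, norm_zero]
      positivity
  have h3 : (r - ((N - i : ℕ) : ℝ)) = (r - N) + i := by
    rw [Nat.cast_sub (by simpa [Nat.lt_succ_iff] using hi)]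
    ring
  calc _ ≤ (N.choose i : ℝ) * (B i * (ε₀ + R) ^ i * (1 + ‖ξ‖) ^ (-(i : ℝ))) *
        (C (N - i) * (1 + ‖ξ‖) ^ (r - ((N - i : ℕ) : ℝ))) := by
        have := hB i
        gcongr
        exact hCc (N - i) z ξ
    _ = (N.choose i : ℝ) * (B i * (ε₀ + R) ^ i) * C (N - i) *
        ((1 + ‖ξ‖) ^ (-(i : ℝ)) * (1 + ‖ξ‖) ^ (r - ((N - i : ℕ) : ℝ))) := by ring
    _ = _ := by
        rw [← Real.rpow_add hpos, h3]
        congr 2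
        ring

/-- `M` integrations by parts in the direction `y` itself; each one differentiates `y·ξ` along `y`,
which gives `|y|²`. -/
theorem integral_cexp_inner_mul_iteratedFDeriv (y : Eu n) (M : ℕ) :
    ∀ {f : Eu n → ℂ}, ContDiff ℝ ∞ f → HasCompactSupport f →
      ∫ ξ, Complex.exp (Complex.I * ((inner ℝ y ξ : ℝ) : ℂ)) *
        iteratedFDeriv ℝ M f ξ (fun _ => y) =
      (-(Complex.I * ((‖y‖ ^ 2 : ℝ) : ℂ))) ^ M *
        ∫ ξ, Complex.exp (Complex.I * ((inner ℝ y ξ : ℝ) : ℂ)) * f ξ := by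
  induction M with
  | zero => intro f _ _; simp
  | succ M ih =>
    intro f hf hfc
    have hΨ : ContDiff ℝ ∞ (fun ξ : Eu n => (inner ℝ y ξ : ℝ)) := (innerSL ℝ y).contDiff
    have hd : ∀ ξ : Eu n, fderiv ℝ (fun ξ : Eu n => (inner ℝ y ξ : ℝ)) ξ y = ‖y‖ ^ 2 := by
      intro ξ
      have : fderiv ℝ (fun ξ : Eu n => (inner ℝ y ξ : ℝ)) ξ = innerSL ℝ y :=
        (innerSL ℝ y).hasFDerivAt.fderiv
      rw [this]
      simp
    simp_rw [iteratedFDeriv_succ_apply_fderiv hf]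
    have hconst : (Fin.init fun _ : Fin (M + 1) => y) = fun _ => y := rfl
    rw [hconst, ih (contDiff_fderiv_apply hf y) (hfc.fderiv_apply ℝ y),
      (integral_phase_mul_fderiv hΨ hf hfc y).2.2]
    simp_rw [hd]
    have : ∀ ξ : Eu n, Complex.exp (Complex.I * ((inner ℝ y ξ : ℝ) : ℂ)) *
        (Complex.I * ((‖y‖ ^ 2 : ℝ) : ℂ) * f ξ) = (Complex.I * ((‖y‖ ^ 2 : ℝ) : ℂ)) *
        (Complex.exp (Complex.I * ((inner ℝ y ξ : ℝ) : ℂ)) * f ξ) := fun ξ => by ring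
    simp_rw [this]
    rw [integral_const_mul]
    ring

theorem norm_pow_mul_norm_integral_cexp_inner_le (y : Eu n) (M : ℕ) {f : Eu n → ℂ}
    (hf : ContDiff ℝ ∞ f) (hfc : HasCompactSupport f) :
    ‖y‖ ^ M * ‖∫ ξ, Complex.exp (Complex.I * ((inner ℝ y ξ : ℝ) : ℂ)) * f ξ‖ ≤
      ∫ ξ, ‖iteratedFDeriv ℝ M f ξ‖ := by
  have hintg : Integrable (fun ξ => ‖iteratedFDeriv ℝ M f ξ‖) :=
    (hf.continuous_iteratedFDeriv (natCast_le_infty M)).norm.integrable_of_hasCompactSupport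
      (hfc.iteratedFDeriv M).norm
  rcases M.eq_zero_or_pos with rfl | hM
  · simp only [pow_zero, one_mul, norm_iteratedFDeriv_zero]
    refine (norm_integral_le_integral_norm _).trans (le_of_eq ?_)
    simp_rw [norm_mul, norm_cexp_I_mul_ofReal, one_mul]
  rcases (norm_nonneg y).eq_or_lt with hy | hy
  · rw [← hy, zero_pow hM.ne', zero_mul]
    exact integral_nonneg fun ξ => norm_nonneg _
  have h1 := congrArg norm (integral_cexp_inner_mul_iteratedFDeriv y M hf hfc)
  rw [norm_mul, norm_pow, norm_neg, norm_mul, Complex.norm_I, one_mul, Complex.norm_real,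
    norm_pow, norm_norm] at h1
  have h2 : ‖∫ ξ, Complex.exp (Complex.I * ((inner ℝ y ξ : ℝ) : ℂ)) *
      iteratedFDeriv ℝ M f ξ (fun _ => y)‖ ≤ ∫ ξ, ‖y‖ ^ M * ‖iteratedFDeriv ℝ M f ξ‖ := by
    refine norm_integral_le_of_norm_le (hintg.const_mul _) (.of_forall fun ξ => ?_)
    rw [norm_mul, norm_cexp_I_mul_ofReal, one_mul, mul_comm]
    simpa using (iteratedFDeriv ℝ M f ξ).le_opNorm (fun _ => y)
  -- The left side carries `|y|^(2M)` and the right side `|y|^M`; one factor `|y|^M` cancels since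
  -- `y ≠ 0`.
  rw [h1, integral_const_mul, ← pow_mul, mul_comm 2 M, pow_mul, sq, mul_assoc] at h2
  exact le_of_mul_le_mul_left h2 (by positivity)

theorem integrable_one_add_norm_rpow {s : ℝ} (hs : s < -n) :
    Integrable (fun ξ : Eu n => (1 + ‖ξ‖) ^ s) := by
  have := integrable_one_add_norm (E := Eu n) (μ := volume) (r := -s)
    (by simp; linarith)
  simpa using this

theorem hasCompactSupport_regSymbol (hχ : IsCutoff χ) {ε : ℝ} (hε : 0 < ε) (z : Eu n) :
    HasCompactSupport (regSymbol c χ ε z) := by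
  obtain ⟨R, hR, hRχ⟩ := hχ.exists_radius
  exact hasCompactSupport_of_forall_notMem (isCompact_closedBall 0 (R / ε))
    fun ξ hξ => regSymbol_eq_zero hRχ hε z hξ

/-- `M > r + n` makes the `M`-th frequency derivative of the symbol integrable. The resulting decay
off the diagonal is uniform in `ε`, unlike the sup bound below. -/
theorem exists_norm_pow_mul_norm_regKernel_le (hc : IsSymbol r c) (hχ : IsCutoff χ) {ε₀ : ℝ}
    (hε₀ : 0 < ε₀) {M : ℕ} (hM : r + n < M) : ∃ C : ℝ, 0 ≤ C ∧ ∀ ε, 0 < ε → ε ≤ ε₀ →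
      ∀ z₁ z₂ : Eu n, ‖z₁ - z₂‖ ^ M * ‖regKernel c χ ε z₁ z₂‖ ≤ C := by
  obtain ⟨C, hC, h⟩ := exists_norm_iteratedFDeriv_regSymbol_le hc hχ hε₀ M
  have hi := integrable_one_add_norm_rpow (n := n) (s := r - M) (by linarith)
  refine ⟨C * ∫ ξ : Eu n, (1 + ‖ξ‖) ^ (r - M),
    mul_nonneg hC (integral_nonneg fun ξ => by positivity), fun ε hε hεε₀ z₁ z₂ => ?_⟩
  rw [regKernel_eq]
  refine (norm_pow_mul_norm_integral_cexp_inner_le _ M (contDiff_regSymbol_right hc hχ ε z₁)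
    (hasCompactSupport_regSymbol hχ hε z₁)).trans ?_
  rw [← integral_const_mul]
  refine integral_mono_of_nonneg (.of_forall fun ξ => norm_nonneg _) (hi.const_mul C)
    (.of_forall fun ξ => h ε hε hεε₀ z₁ ξ)

theorem continuous_cexp_inner {X : Type*} [TopologicalSpace X] {f g : X → Eu n}
    (hf : Continuous f) (hg : Continuous g) :
    Continuous (fun x => Complex.exp (Complex.I * ((inner ℝ (f x) (g x) : ℝ) : ℂ))) :=
  Complex.continuous_exp.comp
    (continuous_const.mul (Complex.continuous_ofReal.comp (hf.inner hg)))

theorem continuous_regKernel (hc : IsSymbol r c) (hχ : IsCutoff χ) {ε : ℝ} (hε : 0 < ε) :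
    Continuous (fun z : Eu n × Eu n => regKernel c χ ε z.1 z.2) := by
  obtain ⟨R, hR, hRχ⟩ := hχ.exists_radius
  have e : (fun z : Eu n × Eu n => regKernel c χ ε z.1 z.2) = fun z : Eu n × Eu n =>
      ∫ ξ in Metric.closedBall (0 : Eu n) (R / ε),
        Complex.exp (Complex.I * ((inner ℝ (z.1 - z.2) ξ : ℝ) : ℂ)) * regSymbol c χ ε z.1 ξ := by
    ext z
    rw [regKernel_eq]
    refine (setIntegral_eq_integral_of_forall_compl_eq_zero fun ξ hξ => ?_).symm
    rw [regSymbol_eq_zero hRχ hε _ hξ, mul_zero]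
  rw [e]
  refine continuous_parametric_integral_of_continuous ?_ (isCompact_closedBall _ _)
  refine (continuous_cexp_inner ?_ continuous_snd).mul
    ((contDiff_regSymbol hc hχ ε).continuous.comp
      ((continuous_fst.comp continuous_fst).prodMk continuous_snd))
  exact (continuous_fst.comp continuous_fst).sub (continuous_snd.comp continuous_fst)

theorem exists_norm_regKernel_le (hc : IsSymbol r c) (hχ : IsCutoff χ) {ε : ℝ} (hε : 0 < ε) :
    ∃ C : ℝ, 0 ≤ C ∧ ∀ z₁ z₂ : Eu n, ‖regKernel c χ ε z₁ z₂‖ ≤ C := by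
  obtain ⟨R, hR, hRχ⟩ := hχ.exists_radius
  obtain ⟨C, hC, hCc⟩ := hc.exists_norm_le
  obtain ⟨B, hB, hBχ⟩ := hχ.exists_norm_le
  have hcont : Continuous (fun ξ : Eu n => (1 + ‖ξ‖) ^ r) :=
    (continuous_const.add continuous_norm).rpow_const fun ξ =>
      Or.inl (show (0 : ℝ) < 1 + ‖ξ‖ by positivity).ne'
  obtain ⟨Q, hQ⟩ := (isCompact_closedBall (0 : Eu n) (R / ε)).exists_bound_of_continuousOn
    hcont.continuousOn
  refine ⟨|B * (C * Q)| * volume.real (Metric.closedBall (0 : Eu n) (R / ε)), by positivity,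
    fun z₁ z₂ => ?_⟩
  rw [regKernel_eq, ← setIntegral_eq_integral_of_forall_compl_eq_zero
    (s := Metric.closedBall (0 : Eu n) (R / ε))
    (fun ξ hξ => by rw [regSymbol_eq_zero hRχ hε _ hξ, mul_zero])]
  refine norm_setIntegral_le_of_norm_le_const measure_closedBall_lt_top fun ξ hξ => ?_
  rw [norm_mul, norm_cexp_I_mul_ofReal, one_mul, regSymbol, norm_mul, Complex.norm_real]
  refine le_trans ?_ (le_abs_self _)
  have h1 := hQ ξ hξ
  rw [Real.norm_of_nonneg (by positivity)] at h1
  exact mul_le_mul (hBχ _) ((hCc z₁ ξ).trans (by gcongr)) (norm_nonneg _) hB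

theorem exists_norm_regKernel_le_rpow (hc : IsSymbol r c) (hχ : IsCutoff χ) {ε : ℝ} (hε : 0 < ε)
    {M : ℕ} (hM : r + n < M) : ∃ C : ℝ, 0 ≤ C ∧
      ∀ z₁ z₂ : Eu n, ‖regKernel c χ ε z₁ z₂‖ ≤ C * (1 + ‖z₁ - z₂‖) ^ (-(M : ℝ)) := by
  obtain ⟨C₀, hC₀, h₀⟩ := exists_norm_regKernel_le hc hχ hε
  obtain ⟨C, hC, h⟩ := exists_norm_pow_mul_norm_regKernel_le hc hχ hε hM
  refine ⟨2 ^ (M - 1) * (C₀ + C), by positivity, fun z₁ z₂ => ?_⟩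
  have hpos : 0 < 1 + ‖z₁ - z₂‖ := by positivity
  rw [Real.rpow_neg hpos.le, Real.rpow_natCast, ← div_eq_mul_inv, le_div_iff₀ (by positivity),
    mul_comm]
  calc _ ≤ (2 ^ (M - 1) * (1 ^ M + ‖z₁ - z₂‖ ^ M)) * ‖regKernel c χ ε z₁ z₂‖ := by
        gcongr
        exact add_pow_le zero_le_one (norm_nonneg _) M
    _ = 2 ^ (M - 1) * (‖regKernel c χ ε z₁ z₂‖ + ‖z₁ - z₂‖ ^ M * ‖regKernel c χ ε z₁ z₂‖) := by
        ring
    _ ≤ _ := by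
        gcongr
        · exact h₀ z₁ z₂
        · exact h ε hε le_rfl z₁ z₂

theorem one_add_norm_le_mul {R : ℝ} (hR : 0 ≤ R) {z₁ z₂ : Eu n} (h : ‖z₁‖ ≤ R) :
    1 + ‖z₂‖ ≤ (1 + R) * (1 + ‖z₁ - z₂‖) := by
  have h1 : ‖z₂‖ ≤ ‖z₁‖ + ‖z₁ - z₂‖ := by
    have := norm_sub_le z₁ (z₁ - z₂)
    simpa using this
  nlinarith [norm_nonneg (z₁ - z₂)]

/-- Functions of `(z₁, z₂)` which are supported over a compact set of `z₁` and decay fast in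
`z₁ - z₂` are dominated by an integrable product. -/
theorem one_add_norm_sub_rpow_le {R : ℝ} (hR : 0 ≤ R) {z₁ z₂ : Eu n} (h : ‖z₁‖ ≤ R) (M : ℕ) :
    (1 + ‖z₁ - z₂‖) ^ (-(M : ℝ)) ≤ (1 + R) ^ M * (1 + ‖z₂‖) ^ (-(M : ℝ)) := by
  have h1 : 0 < 1 + ‖z₁ - z₂‖ := by positivity
  have h2 : 0 < 1 + ‖z₂‖ := by positivity
  rw [Real.rpow_neg h1.le, Real.rpow_natCast, Real.rpow_neg h2.le, Real.rpow_natCast,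
    ← div_eq_mul_inv, le_div_iff₀ (by positivity), ← div_eq_inv_mul, div_le_iff₀ (by positivity),
    ← mul_pow]
  exact pow_le_pow_left₀ h2.le (one_add_norm_le_mul hR h) M

/-- Compactness in `z₁` may come from `g` or from the symbol, hence the hypothesis on their product.
In `z₂` the decay of the kernel off the diagonal suffices. -/
theorem integrable_mul_regKernel (hc : IsSymbol r c) (hχ : IsCutoff χ) {ε : ℝ} (hε : 0 < ε)
    {K : Set (Eu n)} (hK : IsCompact K) {g : Eu n × Eu n → ℂ} (hg : Continuous g) {B : ℝ}
    (hgB : ∀ z, ‖g z‖ ≤ B) (hgc : ∀ z₁ ∉ K, ∀ z₂ ξ, g (z₁, z₂) * c z₁ ξ = 0) :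
    Integrable (fun z : Eu n × Eu n => g z * regKernel c χ ε z.1 z.2) := by
  obtain ⟨M, hM⟩ := exists_nat_gt (max (r + n) n)
  obtain ⟨C, hC, h⟩ := exists_norm_regKernel_le_rpow hc hχ hε ((le_max_left _ _).trans_lt hM)
  obtain ⟨R', hR'⟩ := hK.isBounded.exists_norm_le
  set R := max R' 0 with hRdef
  have hR : ∀ z ∈ K, ‖z‖ ≤ R := fun z hz => (hR' z hz).trans (le_max_left _ _)
  have hR0 : 0 ≤ R := le_max_right _ _
  have hi : Integrable (fun z₂ : Eu n => (1 + ‖z₂‖) ^ (-(M : ℝ))) :=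
    integrable_one_add_norm_rpow (by linarith [(le_max_right (r + n) (n : ℝ)).trans_lt hM])
  have hi1 : Integrable (K.indicator fun _ : Eu n => (1 : ℝ)) :=
    (integrable_indicator_iff hK.measurableSet).2 (by
      rw [integrableOn_const_iff]
      exact Or.inr hK.measure_lt_top)
  have hdom : Integrable (fun z : Eu n × Eu n => (B * C * (1 + R) ^ M) *
      (K.indicator (fun _ : Eu n => (1 : ℝ)) z.1 * (1 + ‖z.2‖) ^ (-(M : ℝ)))) :=
    (hi1.mul_prod hi).const_mul _
  refine hdom.mono' (hg.mul (continuous_regKernel hc hχ hε)).aestronglyMeasurable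
    (.of_forall fun z => ?_)
  by_cases hz : z.1 ∈ K
  · rw [Set.indicator_of_mem hz, one_mul, norm_mul]
    calc ‖g z‖ * ‖regKernel c χ ε z.1 z.2‖
        ≤ B * (C * ((1 + R) ^ M * (1 + ‖z.2‖) ^ (-(M : ℝ)))) := by
          refine mul_le_mul (hgB z) ((h z.1 z.2).trans ?_) (norm_nonneg _)
            ((norm_nonneg _).trans (hgB z))
          gcongr
          exact one_add_norm_sub_rpow_le hR0 (hR _ hz) M
      _ = _ := by ring
  · have : g z * regKernel c χ ε z.1 z.2 = 0 := by
      rw [regKernel, ← integral_const_mul]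
      refine (integral_congr_ae (.of_forall fun ξ => ?_)).trans (integral_zero _ _)
      have := hgc z.1 hz z.2 ξ
      simp only [Prod.mk.eta] at this
      linear_combination (Complex.exp (Complex.I * ((inner ℝ (z.1 - z.2) ξ : ℝ) : ℂ)) *
        ((χ (ε • ξ) : ℝ) : ℂ)) * this
    rw [this, Set.indicator_of_notMem hz]
    simp

end KernelBounds

end NearField

namespace NearField

/-! ### The limit `ε → 0` for products with a test function in `z₂` -/

section OscillatoryLimit

variable {n : ℕ} {r : ℝ} {c : Eu n → Eu n → ℂ} {χ : Eu n → ℝ}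

/-- The Fourier transform `∫ e^{-i z·ξ} u(z) dz`. -/
noncomputable def fourierInt {n : ℕ} (u : Eu n → ℂ) (ξ : Eu n) : ℂ :=
  ∫ z : Eu n, Complex.exp (Complex.I * ((inner ℝ (-z) ξ : ℝ) : ℂ)) * u z

theorem continuous_fourierInt {u : Eu n → ℂ} (hu : Continuous u) (huc : HasCompactSupport u) :
    Continuous (fourierInt u) := by
  have e : fourierInt u = fun ξ => ∫ z in tsupport u,
      Complex.exp (Complex.I * ((inner ℝ (-z) ξ : ℝ) : ℂ)) * u z := by
    ext ξ
    refine (setIntegral_eq_integral_of_forall_compl_eq_zero fun z hz => ?_).symm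
    rw [image_eq_zero_of_notMem_tsupport hz, mul_zero]
  rw [e]
  refine continuous_parametric_integral_of_continuous ?_ huc.isCompact
  exact (continuous_cexp_inner continuous_snd.neg continuous_fst).mul (hu.comp continuous_snd)

theorem exists_norm_fourierInt_le {u : Eu n → ℂ} (hu : ContDiff ℝ ∞ u)
    (huc : HasCompactSupport u) (N : ℕ) :
    ∃ C : ℝ, 0 ≤ C ∧ ∀ ξ, ‖fourierInt u ξ‖ ≤ C * (1 + ‖ξ‖) ^ (-(N : ℝ)) := by
  have h0 := norm_pow_mul_norm_integral_cexp_inner_le (n := n)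
  have key : ∀ ξ, fourierInt u ξ =
      ∫ z, Complex.exp (Complex.I * ((inner ℝ (-ξ) z : ℝ) : ℂ)) * u z := by
    intro ξ
    refine integral_congr_ae (.of_forall fun z => ?_)
    simp only [inner_neg_left, real_inner_comm]
  refine ⟨2 ^ (N - 1) * ((∫ z, ‖iteratedFDeriv ℝ 0 u z‖) + ∫ z, ‖iteratedFDeriv ℝ N u z‖),
    ?_, fun ξ => ?_⟩
  · have h1 : 0 ≤ ∫ z, ‖iteratedFDeriv ℝ 0 u z‖ := integral_nonneg fun z => norm_nonneg _
    have h2 : 0 ≤ ∫ z, ‖iteratedFDeriv ℝ N u z‖ := integral_nonneg fun z => norm_nonneg _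
    positivity
  have hpos : 0 < 1 + ‖ξ‖ := by positivity
  have hz := h0 (-ξ) 0 hu huc
  have hN := h0 (-ξ) N hu huc
  rw [← key, norm_neg] at hz hN
  rw [pow_zero, one_mul] at hz
  rw [Real.rpow_neg hpos.le, Real.rpow_natCast, ← div_eq_mul_inv, le_div_iff₀ (by positivity),
    mul_comm]
  calc _ ≤ (2 ^ (N - 1) * (1 ^ N + ‖ξ‖ ^ N)) * ‖fourierInt u ξ‖ := by
        gcongr
        exact add_pow_le zero_le_one (norm_nonneg _) N
    _ = 2 ^ (N - 1) * (‖fourierInt u ξ‖ + ‖ξ‖ ^ N * ‖fourierInt u ξ‖) := by ring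
    _ ≤ _ := by gcongr

/-- The integrand of the absolutely convergent form of an oscillatory integral. -/
noncomputable def symbolPairing {n : ℕ} (c : Eu n → Eu n → ℂ) (p u : Eu n → ℂ)
    (q : Eu n × Eu n) : ℂ :=
  p q.1 * c q.1 q.2 * Complex.exp (Complex.I * ((inner ℝ q.1 q.2 : ℝ) : ℂ)) * fourierInt u q.2

theorem continuous_symbolPairing (hc : IsSymbol r c) {p u : Eu n → ℂ} (hp : Continuous p)
    (hu : Continuous u) (huc : HasCompactSupport u) : Continuous (symbolPairing c p u) :=
  (((hp.comp continuous_fst).mul hc.continuous).mul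
    (continuous_cexp_inner continuous_fst continuous_snd)).mul
    ((continuous_fourierInt hu huc).comp continuous_snd)

/-- A bound for `c(z, ξ) û(ξ)` which is integrable in `ξ`, uniformly in `z`. -/
theorem exists_norm_symbol_mul_fourierInt_le (hc : IsSymbol r c) {u : Eu n → ℂ}
    (hu : ContDiff ℝ ∞ u) (huc : HasCompactSupport u) : ∃ C : ℝ, 0 ≤ C ∧ ∀ z ξ : Eu n,
      ‖c z ξ‖ * ‖fourierInt u ξ‖ ≤ C * (1 + ‖ξ‖) ^ (-((n : ℝ) + 1)) := by
  obtain ⟨N, hN⟩ := exists_nat_gt (r + n + 1)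
  obtain ⟨C, hC, h⟩ := hc.exists_norm_le
  obtain ⟨C', hC', h'⟩ := exists_norm_fourierInt_le hu huc N
  refine ⟨C * C', by positivity, fun z ξ => ?_⟩
  have hpos : 0 < 1 + ‖ξ‖ := by positivity
  calc _ ≤ (C * (1 + ‖ξ‖) ^ r) * (C' * (1 + ‖ξ‖) ^ (-(N : ℝ))) := by
        gcongr
        · exact h z ξ
        · exact h' ξ
    _ = C * C' * (1 + ‖ξ‖) ^ (r + -(N : ℝ)) := by rw [Real.rpow_add hpos]; ring
    _ ≤ _ := by
        gcongr
        · linarith [norm_nonneg ξ]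
        · linarith

theorem integrable_symbolPairing (hc : IsSymbol r c) {K : Set (Eu n)} (hK : IsCompact K)
    {p u : Eu n → ℂ} (hp : Continuous p) {B : ℝ} (hpB : ∀ z, ‖p z‖ ≤ B)
    (hpc : ∀ z ∉ K, ∀ ξ, p z * c z ξ = 0) (hu : ContDiff ℝ ∞ u) (huc : HasCompactSupport u) :
    Integrable (symbolPairing c p u) := by
  obtain ⟨C, hC, h⟩ := exists_norm_symbol_mul_fourierInt_le hc hu huc
  have hi : Integrable (fun ξ : Eu n => (1 + ‖ξ‖) ^ (-((n : ℝ) + 1))) :=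
    integrable_one_add_norm_rpow (by linarith)
  have hi1 : Integrable (K.indicator fun _ : Eu n => (1 : ℝ)) :=
    (integrable_indicator_iff hK.measurableSet).2 (by
      rw [integrableOn_const_iff]
      exact Or.inr hK.measure_lt_top)
  refine ((hi1.mul_prod hi).const_mul (B * C)).mono'
    (continuous_symbolPairing hc hp hu.continuous huc).aestronglyMeasurable
    (.of_forall fun q => ?_)
  by_cases hq : q.1 ∈ K
  · rw [Set.indicator_of_mem hq, one_mul, symbolPairing, norm_mul, norm_mul, norm_mul,
      norm_cexp_I_mul_ofReal, mul_one]
    calc ‖p q.1‖ * ‖c q.1 q.2‖ * ‖fourierInt u q.2‖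
        = ‖p q.1‖ * (‖c q.1 q.2‖ * ‖fourierInt u q.2‖) := by ring
      _ ≤ B * (C * (1 + ‖q.2‖) ^ (-((n : ℝ) + 1))) :=
          mul_le_mul (hpB _) (h _ _) (by positivity) ((norm_nonneg _).trans (hpB q.1))
      _ = _ := by ring
  · rw [symbolPairing, hpc _ hq, Set.indicator_of_notMem hq]
    simp

theorem integral_prod_integral_eq_integral_integral {X : Type*} [NormedAddCommGroup X]
    [MeasureSpace X] [BorelSpace X] [SecondCountableTopology X]
    [SFinite (volume : Measure X)] [IsFiniteMeasureOnCompacts (volume : Measure X)]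
    {H : X → X → X → ℂ}
    (hH : Continuous fun q : (X × X) × X => H q.1.1 q.1.2 q.2)
    (hHc : HasCompactSupport fun q : (X × X) × X => H q.1.1 q.1.2 q.2) :
    ∫ z : X × X, ∫ ξ, H z.1 z.2 ξ = ∫ z₁, ∫ z₂, ∫ ξ, H z₁ z₂ ξ := by
  have hi : Integrable (fun q : (X × X) × X => H q.1.1 q.1.2 q.2)
      ((volume : Measure (X × X)).prod volume) :=
    hH.integrable_of_hasCompactSupport hHc
  exact integral_prod _ hi.integral_prod_left

/-- Fubini: integrating in `z₂` first produces the Fourier transform of `u`. Before that the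
integrand is compactly supported in all three variables, through `K`, the support of `u` and the
cut-off. -/
theorem regSymbol_integral_eq (hc : IsSymbol r c) (hχ : IsCutoff χ) {ε : ℝ} (hε : 0 < ε)
    {K : Set (Eu n)} (hK : IsCompact K) {p u : Eu n → ℂ} (hp : Continuous p)
    {B : ℝ} (hpB : ∀ z, ‖p z‖ ≤ B)
    (hpc : ∀ z ∉ K, ∀ ξ, p z * c z ξ = 0) (hu : ContDiff ℝ ∞ u) (huc : HasCompactSupport u) :
    ∫ z : Eu n × Eu n, p z.1 * u z.2 * regKernel c χ ε z.1 z.2 =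
      ∫ q : Eu n × Eu n, ((χ (ε • q.2) : ℝ) : ℂ) * symbolPairing c p u q := by
  obtain ⟨R, hR, hRχ⟩ := hχ.exists_radius
  have hcp : Continuous fun z : Eu n × Eu n => p z.1 * c z.1 z.2 :=
    (hp.comp continuous_fst).mul hc.continuous
  set H : Eu n → Eu n → Eu n → ℂ := fun z₁ z₂ ξ => u z₂ * ((χ (ε • ξ) : ℝ) : ℂ) * (p z₁ * c z₁ ξ) *
    Complex.exp (Complex.I * ((inner ℝ (z₁ - z₂) ξ : ℝ) : ℂ)) with hHdef
  have hχcont : Continuous fun ξ : Eu n => ((χ (ε • ξ) : ℝ) : ℂ) :=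
    Complex.continuous_ofReal.comp (contDiff_cutoff_smul hχ ε).continuous
  have hH : Continuous fun q : (Eu n × Eu n) × Eu n => H q.1.1 q.1.2 q.2 := by
    refine ((((hu.continuous.comp (continuous_snd.comp continuous_fst)).mul
      (hχcont.comp continuous_snd))).mul (hcp.comp
        ((continuous_fst.comp continuous_fst).prodMk continuous_snd))).mul
      (continuous_cexp_inner ?_ continuous_snd)
    exact (continuous_fst.comp continuous_fst).sub (continuous_snd.comp continuous_fst)
  have hHz : ∀ z₁ z₂ ξ, ¬ (z₁ ∈ K ∧ z₂ ∈ tsupport u ∧ ξ ∈ Metric.closedBall (0 : Eu n) (R / ε)) →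
      H z₁ z₂ ξ = 0 := by
    intro z₁ z₂ ξ h
    simp only [hHdef]
    by_cases h1 : z₁ ∈ K
    · by_cases h2 : z₂ ∈ tsupport u
      · have h3 : ξ ∉ Metric.closedBall (0 : Eu n) (R / ε) := fun h3 => h ⟨h1, h2, h3⟩
        -- With the constant symbol `1` this says that `χ(ε ξ)` itself vanishes.
        have := regSymbol_eq_zero (c := fun _ _ => 1) hRχ hε 0 h3
        simp only [regSymbol, mul_one] at this
        rw [this]
        ring
      · rw [image_eq_zero_of_notMem_tsupport h2]
        ring
    · rw [hpc _ h1]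
      ring
  have hHc : HasCompactSupport fun q : (Eu n × Eu n) × Eu n => H q.1.1 q.1.2 q.2 :=
    hasCompactSupport_of_forall_notMem
      ((hK.prod huc.isCompact).prod (isCompact_closedBall (0 : Eu n) (R / ε)))
      fun q hq => hHz _ _ _ fun h => hq ⟨⟨h.1, h.2.1⟩, h.2.2⟩
  have hswap : ∀ z₁, ∫ z₂, ∫ ξ, H z₁ z₂ ξ = ∫ ξ, ∫ z₂, H z₁ z₂ ξ := by
    intro z₁
    have h1 : Continuous (Function.uncurry (H z₁)) :=
      hH.comp ((continuous_const.prodMk continuous_fst).prodMk continuous_snd)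
    have h2 : HasCompactSupport (Function.uncurry (H z₁)) :=
      hasCompactSupport_of_forall_notMem
        (huc.isCompact.prod (isCompact_closedBall (0 : Eu n) (R / ε)))
        fun q hq => hHz _ _ _ fun h => hq ⟨h.2.1, h.2.2⟩
    exact integral_integral_swap (h1.integrable_of_hasCompactSupport h2)
  have e1 : ∀ z : Eu n × Eu n, p z.1 * u z.2 * regKernel c χ ε z.1 z.2 =
      ∫ ξ, H z.1 z.2 ξ := by
    intro z
    rw [regKernel, ← integral_const_mul]
    refine integral_congr_ae (.of_forall fun ξ => ?_)
    simp only [hHdef]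
    ring
  have e2 : ∀ z₁ ξ, ∫ z₂, H z₁ z₂ ξ =
      ((χ (ε • ξ) : ℝ) : ℂ) * symbolPairing c p u (z₁, ξ) := by
    intro z₁ ξ
    simp only [symbolPairing, fourierInt]
    rw [← integral_const_mul, ← integral_const_mul]
    refine integral_congr_ae (.of_forall fun z₂ => ?_)
    simp only [hHdef]
    have : Complex.exp (Complex.I * ((inner ℝ (z₁ - z₂) ξ : ℝ) : ℂ)) =
        Complex.exp (Complex.I * ((inner ℝ z₁ ξ : ℝ) : ℂ)) *
          Complex.exp (Complex.I * ((inner ℝ (-z₂) ξ : ℝ) : ℂ)) := by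
      rw [← Complex.exp_add, sub_eq_add_neg, inner_add_left]
      push_cast
      ring_nf
    rw [this]
    ring
  obtain ⟨b, hb, hχb⟩ := hχ.exists_norm_le
  have hintg : Integrable
      (fun q : Eu n × Eu n => ((χ (ε • q.2) : ℝ) : ℂ) * symbolPairing c p u q) :=
    (integrable_symbolPairing hc hK hp hpB hpc hu huc).bdd_mul
      (hχcont.comp continuous_snd).aestronglyMeasurable
      (.of_forall fun q => by rw [Complex.norm_real]; exact hχb _)
  simp_rw [e1]
  rw [integral_prod_integral_eq_integral_integral hH hHc]
  simp_rw [hswap, e2]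
  exact (integral_prod _ hintg).symm

/-- The oscillatory integral of a product `p(z₁) u(z₂)` with `u` a test function. -/
theorem tendsto_integral_mul_regKernel (hc : IsSymbol r c) (hχ : IsCutoff χ)
    {K : Set (Eu n)} (hK : IsCompact K) {p u : Eu n → ℂ} (hp : Continuous p)
    {B : ℝ} (hpB : ∀ z, ‖p z‖ ≤ B)
    (hpc : ∀ z ∉ K, ∀ ξ, p z * c z ξ = 0) (hu : ContDiff ℝ ∞ u) (huc : HasCompactSupport u) :
    Tendsto (fun ε : ℝ => ∫ z : Eu n × Eu n, p z.1 * u z.2 * regKernel c χ ε z.1 z.2)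
      (𝓝[>] 0) (𝓝 (∫ q, symbolPairing c p u q)) := by
  obtain ⟨b, hb, hχb⟩ := hχ.exists_norm_le
  have hintg := integrable_symbolPairing hc hK hp hpB hpc hu huc
  have h1 : Tendsto (fun ε : ℝ => ∫ q : Eu n × Eu n,
      ((χ (ε • q.2) : ℝ) : ℂ) * symbolPairing c p u q) (𝓝[>] 0)
      (𝓝 (∫ q, symbolPairing c p u q)) := by
    -- The decay of the Fourier transform of `u` makes the pairing integrable without any cut-off,
    -- so only boundedness of `χ` and `χ(0) = 1` are used.
    refine tendsto_integral_filter_of_dominated_convergence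
      (fun q => b * ‖symbolPairing c p u q‖) (.of_forall fun ε => ?_)
      (.of_forall fun ε => .of_forall fun q => ?_) (hintg.norm.const_mul b)
      (.of_forall fun q => ?_)
    · exact ((Complex.continuous_ofReal.comp ((contDiff_cutoff_smul hχ ε).continuous.comp
        continuous_snd)).mul
        (continuous_symbolPairing hc hp hu.continuous huc)).aestronglyMeasurable
    · rw [norm_mul, Complex.norm_real]
      gcongr
      exact hχb _
    · have h2 : Tendsto (fun ε : ℝ => χ (ε • q.2)) (𝓝[>] 0) (𝓝 1) := by
        have h3 : Continuous fun ε : ℝ => χ (ε • q.2) :=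
          hχ.contDiff.continuous.comp (continuous_id.smul continuous_const)
        have h4 := h3.tendsto 0
        rw [zero_smul, hχ.map_zero] at h4
        exact h4.mono_left nhdsWithin_le_nhds
      have h3 := ((Complex.continuous_ofReal.tendsto 1).comp h2).mul_const (symbolPairing c p u q)
      simpa using h3
  refine h1.congr' ?_
  filter_upwards [self_mem_nhdsWithin] with ε hε
  exact (regSymbol_integral_eq hc hχ hε hK hp hpB hpc hu huc).symm

end OscillatoryLimit

end NearField

open scoped ContDiff FourierTransform

namespace NearField

/-! ### The symbol vanishes where the kernel does -/

section Support

variable {n : ℕ} {r : ℝ} {c : Eu n → Eu n → ℂ} {χ : Eu n → ℝ}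

theorem exists_isCutoff (n : ℕ) : ∃ χ : Eu n → ℝ, IsCutoff χ := by
  obtain ⟨χ, h1, h2, -, h3, -⟩ := exists_contDiff_cutoff (isCompact_singleton (x := (0 : Eu n)))
    isOpen_univ (Set.subset_univ _)
  exact ⟨χ, h1, h2, h3.self_of_nhdsSet 0 rfl⟩

/-- Fourier inversion at the origin: the integral is a nonzero multiple of `u 0`. -/
theorem integral_fourierInt_ne_zero {u : Eu n → ℂ} (hu : ContDiff ℝ ∞ u)
    (huc : HasCompactSupport u) (h0 : u 0 ≠ 0) : ∫ ξ, fourierInt u ξ ≠ 0 := by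
  intro h
  apply h0
  -- Conversion to the Fourier transform normalized with `e^{-2πi}`.
  have hF : ∀ w, 𝓕 u w = fourierInt u ((2 * Real.pi) • w) := by
    intro w
    rw [Real.fourier_eq', fourierInt]
    refine integral_congr_ae (.of_forall fun v => ?_)
    simp only [smul_eq_mul, inner_neg_left, inner_smul_right]
    congr 2
    push_cast
    ring
  have hi : Integrable (fourierInt u) := by
    obtain ⟨C, hC, hb⟩ := exists_norm_fourierInt_le hu huc (n + 1)
    exact ((integrable_one_add_norm_rpow (n := n) (s := -((n + 1 : ℕ) : ℝ))
      (by push_cast; linarith)).const_mul C).mono'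
      (continuous_fourierInt hu.continuous huc).aestronglyMeasurable (.of_forall hb)
  have hi' : Integrable (𝓕 u) := by
    have : 𝓕 u = fun w => fourierInt u ((2 * Real.pi) • w) := funext hF
    rw [this]
    exact hi.comp_smul (by positivity)
  have h1 := congrFun (hu.continuous.fourierInv_fourier_eq
    (hu.continuous.integrable_of_hasCompactSupport huc) hi') 0
  rw [← h1, Real.fourierInv_eq']
  simp only [inner_zero_right, mul_zero, Complex.ofReal_zero, zero_mul, Complex.exp_zero, one_smul,
    hF]
  rw [Measure.integral_comp_smul, h, smul_zero]

/-- The function `z ↦ ∫ c(z, ξ) e^{i z·ξ} û(ξ) dξ`. -/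
noncomputable def symbolAction {n : ℕ} (c : Eu n → Eu n → ℂ) (u : Eu n → ℂ) (z : Eu n) : ℂ :=
  ∫ ξ, c z ξ * Complex.exp (Complex.I * ((inner ℝ z ξ : ℝ) : ℂ)) * fourierInt u ξ

theorem continuous_symbolAction (hc : IsSymbol r c) {u : Eu n → ℂ} (hu : ContDiff ℝ ∞ u)
    (huc : HasCompactSupport u) : Continuous (symbolAction c u) := by
  obtain ⟨C, hC, h⟩ := exists_norm_symbol_mul_fourierInt_le hc hu huc
  have hcont : Continuous fun p : Eu n × Eu n => c p.1 p.2 *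
      Complex.exp (Complex.I * ((inner ℝ p.1 p.2 : ℝ) : ℂ)) * fourierInt u p.2 :=
    (hc.continuous.mul (continuous_cexp_inner continuous_fst continuous_snd)).mul
      ((continuous_fourierInt hu.continuous huc).comp continuous_snd)
  refine continuous_of_dominated (bound := fun ξ => C * (1 + ‖ξ‖) ^ (-((n : ℝ) + 1)))
    (fun z => (hcont.comp (continuous_const.prodMk continuous_id)).aestronglyMeasurable)
    (fun z => .of_forall fun ξ => ?_)
    ((integrable_one_add_norm_rpow (by linarith)).const_mul C)
    (.of_forall fun ξ => hcont.comp (continuous_id.prodMk continuous_const))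
  rw [norm_mul, norm_mul, norm_cexp_I_mul_ofReal, mul_one]
  exact h z ξ

/-- Testing the kernel on `α(z₁) u(z₂)` with `α` supported off `closure D` gives `∫ α · symbolAction
c u = 0`. As `α` is arbitrary, the function vanishes almost everywhere off `closure D`, and by
continuity everywhere there. -/
theorem symbolAction_eq_zero (hc : IsSymbol r c) {D : Set (Eu n)}
    (hC : KernelSupportedIn c (closure D ×ˢ closure D)) {u : Eu n → ℂ} (hu : ContDiff ℝ ∞ u)
    (huc : HasCompactSupport u) {z : Eu n} (hz : z ∉ closure D) : symbolAction c u z = 0 := by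
  have hO : IsOpen (closure D)ᶜ := isClosed_closure.isOpen_compl
  have hcont := continuous_symbolAction hc hu huc
  obtain ⟨χ, hχ⟩ := exists_isCutoff n
  have hae : ∀ᵐ z, z ∈ (closure D)ᶜ → symbolAction c u z = 0 := by
    refine hO.ae_eq_zero_of_integral_contDiff_smul_eq_zero
      (hcont.locallyIntegrable.locallyIntegrableOn _) fun α hα hαc hαO => ?_
    set p : Eu n → ℂ := fun z => (α z : ℂ) with hp
    have hps : ContDiff ℝ ∞ p := Complex.ofRealCLM.contDiff.comp hα
    have hpz : ∀ z ∉ tsupport α, p z = 0 := fun z hz => by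
      simp [hp, image_eq_zero_of_notMem_tsupport hz]
    obtain ⟨B, hB⟩ := hps.continuous.bounded_above_of_compact_support
      (hasCompactSupport_of_forall_notMem hαc.isCompact hpz)
    have hpc : ∀ z ∉ tsupport α, ∀ ξ, p z * c z ξ = 0 := fun z hz ξ => by
      rw [hpz z hz, zero_mul]
    have hz0 : ∀ q ∉ tsupport α ×ˢ tsupport u, p q.1 * u q.2 = 0 := by
      intro q hq
      by_cases h1 : q.1 ∈ tsupport α
      · have h2 : q.2 ∉ tsupport u := fun h2 => hq ⟨h1, h2⟩
        rw [image_eq_zero_of_notMem_tsupport h2, mul_zero]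
      · rw [hpz _ h1, zero_mul]
    have hK := hαc.isCompact.prod huc.isCompact
    have hosc := hC (fun q => p q.1 * u q.2) ((hps.comp contDiff_fst).mul (hu.comp contDiff_snd))
      (hasCompactSupport_of_forall_notMem hK hz0) (by
        refine Set.disjoint_left.2 fun q hq hqD => ?_
        exact hαO (tsupport_subset_of_forall_notMem hK hz0 hq).1 hqD.1) χ hχ
    have h1 := tendsto_nhds_unique hosc.2
      (tendsto_integral_mul_regKernel hc hχ hαc.isCompact hps.continuous hB hpc hu huc)
    have h2 := integral_prod _
      (integrable_symbolPairing hc hαc.isCompact hps.continuous hB hpc hu huc)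
    have h3 : ∀ z, α z • symbolAction c u z = ∫ ξ, symbolPairing c p u (z, ξ) := by
      intro z
      rw [symbolAction, Complex.real_smul, ← integral_const_mul]
      refine integral_congr_ae (.of_forall fun ξ => ?_)
      simp only [symbolPairing, hp]
      ring
    simp_rw [h3]
    exact h2.symm.trans h1.symm
  have hrestr : symbolAction c u =ᵐ[volume.restrict (closure D)ᶜ] fun _ => 0 :=
    (ae_restrict_iff' hO.measurableSet).2 hae
  exact Measure.eqOn_open_of_ae_eq hrestr hO hcont.continuousOn continuousOn_const hz

/-- The symbol of a kernel supported in `closure D ×ˢ closure D` vanishes over the complement of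
`closure D`. -/
theorem symbol_eq_zero (hc : IsSymbol r c) {D : Set (Eu n)}
    (hC : KernelSupportedIn c (closure D ×ˢ closure D)) {z : Eu n} (hz : z ∉ closure D)
    (η : Eu n) : c z η = 0 := by
  obtain ⟨χ, hχ⟩ := exists_isCutoff n
  set u : Eu n → ℂ := fun z => (χ z : ℂ) with hudef
  have hu : ContDiff ℝ ∞ u := Complex.ofRealCLM.contDiff.comp hχ.contDiff
  have huc : HasCompactSupport u := hasCompactSupport_of_forall_notMem
    hχ.hasCompactSupport.isCompact fun z hz => by
      simp [hudef, image_eq_zero_of_notMem_tsupport hz]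
  have hu0 : u 0 ≠ 0 := by simp [hudef, hχ.map_zero]
  have hFc := continuous_fourierInt hu.continuous huc
  set F : Eu n → ℂ := fun ξ => c z ξ * Complex.exp (Complex.I * ((inner ℝ z ξ : ℝ) : ℂ)) with hF
  have hFcont : Continuous F := (hc.continuous.comp (continuous_const.prodMk continuous_id)).mul
    (continuous_cexp_inner continuous_const continuous_id)
  -- modulated and dilated test functions
  have hscaled : ∀ s : ℝ, 0 < s → ∫ τ, F (η + s • τ) * fourierInt u τ = 0 := by
    intro s hs
    -- The Fourier transform of `v` is that of `u` concentrated around `η` at width `s`, so letting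
    -- `s → 0` isolates the value of the symbol at `η`.
    set v : Eu n → ℂ := fun z =>
      u (s • z) * Complex.exp (Complex.I * ((inner ℝ η z : ℝ) : ℂ)) with hv
    have hvs : ContDiff ℝ ∞ v := (hu.comp (contDiff_id.const_smul s)).mul
      (contDiff_cexp_phase (innerSL ℝ η).contDiff)
    have hvc : HasCompactSupport v := by
      refine HasCompactSupport.mul_right ?_
      exact huc.comp_homeomorph (Homeomorph.smulOfNeZero s hs.ne')
    have hFv : ∀ ξ, fourierInt v ξ = ((|(s ^ n)⁻¹| : ℝ) : ℂ) * fourierInt u (s⁻¹ • (ξ - η)) := by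
      intro ξ
      have h1 := Measure.integral_comp_smul (volume : Measure (Eu n)) (fun y : Eu n =>
        Complex.exp (Complex.I * ((inner ℝ (-y) (s⁻¹ • (ξ - η)) : ℝ) : ℂ)) * u y) s
      rw [finrank_euclideanSpace_fin, Complex.real_smul] at h1
      rw [fourierInt, fourierInt, ← h1]
      refine integral_congr_ae (.of_forall fun y => ?_)
      simp only [hv]
      have : (inner ℝ (-(s • y)) (s⁻¹ • (ξ - η)) : ℝ) = inner ℝ (-y) ξ + inner ℝ η y := by
        rw [inner_neg_left, inner_neg_left, inner_smul_left, inner_smul_right, inner_sub_right,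
          real_inner_comm η y]
        simp only [conj_trivial]
        field_simp
        ring
      rw [this]
      push_cast
      rw [mul_add, Complex.exp_add]
      ring
    have h0 := symbolAction_eq_zero hc hC hvs hvc hz
    have h1 : symbolAction c v z = ((|(s ^ n)⁻¹| : ℝ) : ℂ) *
        ∫ ξ, F ξ * fourierInt u (s⁻¹ • (ξ - η)) := by
      rw [symbolAction, ← integral_const_mul]
      refine integral_congr_ae (.of_forall fun ξ => ?_)
      simp only [hFv, hF]
      ring
    have h2 : ∫ ξ, F ξ * fourierInt u (s⁻¹ • (ξ - η)) = 0 := by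
      rw [h0] at h1
      refine (mul_eq_zero.1 h1.symm).resolve_left ?_
      exact_mod_cast (abs_pos.2 (inv_ne_zero (pow_ne_zero n hs.ne'))).ne'
    have h3 := integral_add_left_eq_self (μ := (volume : Measure (Eu n)))
      (fun ξ => F ξ * fourierInt u (s⁻¹ • (ξ - η))) η
    have h4 := Measure.integral_comp_smul (volume : Measure (Eu n))
      (fun ξ => F (η + ξ) * fourierInt u (s⁻¹ • (η + ξ - η))) s
    rw [h3, h2, smul_zero] at h4
    rw [← h4]
    refine integral_congr_ae (.of_forall fun τ => ?_)
    simp only [add_sub_cancel_left, smul_smul, inv_mul_cancel₀ hs.ne', one_smul]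
  obtain ⟨C, hC0, hCc⟩ := hc.exists_norm_le
  -- With `|r|` instead of `r`, the bound `(1 + |η + sτ|)^r ≤ (1 + |η|)^|r| (1 + |τ|)^|r|` holds for
  -- both signs of `r` and all `0 < s ≤ 1`.
  obtain ⟨N, hN⟩ := exists_nat_gt (|r| + n + 1)
  obtain ⟨C', hC', hCu⟩ := exists_norm_fourierInt_le hu huc N
  have hlim : Tendsto (fun s : ℝ => ∫ τ, F (η + s • τ) * fourierInt u τ) (𝓝[>] 0)
      (𝓝 (∫ τ, F η * fourierInt u τ)) := by
    refine tendsto_integral_filter_of_dominated_convergence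
      (fun τ => C * (1 + ‖η‖) ^ |r| * C' * (1 + ‖τ‖) ^ (|r| + -(N : ℝ)))
      (.of_forall fun s => ?_) ?_
      ((integrable_one_add_norm_rpow (by linarith)).const_mul _) (.of_forall fun τ => ?_)
    · exact ((hFcont.comp (continuous_const.add (continuous_id.const_smul s))).mul
        hFc).aestronglyMeasurable
    · filter_upwards [Ioc_mem_nhdsGT (zero_lt_one' ℝ)] with s hs
      refine .of_forall fun τ => ?_
      have hpos : 0 < 1 + ‖τ‖ := by positivity
      have h1 : ‖F (η + s • τ)‖ ≤ C * ((1 + ‖η‖) ^ |r| * (1 + ‖τ‖) ^ |r|) := by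
        simp only [hF]
        rw [norm_mul, norm_cexp_I_mul_ofReal, mul_one]
        refine (hCc _ _).trans ?_
        gcongr
        rw [← Real.mul_rpow (by positivity) (by positivity)]
        refine (Real.rpow_le_rpow_of_exponent_le (by linarith [norm_nonneg (η + s • τ)])
          (le_abs_self r)).trans ?_
        refine Real.rpow_le_rpow (by positivity) ?_ (abs_nonneg r)
        have h2 : ‖η + s • τ‖ ≤ ‖η‖ + ‖τ‖ := by
          refine (norm_add_le _ _).trans ?_
          rw [norm_smul, Real.norm_of_nonneg hs.1.le]
          have := mul_le_of_le_one_left (norm_nonneg τ) hs.2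
          linarith
        nlinarith [norm_nonneg η, norm_nonneg τ]
      rw [norm_mul]
      calc _ ≤ (C * ((1 + ‖η‖) ^ |r| * (1 + ‖τ‖) ^ |r|)) * (C' * (1 + ‖τ‖) ^ (-(N : ℝ))) := by
            gcongr
            exact hCu τ
        _ = _ := by rw [Real.rpow_add hpos]; ring
    · have h1 : Continuous fun s : ℝ => F (η + s • τ) * fourierInt u τ :=
        (hFcont.comp (continuous_const.add (continuous_id.smul continuous_const))).mul
          continuous_const
      have h2 := h1.tendsto 0
      simp only [zero_smul, add_zero] at h2
      exact h2.mono_left nhdsWithin_le_nhds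
  have hzero : Tendsto (fun s : ℝ => ∫ τ, F (η + s • τ) * fourierInt u τ) (𝓝[>] 0) (𝓝 0) := by
    refine tendsto_const_nhds.congr' ?_
    filter_upwards [self_mem_nhdsWithin] with s hs
    exact (hscaled s hs).symm
  have h1 := tendsto_nhds_unique hlim hzero
  rw [integral_const_mul] at h1
  have h2 := (mul_eq_zero.1 h1).resolve_right (integral_fourierInt_ne_zero hu huc hu0)
  exact (mul_eq_zero.1 h2).resolve_right (Complex.exp_ne_zero _)

end Support

end NearField

namespace NearField

/-! ### The part away from the support in `z₂` tends to zero -/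

section Tail

variable {n : ℕ} {r : ℝ} {c : Eu n → Eu n → ℂ} {χ : Eu n → ℝ}

theorem regKernel_eq_zero {z₁ : Eu n} (h : ∀ ξ, c z₁ ξ = 0) (ε : ℝ) (z₂ : Eu n) :
    regKernel c χ ε z₁ z₂ = 0 := by
  simp [regKernel, h]

/-- Off the diagonal the regularized kernels are bounded, and decay, uniformly in `ε ≤ 1`. -/
theorem exists_norm_regKernel_le_off_diagonal (hc : IsSymbol r c) (hχ : IsCutoff χ) {M : ℕ}
    (hM : r + n < (2 * M : ℕ)) {R δ : ℝ} (hR : 0 ≤ R) (hδ : 0 < δ) : ∃ C : ℝ, 0 ≤ C ∧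
      ∀ ε, 0 < ε → ε ≤ 1 → ∀ z₁ z₂ : Eu n, ‖z₁‖ ≤ R → δ ≤ ‖z₁ - z₂‖ →
        ‖regKernel c χ ε z₁ z₂‖ ≤ C * ((1 + ‖z₂‖ ^ 2) ^ M)⁻¹ := by
  obtain ⟨C, hC, h⟩ := exists_norm_pow_mul_norm_regKernel_le hc hχ one_pos hM
  -- Chosen so that `1 + |z₂| ≤ (1 + R)(1 + |z₁ - z₂|) ≤ A |z₁ - z₂|` once `|z₁ - z₂| ≥ δ`.
  set A := (1 + R) * (1 + 1 / δ) with hA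
  have hA0 : 0 ≤ A := by positivity
  refine ⟨A ^ (2 * M) * C, by positivity, fun ε hε hε1 z₁ z₂ hz₁ hδz => ?_⟩
  have h1 : 1 + ‖z₂‖ ≤ A * ‖z₁ - z₂‖ := by
    refine (one_add_norm_le_mul hR hz₁).trans ?_
    rw [hA, mul_assoc]
    gcongr
    have : 1 ≤ 1 / δ * ‖z₁ - z₂‖ := by
      rw [one_div, ← div_eq_inv_mul, le_div_iff₀ hδ]
      linarith
    linarith
  have h2 : (1 + ‖z₂‖ ^ 2) ^ M ≤ (A * ‖z₁ - z₂‖) ^ (2 * M) := by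
    rw [pow_mul]
    refine pow_le_pow_left₀ (by positivity) ?_ M
    calc 1 + ‖z₂‖ ^ 2 ≤ (1 + ‖z₂‖) ^ 2 := by nlinarith [norm_nonneg z₂]
      _ ≤ _ := pow_le_pow_left₀ (by positivity) h1 2
  rw [← div_eq_mul_inv, le_div_iff₀ (by positivity)]
  calc _ ≤ ‖regKernel c χ ε z₁ z₂‖ * (A * ‖z₁ - z₂‖) ^ (2 * M) := by gcongr
    _ = A ^ (2 * M) * (‖z₁ - z₂‖ ^ (2 * M) * ‖regKernel c χ ε z₁ z₂‖) := by rw [mul_pow]; ring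
    _ ≤ _ := by
        gcongr
        exact h ε hε hε1 z₁ z₂

theorem integrable_inv_one_add_sq_pow {M : ℕ} (hM : n < 2 * M) :
    Integrable (fun z : Eu n => ((1 + ‖z‖ ^ 2) ^ M)⁻¹) := by
  have := integrable_rpow_neg_one_add_norm_sq (E := Eu n) (μ := volume) (r := ((2 * M : ℕ) : ℝ))
    (by rw [finrank_euclideanSpace_fin]; exact_mod_cast hM)
  refine this.congr (.of_forall fun z => ?_)
  simp only
  have e : -((2 * M : ℕ) : ℝ) / 2 = -(M : ℝ) := by push_cast; ring
  rw [e, Real.rpow_neg (by positivity), Real.rpow_natCast]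

/-- Away from the support of the kernel the oscillatory integral of a bounded continuous function
vanishes. -/
theorem tendsto_integral_mul_regKernel_tail (hc : IsSymbol r c) (hχ : IsCutoff χ) {D : Set (Eu n)}
    (hD : Bornology.IsBounded D) (hC : KernelSupportedIn c (closure D ×ˢ closure D))
    {α : Eu n → ℂ} (hα : ContDiff ℝ ∞ α) (hαc : HasCompactSupport α)
    {q : Eu n → ℂ} (hq : Continuous q) {B : ℝ} (hqB : ∀ z, ‖q z‖ ≤ B)
    (hqD : ∀ᶠ z in 𝓝ˢ (closure D), q z = 0) :
    Tendsto (fun ε : ℝ => ∫ z : Eu n × Eu n, α z.1 * q z.2 * regKernel c χ ε z.1 z.2)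
      (𝓝[>] 0) (𝓝 0) := by
  have hK : IsCompact (closure D) := hD.isCompact_closure
  obtain ⟨O, hO, hDO, hqO⟩ : ∃ O : Set (Eu n), IsOpen O ∧ closure D ⊆ O ∧ ∀ z ∈ O, q z = 0 := by
    obtain ⟨O, h1, h2, h3⟩ := mem_nhdsSet_iff_exists.1 hqD
    exact ⟨O, h1, h2, h3⟩
  obtain ⟨θ, hθ, hθc, hθO, hθ1, hθI⟩ := exists_contDiff_cutoff hK hO hDO
  -- For `z₁` in `closure D` the factor `1 - θ(z₂)` removes the `δ`-neighbourhood of the diagonal;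
  -- on the rest the kernels are bounded uniformly in `ε`.
  obtain ⟨δ, hδ, hδθ⟩ : ∃ δ : ℝ, 0 < δ ∧ ∀ z₁ ∈ closure D, ∀ z₂, ‖z₁ - z₂‖ < δ → θ z₂ = 1 := by
    obtain ⟨V, h1, h2, h3⟩ := mem_nhdsSet_iff_exists.1 hθ1
    obtain ⟨δ, hδ, hδV⟩ := hK.exists_thickening_subset_open h1 h2
    refine ⟨δ, hδ, fun z₁ hz₁ z₂ hz => h3 (hδV ?_)⟩
    rw [Metric.mem_thickening_iff]
    exact ⟨z₁, hz₁, by rwa [dist_eq_norm, norm_sub_rev]⟩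
  obtain ⟨R', hR'⟩ := hK.isBounded.exists_norm_le
  set R := max R' 0 with hRdef
  have hR : ∀ z ∈ closure D, ‖z‖ ≤ R := fun z hz => (hR' z hz).trans (le_max_left _ _)
  obtain ⟨M, hM⟩ := exists_nat_gt (max (r + n) n)
  have hM1 : r + n < ((2 * M : ℕ) : ℝ) := by
    have := (le_max_left _ _).trans_lt hM
    push_cast
    have : (0 : ℝ) ≤ M := by positivity
    linarith
  have hM2 : n < 2 * M := by
    have : n < M := by exact_mod_cast (le_max_right (r + n) (n : ℝ)).trans_lt hM
    omega
  obtain ⟨C, hC0, hCk⟩ := exists_norm_regKernel_le_off_diagonal hc hχ hM1 (R := R) (δ := δ)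
    (le_max_right _ _) hδ
  obtain ⟨A, hA⟩ := hα.continuous.bounded_above_of_compact_support hαc
  have hA0 : 0 ≤ A := (norm_nonneg _).trans (hA 0)
  have hc0 : ∀ z ∉ closure D, ∀ ξ, c z ξ = 0 := fun z hz ξ => symbol_eq_zero hc hC hz ξ
  have hw := integrable_inv_one_add_sq_pow (n := n) hM2
  have hwc : Continuous fun z : Eu n => ((1 + ‖z‖ ^ 2) ^ M)⁻¹ :=
    ((continuous_const.add (continuous_norm.pow 2)).pow M).inv₀ fun z =>
      (show (0 : ℝ) < (1 + ‖z‖ ^ 2) ^ M by positivity).ne'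
  have hqw : Integrable fun z : Eu n => q z * ((((1 + ‖z‖ ^ 2) ^ M)⁻¹ : ℝ) : ℂ) :=
    hw.ofReal.bdd_mul hq.aestronglyMeasurable (.of_forall hqB)
  have hi1 : Integrable ((closure D).indicator fun _ : Eu n => (1 : ℝ)) :=
    (integrable_indicator_iff hK.measurableSet).2 (by
      rw [integrableOn_const_iff]
      exact Or.inr hK.measure_lt_top)
  set v := ∫ z, (closure D).indicator (fun _ : Eu n => (1 : ℝ)) z with hv
  have hv0 : 0 ≤ v := integral_nonneg fun z => Set.indicator_nonneg (fun _ _ => zero_le_one) z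
  rw [Metric.tendsto_nhds]
  intro e he
  -- The approximation error will be at most `A C v η < e / 2`; the `+ 1` covers `A C v = 0`.
  set η := e / (2 * (A * C * v + 1)) with hη
  have hη0 : 0 < η := by positivity
  -- The support hypothesis on the kernel speaks only of test functions, whereas `q` is merely
  -- continuous and bounded. It is therefore approximated in `L¹` with the weight that dominates the
  -- kernels. The weight is a power of `1 + |z|²`, so dividing it out again leaves a smooth
  -- function.
  obtain ⟨b₀, hb₀c, hb₀s, hb₀⟩ := (memLp_one_iff_integrable.2 hqw).exist_eLpNorm_sub_le
    (by simp) le_rfl hη0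
  set β : Eu n → ℂ := fun z => (((1 + ‖z‖ ^ 2) ^ M : ℝ) : ℂ) * b₀ z with hβ
  have hβs : ContDiff ℝ ∞ β := by
    refine (Complex.ofRealCLM.contDiff.comp ?_).mul hb₀s
    exact (contDiff_const.add (contDiff_norm_sq ℝ)).pow M
  have hβz : ∀ z ∉ tsupport b₀, β z = 0 := fun z hz => by
    simp [hβ, image_eq_zero_of_notMem_tsupport hz]
  have hβw : ∀ z, ‖q z - β z‖ * ((1 + ‖z‖ ^ 2) ^ M)⁻¹ =
      ‖q z * ((((1 + ‖z‖ ^ 2) ^ M)⁻¹ : ℝ) : ℂ) - b₀ z‖ := by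
    intro z
    have hp : (0 : ℝ) < (1 + ‖z‖ ^ 2) ^ M := by positivity
    have h1 : q z * ((((1 + ‖z‖ ^ 2) ^ M)⁻¹ : ℝ) : ℂ) - b₀ z =
        (q z - β z) * ((((1 + ‖z‖ ^ 2) ^ M)⁻¹ : ℝ) : ℂ) := by
      simp only [hβ]
      have hne : (((1 + ‖z‖ ^ 2) ^ M : ℝ) : ℂ) ≠ 0 := by exact_mod_cast hp.ne'
      rw [Complex.ofReal_inv]
      field_simp
    rw [h1, norm_mul, Complex.norm_real, Real.norm_of_nonneg (by positivity)]
  have hβi : Integrable fun z : Eu n => ‖q z - β z‖ * ((1 + ‖z‖ ^ 2) ^ M)⁻¹ := by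
    simp_rw [hβw]
    exact (hqw.sub (hb₀s.continuous.integrable_of_hasCompactSupport hb₀c)).norm
  have hβη : ∫ z : Eu n, ‖q z - β z‖ * ((1 + ‖z‖ ^ 2) ^ M)⁻¹ ≤ η := by
    simp_rw [hβw]
    rw [eLpNorm_one_eq_lintegral_enorm] at hb₀
    have h1 := integral_norm_eq_lintegral_enorm
      (hqw.sub (hb₀s.continuous.integrable_of_hasCompactSupport hb₀c)).aestronglyMeasurable
    simp only [Pi.sub_apply] at h1 hb₀
    rw [h1]
    exact ENNReal.toReal_le_of_le_ofReal hη0.le hb₀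
  -- the approximating test function
  set ψ : Eu n × Eu n → ℂ := fun z => α z.1 * (((1 - θ z.2 : ℝ) : ℂ) * β z.2) with hψ
  have hψs : ContDiff ℝ ∞ ψ := (hα.comp contDiff_fst).mul
    (((Complex.ofRealCLM.contDiff.comp (contDiff_const.sub hθ)).comp contDiff_snd).mul
      (hβs.comp contDiff_snd))
  have hψz : ∀ z ∉ tsupport α ×ˢ tsupport b₀, ψ z = 0 := by
    intro z hz
    simp only [hψ]
    by_cases h1 : z.1 ∈ tsupport α
    · rw [hβz z.2 fun h2 => hz ⟨h1, h2⟩]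
      ring
    · rw [image_eq_zero_of_notMem_tsupport h1]
      ring
  have hψc : HasCompactSupport ψ :=
    hasCompactSupport_of_forall_notMem (hαc.isCompact.prod hb₀c.isCompact) hψz
  have hψD : Disjoint (tsupport ψ) (closure D ×ˢ closure D) := by
    rw [Set.disjoint_right]
    intro z hz
    rw [notMem_tsupport_iff_eventuallyEq]
    have h1 : ∀ᶠ w in 𝓝 z.2, θ w = 1 := hθ1.filter_mono (nhds_le_nhdsSet hz.2)
    filter_upwards [continuous_snd.continuousAt.eventually h1] with w hw
    simp [hψ, hw]
  obtain ⟨hψi, hψlim⟩ := hC ψ hψs hψc hψD χ hχ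
  have hψev := (Metric.tendsto_nhds.1 hψlim) (e / 2) (by positivity)
  have hg : Continuous fun z : Eu n × Eu n => α z.1 * q z.2 :=
    (hα.continuous.comp continuous_fst).mul (hq.comp continuous_snd)
  filter_upwards [hψev, Ioc_mem_nhdsGT (zero_lt_one' ℝ)] with ε hε1 hε2
  have hgi : Integrable fun z : Eu n × Eu n => α z.1 * q z.2 * regKernel c χ ε z.1 z.2 :=
    integrable_mul_regKernel hc hχ hε2.1 hK hg (B := A * B)
      (fun z => by
        rw [norm_mul]
        exact mul_le_mul (hA _) (hqB _) (norm_nonneg _) hA0)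
      (fun z hz z₂ ξ => by rw [hc0 z hz, mul_zero])
  rw [dist_zero_right] at hε1 ⊢
  have hdiff : ‖∫ z : Eu n × Eu n, (α z.1 * q z.2 * regKernel c χ ε z.1 z.2 -
      ψ z * regKernel c χ ε z.1 z.2)‖ ≤ A * C * (v * η) := by
    have hdom : Integrable fun z : Eu n × Eu n => A * C *
        ((closure D).indicator (fun _ : Eu n => (1 : ℝ)) z.1 *
          (‖q z.2 - β z.2‖ * ((1 + ‖z.2‖ ^ 2) ^ M)⁻¹)) :=
      (hi1.mul_prod hβi).const_mul _
    refine (norm_integral_le_of_norm_le hdom (.of_forall fun z => ?_)).trans ?_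
    · by_cases hz : z.1 ∈ closure D
      · have h1 : α z.1 * q z.2 * regKernel c χ ε z.1 z.2 - ψ z * regKernel c χ ε z.1 z.2 =
            α z.1 * (((1 - θ z.2 : ℝ) : ℂ) * (q z.2 - β z.2)) * regKernel c χ ε z.1 z.2 := by
          -- `q` vanishes on `O`, which contains the support of `θ`, so the factor `1 - θ` can be
          -- inserted in front of `q` for free.
          have h2 : ((1 - θ z.2 : ℝ) : ℂ) * q z.2 = q z.2 := by
            by_cases h3 : z.2 ∈ O
            · rw [hqO _ h3, mul_zero]
            · have : θ z.2 = 0 := image_eq_zero_of_notMem_tsupport fun h4 => h3 (hθO h4)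
              simp [this]
          simp only [hψ]
          linear_combination (-(α z.1) * regKernel c χ ε z.1 z.2) * h2
        rw [h1, Set.indicator_of_mem hz, one_mul]
        by_cases hclose : ‖z.1 - z.2‖ < δ
        · rw [hδθ z.1 hz z.2 hclose]
          simp only [sub_self, Complex.ofReal_zero, zero_mul, mul_zero, norm_zero]
          positivity
        · have h3 := hCk ε hε2.1 hε2.2 z.1 z.2 (hR _ hz) (not_lt.1 hclose)
          have h4 : ‖((1 - θ z.2 : ℝ) : ℂ)‖ ≤ 1 := by
            rw [Complex.norm_real, Real.norm_eq_abs, abs_le]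
            have := hθI z.2
            constructor <;> linarith [this.1, this.2]
          rw [norm_mul, norm_mul, norm_mul]
          calc _ ≤ A * (1 * ‖q z.2 - β z.2‖) * (C * ((1 + ‖z.2‖ ^ 2) ^ M)⁻¹) := by
                gcongr
                exact hA _
            _ = _ := by ring
      · rw [regKernel_eq_zero (hc0 _ hz), Set.indicator_of_notMem hz]
        simp
    · rw [integral_const_mul]
      have h1 := integral_prod_mul (μ := (volume : Measure (Eu n)))
        (ν := (volume : Measure (Eu n)))
        (fun z => (closure D).indicator (fun _ : Eu n => (1 : ℝ)) z)
        (fun z => ‖q z - β z‖ * ((1 + ‖z‖ ^ 2) ^ M)⁻¹)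
      have h2 : ∫ z : Eu n × Eu n, (closure D).indicator (fun _ : Eu n => (1 : ℝ)) z.1 *
          (‖q z.2 - β z.2‖ * ((1 + ‖z.2‖ ^ 2) ^ M)⁻¹) =
          v * ∫ z : Eu n, ‖q z - β z‖ * ((1 + ‖z‖ ^ 2) ^ M)⁻¹ := h1
      rw [h2]
      gcongr
  rw [integral_sub hgi (hψi ε hε2.1)] at hdiff
  have h5 : A * C * (v * η) < e / 2 := by
    have : A * C * (v * η) = (A * C * v) / (A * C * v + 1) * (e / 2) := by
      rw [hη]
      have : A * C * v + 1 ≠ 0 := by positivity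
      field_simp
    rw [this]
    have h6 : (A * C * v) / (A * C * v + 1) < 1 := by
      rw [div_lt_one (by positivity)]
      linarith
    have h7 : 0 < e / 2 := by positivity
    nlinarith
  calc _ ≤ ‖(∫ z : Eu n × Eu n, α z.1 * q z.2 * regKernel c χ ε z.1 z.2) -
        ∫ z, ψ z * regKernel c χ ε z.1 z.2‖ + ‖∫ z, ψ z * regKernel c χ ε z.1 z.2‖ := by
        have := norm_add_le ((∫ z : Eu n × Eu n, α z.1 * q z.2 * regKernel c χ ε z.1 z.2) -
          ∫ z, ψ z * regKernel c χ ε z.1 z.2) (∫ z, ψ z * regKernel c χ ε z.1 z.2)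
        rwa [sub_add_cancel] at this
    _ < e / 2 + e / 2 := add_lt_add_of_le_of_lt (hdiff.trans h5.le) hε1
    _ = e := by ring

end Tail

end NearField

namespace NearField

/-! ### The travel time near `closure D` -/

section Geometry

variable {n : ℕ}

/-- Smooth compactly supported substitutes for the norm `f`, for its gradient `g`, and for the
difference quotient `F` with `|v + w| - |v| = F(v, w)·w`. They are correct at the differences
`z - x` with `x ∈ Q` and `z` in the neighbourhood `K'` of `K`, where the gradient of
`|z - x| + |z - y|` is bounded from below. -/
structure TravelTimeModel {n : ℕ} (K Q : Set (Eu n)) where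
  K' : Set (Eu n)
  isCompact : IsCompact K'
  subset_interior : K ⊆ interior K'
  f : Eu n → ℝ
  f_contDiff : ContDiff ℝ ∞ f
  f_support : HasCompactSupport f
  f_eq : ∀ x ∈ Q, ∀ z ∈ K', f (z - x) = ‖z - x‖
  F : Eu n × Eu n → Eu n
  F_contDiff : ContDiff ℝ ∞ F
  F_support : HasCompactSupport F
  F_eq : ∀ x ∈ Q, ∀ z ∈ K', ∀ w, z + w ∈ K' →
    f (z + w - x) - f (z - x) = inner ℝ (F (z - x, w)) w
  g : Eu n → Eu n
  g_contDiff : ContDiff ℝ ∞ g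
  g_support : HasCompactSupport g
  fderiv_f : ∀ v h, fderiv ℝ f v h = inner ℝ (g v) h
  a : ℝ
  a_pos : 0 < a
  le_norm_sq : ∀ x ∈ Q, ∀ y ∈ Q, ∀ z ∈ K', a ≤ ‖g (z - x) + g (z - y)‖ ^ 2

/-- Obtained by differentiating `|v| · |v| = |v|²` and cancelling `2|v|`. -/
theorem fderiv_norm_apply {v : Eu n} (hv : v ≠ 0) (h : Eu n) :
    fderiv ℝ (fun v : Eu n => ‖v‖) v h = inner ℝ (‖v‖⁻¹ • v) h := by
  have hd : HasFDerivAt (fun v : Eu n => ‖v‖) (fderiv ℝ (fun v : Eu n => ‖v‖) v) v :=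
    ((contDiffAt_norm ℝ hv (n := 1)).differentiableAt one_ne_zero).hasFDerivAt
  have h1 := (hd.mul hd).fderiv
  have h2 : fderiv ℝ (fun v : Eu n => ‖v‖ ^ 2) v h = 2 * inner ℝ v h := by
    rw [fderiv_norm_sq_apply]
    simp
  have e : ((fun v : Eu n => ‖v‖) * fun v : Eu n => ‖v‖) = fun v : Eu n => ‖v‖ ^ 2 := by
    ext v; simp [sq]
  rw [e] at h1
  rw [h1] at h2
  simp only [add_apply, smul_apply, smul_eq_mul] at h2
  rw [inner_smul_left]
  simp only [conj_trivial]
  have : ‖v‖ ≠ 0 := norm_ne_zero_iff.2 hv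
  field_simp
  linarith

/-- The gradient of `|z - x| + |z - y|` vanishes only on the segment from `x` to `y`. -/
theorem mem_segment_of_unit_add_eq_zero {x y z : Eu n} (hx : z ≠ x) (hy : z ≠ y)
    (h : ‖z - x‖⁻¹ • (z - x) + ‖z - y‖⁻¹ • (z - y) = 0) : dist x z + dist z y = dist x y := by
  have hx' : ‖z - x‖ ≠ 0 := norm_ne_zero_iff.2 (sub_ne_zero.2 hx)
  have hy' : ‖z - y‖ ≠ 0 := norm_ne_zero_iff.2 (sub_ne_zero.2 hy)
  set e := ‖z - x‖⁻¹ • (z - x) with he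
  have h1 : z - x = ‖z - x‖ • e := by rw [he, smul_smul, mul_inv_cancel₀ hx', one_smul]
  have h2 : z - y = -(‖z - y‖ • e) := by
    have : e = -(‖z - y‖⁻¹ • (z - y)) := eq_neg_of_add_eq_zero_left h
    rw [this, smul_neg, neg_neg, smul_smul, mul_inv_cancel₀ hy', one_smul]
  have hn : ‖e‖ = 1 := by
    rw [he, norm_smul, norm_inv, norm_norm, inv_mul_cancel₀ hx']
  have h2' : ‖z - y‖ • e = y - z := by
    have := congrArg Neg.neg h2
    simpa using this.symm
  have h3 : y - x = (‖z - x‖ + ‖z - y‖) • e := by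
    rw [add_smul, ← h1, h2']
    abel
  have h4 : ‖y - x‖ = ‖z - x‖ + ‖z - y‖ := by
    rw [h3, norm_smul, hn, mul_one, Real.norm_of_nonneg (by positivity)]
  rw [dist_comm x z, dist_comm x y, dist_eq_norm, dist_eq_norm, dist_eq_norm, h4]

/-- From `|v + w|² - |v|² = (2v + w)·w`, divided by the sum of the norms. Unlike the mean of the
gradient over the segment from `v` to `v + w`, this quotient stays smooth when that segment passes
through the origin. -/
theorem norm_add_sub_norm_eq_inner {v w : Eu n} (hv : v ≠ 0) :
    ‖v + w‖ - ‖v‖ = inner ℝ ((‖v + w‖ + ‖v‖)⁻¹ • ((2 : ℝ) • v + w)) w := by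
  have hpos : 0 < ‖v + w‖ + ‖v‖ := by
    have := norm_pos_iff.2 hv
    positivity
  have h1 := norm_add_sq_real v w
  rw [inner_smul_left, inner_add_left, inner_smul_left, real_inner_self_eq_norm_sq]
  simp only [conj_trivial]
  field_simp
  linarith

theorem contDiffOn_norm_quotient : ContDiffOn ℝ ∞
    (fun p : Eu n × Eu n => (‖p.1 + p.2‖ + ‖p.1‖)⁻¹ • ((2 : ℝ) • p.1 + p.2))
    {p | p.1 ≠ 0 ∧ p.1 + p.2 ≠ 0} := by
  rintro p ⟨hp1, hp2⟩
  have h1 : ContDiffAt ℝ ∞ (fun p : Eu n × Eu n => ‖p.1 + p.2‖) p :=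
    (contDiffAt_fst.add contDiffAt_snd).norm ℝ hp2
  have h2 : ContDiffAt ℝ ∞ (fun p : Eu n × Eu n => ‖p.1‖) p := contDiffAt_fst.norm ℝ hp1
  have h0 : ‖p.1 + p.2‖ + ‖p.1‖ ≠ 0 := by
    have := norm_pos_iff.2 hp1
    positivity
  have h3 : ContDiffAt ℝ ∞ (fun p : Eu n × Eu n => (‖p.1 + p.2‖ + ‖p.1‖)⁻¹) p :=
    (h1.add h2).inv h0
  have h4 : ContDiffAt ℝ ∞ (fun p : Eu n × Eu n => (2 : ℝ) • p.1 + p.2) p :=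
    ((contDiff_fst.const_smul (2 : ℝ)).add contDiff_snd).contDiffAt
  exact (h3.smul h4).contDiffWithinAt

theorem exists_gradient {f : Eu n → ℝ} (hf : ContDiff ℝ ∞ f) (hfc : HasCompactSupport f) :
    ∃ g : Eu n → Eu n, ContDiff ℝ ∞ g ∧ HasCompactSupport g ∧
      ∀ v h, fderiv ℝ f v h = inner ℝ (g v) h := by
  have hd : ContDiff ℝ ∞ (fderiv ℝ f) := hf.fderiv_right (by simp)
  refine ⟨fun v => (InnerProductSpace.toDual ℝ (Eu n)).symm (fderiv ℝ f v), ?_, ?_, ?_⟩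
  · exact ContDiff.comp (g := fun l => (InnerProductSpace.toDual ℝ (Eu n)).symm l)
      ((InnerProductSpace.toDual ℝ (Eu n)).symm.contDiff) hd
  · refine hasCompactSupport_of_forall_notMem (hfc.fderiv ℝ).isCompact fun v hv => ?_
    rw [image_eq_zero_of_notMem_tsupport hv, map_zero]
  · intro v h
    exact (InnerProductSpace.toDual_symm_apply (𝕜 := ℝ) (E := Eu n)).symm

theorem isOpen_norm_quotient_domain : IsOpen {p : Eu n × Eu n | p.1 ≠ 0 ∧ p.1 + p.2 ≠ 0} := by
  have h1 : IsOpen {p : Eu n × Eu n | p.1 ≠ 0} := isOpen_ne_fun continuous_fst continuous_const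
  have h2 : IsOpen {p : Eu n × Eu n | p.1 + p.2 ≠ 0} :=
    isOpen_ne_fun (continuous_fst.add continuous_snd) continuous_const
  exact h1.inter h2

theorem isOpen_dist_add_dist_ne : IsOpen
    {p : (Eu n × Eu n) × Eu n | dist p.1.1 p.2 + dist p.2 p.1.2 ≠ dist p.1.1 p.1.2} := by
  have hd₁ : Continuous fun p : (Eu n × Eu n) × Eu n => dist p.1.1 p.2 + dist p.2 p.1.2 :=
    (continuous_fst.fst.dist continuous_snd).add (continuous_snd.dist continuous_fst.snd)
  have hd₂ : Continuous fun p : (Eu n × Eu n) × Eu n => dist p.1.1 p.1.2 :=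
    continuous_fst.fst.dist continuous_fst.snd
  exact isOpen_ne_fun hd₁ hd₂

theorem exists_compact_prod_subset {K Q : Set (Eu n)} {O : Set ((Eu n × Eu n) × Eu n)}
    (hK : IsCompact K) (hQ : IsCompact Q) (hO : IsOpen O) (hsub : (Q ×ˢ Q) ×ˢ K ⊆ O) :
    ∃ K' : Set (Eu n), IsCompact K' ∧ K ⊆ interior K' ∧ (Q ×ˢ Q) ×ˢ K' ⊆ O := by
  obtain ⟨u, v, -, hv, hQu, hKv, huv⟩ := generalized_tube_lemma (hQ.prod hQ) hK hO hsub
  obtain ⟨K', hK', hKK', hK'v⟩ := exists_compact_between hK hv hKv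
  exact ⟨K', hK', hKK', (Set.prod_mono hQu hK'v).trans huv⟩

theorem dist_add_dist_ne_of_disjoint {x y z : Eu n} {K : Set (Eu n)}
    (h : Disjoint (segment ℝ x y) K) (hz : z ∈ K) : dist x z + dist z y ≠ dist x y := by
  intro heq
  have hw : Wbtw ℝ x z y := dist_add_dist_eq_iff.1 heq
  exact Set.disjoint_left.1 h (mem_segment_iff_wbtw.2 hw) hz

/-- Equality in the triangle inequality characterizes the segment and fails on an open set of `(x,
y, z)`, so the tube lemma thickens `K` while keeping the inequality strict for all `x, y ∈ Q`. -/
theorem exists_compact_between_dist_ne {K Q : Set (Eu n)} (hK : IsCompact K) (hQ : IsCompact Q)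
    (h : ∀ x ∈ Q, ∀ y ∈ Q, Disjoint (segment ℝ x y) K) :
    ∃ K' : Set (Eu n), IsCompact K' ∧ K ⊆ interior K' ∧
      ∀ x ∈ Q, ∀ y ∈ Q, ∀ z ∈ K', dist x z + dist z y ≠ dist x y := by
  have hsub : (Q ×ˢ Q) ×ˢ K ⊆
      {p : (Eu n × Eu n) × Eu n | dist p.1.1 p.2 + dist p.2 p.1.2 ≠ dist p.1.1 p.1.2} := by
    intro p hp
    rw [Set.mem_ofPred_eq]
    rw [Set.mem_prod, Set.mem_prod] at hp
    exact dist_add_dist_ne_of_disjoint (h p.1.1 hp.1.1 p.1.2 hp.1.2) hp.2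
  obtain ⟨K', hK', hKK', hs⟩ := exists_compact_prod_subset hK hQ isOpen_dist_add_dist_ne hsub
  refine ⟨K', hK', hKK', fun x hx y hy z hz => ?_⟩
  have hm : ((x, y), z) ∈ (Q ×ˢ Q) ×ˢ K' := Set.mk_mem_prod (Set.mk_mem_prod hx hy) hz
  have hm' := hs hm
  rw [Set.mem_ofPred_eq] at hm'
  exact hm'

theorem exists_travelTimeModel {K Q : Set (Eu n)} (hK : IsCompact K) (hQ : IsCompact Q)
    (h : ∀ x ∈ Q, ∀ y ∈ Q, Disjoint (segment ℝ x y) K) : Nonempty (TravelTimeModel K Q) := by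
  obtain ⟨K', hK', hKK', hK'O⟩ := exists_compact_between_dist_ne hK hQ h
  have hne : ∀ x ∈ Q, ∀ z ∈ K', z ≠ x := by
    rintro x hx z hz rfl
    exact hK'O z hx z hx z hz (by simp)
  -- All arguments at which the norm is needed: a compact set avoiding its singularity at `0`.
  set S : Set (Eu n) := (fun p : Eu n × Eu n => p.2 - p.1) '' (Q ×ˢ K') with hS
  have hSc : IsCompact S := (hQ.prod hK').image (by fun_prop)
  have hS0 : S ⊆ {0}ᶜ := by
    rintro - ⟨⟨x, z⟩, ⟨hx, hz⟩, rfl⟩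
    exact sub_ne_zero.2 (hne x hx z hz)
  have hSm : ∀ x ∈ Q, ∀ z ∈ K', z - x ∈ S := fun x hx z hz => ⟨(x, z), ⟨hx, hz⟩, rfl⟩
  obtain ⟨f, hf, hfc, hfe⟩ := exists_contDiff_hasCompactSupport_eq hSc
    (isOpen_compl_singleton (x := (0 : Eu n))) hS0 (f := fun v : Eu n => ‖v‖)
    (fun v hv => (contDiffAt_norm ℝ hv).contDiffWithinAt)
  -- The pairs `(v, w)` with both `v` and `v + w` in `S`, where the difference quotient is smooth.
  set S₂ : Set (Eu n × Eu n) := (fun p : Eu n × Eu n => (p.1, p.2 - p.1)) '' (S ×ˢ S) with hS₂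
  have hS₂c : IsCompact S₂ := (hSc.prod hSc).image (by fun_prop)
  set O₂ : Set (Eu n × Eu n) := {p | p.1 ≠ 0 ∧ p.1 + p.2 ≠ 0} with hO₂
  have hO₂o : IsOpen O₂ := isOpen_norm_quotient_domain
  have hS₂O : S₂ ⊆ O₂ := by
    rintro - ⟨⟨p, q⟩, ⟨hp, hq⟩, rfl⟩
    refine ⟨hS0 hp, ?_⟩
    simpa using hS0 hq
  obtain ⟨F, hF, hFc, hFe⟩ := exists_contDiff_hasCompactSupport_eq hS₂c hO₂o hS₂O
    contDiffOn_norm_quotient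
  obtain ⟨g, hgs, hgc, hgf⟩ := exists_gradient hf hfc
  have hgS : ∀ v ∈ S, g v = ‖v‖⁻¹ • v := by
    intro v hv
    refine ext_inner_right ℝ fun h => ?_
    have h1 : f =ᶠ[𝓝 v] fun v => ‖v‖ := hfe.filter_mono (nhds_le_nhdsSet hv)
    rw [← hgf, h1.fderiv_eq, fderiv_norm_apply (hS0 hv)]
  have hcont : Continuous fun p : (Eu n × Eu n) × Eu n =>
      ‖g (p.2 - p.1.1) + g (p.2 - p.1.2)‖ ^ 2 := by
    have := hgs.continuous
    fun_prop
  obtain ⟨a, ha, hae⟩ := ((hQ.prod hQ).prod hK').exists_forall_le' hcont.continuousOn (a := 0) (by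
    rintro ⟨⟨x, y⟩, z⟩ ⟨⟨hx, hy⟩, hz⟩
    simp only at hx hy hz
    refine pow_pos (norm_pos_iff.2 fun h0 => ?_) 2
    rw [hgS _ (hSm x hx z hz), hgS _ (hSm y hy z hz)] at h0
    exact hK'O x hx y hy z hz
      (mem_segment_of_unit_add_eq_zero (hne x hx z hz) (hne y hy z hz) h0))
  exact ⟨{ K' := K', isCompact := hK', subset_interior := hKK', f := f, f_contDiff := hf,
           f_support := hfc
           f_eq := fun x hx z hz => hfe.self_of_nhdsSet _ (hSm x hx z hz)
           F := F, F_contDiff := hF, F_support := hFc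
           F_eq := by
             intro x hx z hz w hzw
             have h1 := hSm x hx z hz
             have h2 := hSm x hx (z + w) hzw
             have h3 : z + w - x = z - x + w := by abel
             rw [hfe.self_of_nhdsSet _ h1, hfe.self_of_nhdsSet _ h2, h3,
               hFe.self_of_nhdsSet (z - x, w) ⟨(z - x, z + w - x), ⟨h1, h2⟩, by
                 simp⟩]
             exact norm_add_sub_norm_eq_inner (hS0 h1)
           g := g, g_contDiff := hgs
           g_support := hgc
           fderiv_f := hgf, a := a, a_pos := ha
           le_norm_sq := fun x hx y hy z hz => hae ((x, y), z) ⟨⟨hx, hy⟩, hz⟩ }⟩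

end Geometry

end NearField

namespace NearField

/-! ### Phases with gradients of a prescribed size -/

section ScaledPhase

variable {ι V G : Type*} [NormedAddCommGroup V] [NormedSpace ℝ V] [NormedAddCommGroup G]
  [NormedSpace ℝ G]

/-- Families of smooth phases whose gradients are of size `Λ`, with all their derivatives. -/
structure ScaledPhase (Λ : ι → ℝ) (Ψ : ι → V → ℝ) : Prop where
  contDiff : ∀ i, ContDiff ℝ ∞ (Ψ i)
  bounded : BoundedFamily (fun i v => (Λ i)⁻¹ • fderiv ℝ (Ψ i) v)

theorem ScaledPhase.add {Λ : ι → ℝ} {Ψ Ψ' : ι → V → ℝ} (h : ScaledPhase Λ Ψ)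
    (h' : ScaledPhase Λ Ψ') : ScaledPhase Λ (fun i v => Ψ i v + Ψ' i v) := by
  refine ⟨fun i => (h.contDiff i).add (h'.contDiff i), ?_⟩
  have e : (fun i v => (Λ i)⁻¹ • fderiv ℝ (fun v => Ψ i v + Ψ' i v) v) =
      fun i v => (Λ i)⁻¹ • fderiv ℝ (Ψ i) v + (Λ i)⁻¹ • fderiv ℝ (Ψ' i) v := by
    funext i v
    rw [← smul_add, fderiv_fun_add ((h.contDiff i).differentiable (by simp) v)
      ((h'.contDiff i).differentiable (by simp) v)]
  rw [e]
  exact h.bounded.add h'.bounded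

theorem ScaledPhase.of_boundedFamily {Λ α : ι → ℝ} {E : ι → V → ℝ} (hα : ∀ i, |α i| ≤ Λ i)
    (hE : BoundedFamily E) : ScaledPhase Λ (fun i v => α i * E i v) := by
  refine ⟨fun i => contDiff_const.mul (hE.contDiff i), ?_⟩
  have e : (fun i v => (Λ i)⁻¹ • fderiv ℝ (fun v => α i * E i v) v) =
      fun i v => ((Λ i)⁻¹ * α i) • fderiv ℝ (E i) v := by
    funext i v
    rw [fderiv_const_mul ((hE.contDiff i).differentiable (by simp) v), smul_smul]
  rw [e]
  refine BoundedFamily.smul (boundedFamily_const _ (C := 1) fun i => ?_) hE.fderiv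
  have h0 : 0 ≤ Λ i := (abs_nonneg _).trans (hα i)
  rw [norm_mul, norm_inv, Real.norm_eq_abs, Real.norm_eq_abs, abs_of_nonneg h0]
  rcases h0.eq_or_lt with h1 | h1
  · simp [← h1]
  · rw [inv_mul_le_iff₀ h1, mul_one]
    exact hα i

theorem ScaledPhase.of_clm {Λ : ι → ℝ} (hΛ : ∀ i, 0 ≤ Λ i) {L : ι → V →L[ℝ] ℝ} {C : ℝ}
    (hC : 0 ≤ C) (hL : ∀ i, ‖L i‖ ≤ C * Λ i) : ScaledPhase Λ (fun i v => L i v) := by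
  refine ⟨fun i => (L i).contDiff, ?_⟩
  simp only [ContinuousLinearMap.fderiv]
  refine boundedFamily_const _ (C := C) fun i => ?_
  rw [norm_smul, norm_inv, Real.norm_of_nonneg (hΛ i)]
  rcases (hΛ i).eq_or_lt with h1 | h1
  · simp [← h1, hC]
  · rw [inv_mul_le_iff₀ h1, mul_comm]
    exact hL i

theorem iteratedFDeriv_fun_const_smul {f : V → G} (hf : ContDiff ℝ ∞ f) (a : ℝ) (j : ℕ) (v : V) :
    iteratedFDeriv ℝ j (fun v => a • f v) v = a • iteratedFDeriv ℝ j f v :=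
  iteratedFDeriv_const_smul_apply ((hf.of_le (natCast_le_infty j)).contDiffAt)

theorem WeightedFamily.normalize {w : ι → ℝ} (hw : ∀ i, 0 < w i) {F : ι → V → G}
    (h : WeightedFamily (fun i _ => w i) F) : BoundedFamily (fun i v => (w i)⁻¹ • F i v) := by
  refine ⟨fun i => (h.contDiff i).const_smul _, fun j => ?_⟩
  obtain ⟨C, hC, hb⟩ := h.bound j
  refine ⟨C, hC, fun i v => ?_⟩
  rw [iteratedFDeriv_fun_const_smul (h.contDiff i), norm_smul, norm_inv,
    Real.norm_of_nonneg (hw i).le, inv_mul_le_iff₀ (hw i), mul_one, mul_comm]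
  exact hb i v

theorem boundedFamily_translate {V' : Type*} [NormedAddCommGroup V'] [NormedSpace ℝ V']
    {f : V' → G} (hf : ContDiff ℝ ∞ f) (hfc : HasCompactSupport f)
    (L : V →L[ℝ] V') (b : ι → V') : BoundedFamily (fun i v => f (L v + b i)) :=
  (boundedFamily_of_hasCompactSupport hf hfc).comp
    (boundedDerivFamily_affine (fun _ => L) b (C := ‖L‖) fun _ => le_rfl)

end ScaledPhase

/-! ### Smooth travel time, gradient and difference quotient, uniformly in source and receiver -/

section Model

variable {ι : Type*} {n : ℕ} {K Q : Set (Eu n)}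

/-- The smooth substitute for the travel time `|z - x| + |z - y|`. -/
def TravelTimeModel.phase (M : TravelTimeModel K Q) (x y z : Eu n) : ℝ :=
  M.f (z - x) + M.f (z - y)

/-- The gradient of the travel time. -/
def TravelTimeModel.grad (M : TravelTimeModel K Q) (x y z : Eu n) : Eu n :=
  M.g (z - x) + M.g (z - y)

/-- The difference quotient of the travel time. -/
def TravelTimeModel.quot (M : TravelTimeModel K Q) (x y : Eu n) (p : Eu n × Eu n) : Eu n :=
  M.F (p.1 - x, p.2) + M.F (p.1 - y, p.2)

variable (M : TravelTimeModel K Q)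

theorem TravelTimeModel.phase_contDiff (x y : Eu n) : ContDiff ℝ ∞ (M.phase x y) := by
  have h1 : ContDiff ℝ ∞ fun z => M.f (z - x) :=
    M.f_contDiff.comp (contDiff_id.sub contDiff_const)
  have h2 : ContDiff ℝ ∞ fun z => M.f (z - y) :=
    M.f_contDiff.comp (contDiff_id.sub contDiff_const)
  exact h1.add h2

theorem TravelTimeModel.phase_eq {x y z : Eu n} (hx : x ∈ Q) (hy : y ∈ Q) (hz : z ∈ M.K') :
    M.phase x y z = ‖x - z‖ + ‖z - y‖ := by
  rw [phase, M.f_eq x hx z hz, M.f_eq y hy z hz, norm_sub_rev x z]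

theorem TravelTimeModel.phase_add_sub {x y z w : Eu n} (hx : x ∈ Q) (hy : y ∈ Q)
    (hz : z ∈ M.K') (hzw : z + w ∈ M.K') :
    M.phase x y (z + w) - M.phase x y z = inner ℝ (M.quot x y (z, w)) w := by
  have h1 := M.F_eq x hx z hz w hzw
  have h2 := M.F_eq y hy z hz w hzw
  simp only [phase, quot, inner_add_left]
  linarith

theorem TravelTimeModel.boundedFamily_phase {V : Type*} [NormedAddCommGroup V] [NormedSpace ℝ V]
    (L : V →L[ℝ] Eu n) (x y : ι → Eu n) : BoundedFamily (fun i v => M.phase (x i) (y i) (L v)) := by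
  have h1 := boundedFamily_translate M.f_contDiff M.f_support L (fun i => - x i)
  have h2 := boundedFamily_translate M.f_contDiff M.f_support L (fun i => - y i)
  simpa only [phase, sub_eq_add_neg] using h1.add h2

theorem TravelTimeModel.boundedFamily_grad {V : Type*} [NormedAddCommGroup V] [NormedSpace ℝ V]
    (L : V →L[ℝ] Eu n) (x y : ι → Eu n) : BoundedFamily (fun i v => M.grad (x i) (y i) (L v)) := by
  have h1 := boundedFamily_translate M.g_contDiff M.g_support L (fun i => - x i)
  have h2 := boundedFamily_translate M.g_contDiff M.g_support L (fun i => - y i)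
  simpa only [grad, sub_eq_add_neg] using h1.add h2

theorem TravelTimeModel.boundedFamily_quot (x y : ι → Eu n) :
    BoundedFamily (fun i p => M.quot (x i) (y i) p) := by
  have h1 := boundedFamily_translate M.F_contDiff M.F_support
    (ContinuousLinearMap.id ℝ (Eu n × Eu n)) (fun i => (- x i, (0 : Eu n)))
  have h2 := boundedFamily_translate M.F_contDiff M.F_support
    (ContinuousLinearMap.id ℝ (Eu n × Eu n)) (fun i => (- y i, (0 : Eu n)))
  have e : (fun i p => M.quot (x i) (y i) p) = fun i (p : Eu n × Eu n) =>
      M.F (ContinuousLinearMap.id ℝ (Eu n × Eu n) p + (- x i, (0 : Eu n))) +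
      M.F (ContinuousLinearMap.id ℝ (Eu n × Eu n) p + (- y i, (0 : Eu n))) := by
    funext i p
    obtain ⟨z, w⟩ := p
    simp only [quot, ContinuousLinearMap.id_apply, Prod.mk_add_mk, add_zero, sub_eq_add_neg]
  rw [e]
  exact h1.add h2

theorem TravelTimeModel.fderiv_phase {V : Type*} [NormedAddCommGroup V] [NormedSpace ℝ V]
    (L : V →L[ℝ] Eu n) (x y : Eu n) (v h : V) :
    fderiv ℝ (fun v => M.phase x y (L v)) v h = inner ℝ (M.grad x y (L v)) (L h) := by
  have key : ∀ x : Eu n, HasFDerivAt (fun v => M.f (L v - x))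
      ((fderiv ℝ M.f (L v - x)).comp L) v := by
    intro x
    have h1 : HasFDerivAt M.f (fderiv ℝ M.f (L v - x)) (L v - x) :=
      (M.f_contDiff.differentiable (by simp) _).hasFDerivAt
    have h2 : HasFDerivAt (fun v => L v - x) L v := L.hasFDerivAt.sub_const x
    exact h1.comp v h2
  have h3 : HasFDerivAt (fun v => M.phase x y (L v)) _ v := (key x).add (key y)
  rw [h3.fderiv, grad, inner_add_left, ← M.fderiv_f, ← M.fderiv_f]
  rfl

end Model

end NearField

namespace NearField

/-! ### Decay in `(z, w)` at a fixed shifted frequency `ζ` -/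

section HighFrequency

variable {ι : Type*} {n : ℕ} {K Q : Set (Eu n)} (M : TravelTimeModel K Q)

theorem TravelTimeModel.isCompact_pairs :
    IsCompact {p : Eu n × Eu n | p.1 ∈ M.K' ∧ p.1 + p.2 ∈ M.K'} := by
  have hc : Continuous fun p : Eu n × Eu n => (p.1, p.2 - p.1) :=
    continuous_fst.prodMk (continuous_snd.sub continuous_fst)
  have h := (M.isCompact.prod M.isCompact).image hc
  have e : (fun p : Eu n × Eu n => (p.1, p.2 - p.1)) '' (M.K' ×ˢ M.K') =
      {p : Eu n × Eu n | p.1 ∈ M.K' ∧ p.1 + p.2 ∈ M.K'} := by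
    ext ⟨z, w⟩
    rw [Set.mem_ofPred_eq]
    constructor
    · rintro ⟨⟨u, v⟩, ⟨hu, hv⟩, he⟩
      simp only [Prod.mk.injEq] at he
      obtain ⟨rfl, rfl⟩ := he
      exact ⟨hu, by simpa using hv⟩
    · rintro ⟨hz, hw⟩
      exact ⟨(z, z + w), ⟨hz, hw⟩, by simp⟩
  rwa [e] at h

/-- The argument at which the symbol is evaluated after the change of variables. -/
theorem TravelTimeModel.boundedDerivFamily_argument (x y ζ : ι → Eu n) {s t : ι → ℝ}
    (hs : ∀ i, 0 ≤ s i) (hs' : ∀ i, s i ≤ 1) : BoundedDerivFamily fun i (p : Eu n × Eu n) =>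
      (p.1, t i • ζ i - s i • M.quot (x i) (y i) p) := by
  have h1 : BoundedDerivFamily fun (_ : ι) (p : Eu n × Eu n) => p.1 := by
    have := boundedDerivFamily_affine (fun _ : ι => ContinuousLinearMap.fst ℝ (Eu n) (Eu n))
      (fun _ => 0) (C := ‖ContinuousLinearMap.fst ℝ (Eu n) (Eu n)‖) fun _ => le_rfl
    simpa using this
  have h2 : BoundedFamily fun i (p : Eu n × Eu n) => (-s i) • M.quot (x i) (y i) p :=
    BoundedFamily.smul (boundedFamily_const _ (C := 1) fun i => by
      rw [norm_neg, Real.norm_of_nonneg (hs i)]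
      exact hs' i) (M.boundedFamily_quot x y)
  have h3 : BoundedDerivFamily fun i (_ : Eu n × Eu n) => t i • ζ i := by
    have := boundedDerivFamily_affine (fun _ : ι => (0 : Eu n × Eu n →L[ℝ] Eu n))
      (fun i => t i • ζ i) (C := 0) fun _ => by simp
    simpa using this
  have h4 := h3.add h2.boundedDeriv
  have e : (fun i (p : Eu n × Eu n) => (p.1, t i • ζ i - s i • M.quot (x i) (y i) p)) =
      fun i (p : Eu n × Eu n) => (p.1, t i • ζ i + (-s i) • M.quot (x i) (y i) p) := by
    funext i p
    rw [neg_smul, sub_eq_add_neg]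
  rw [e]
  exact h1.prodMk h4

/-- As `s, t ≤ 1` and the quotient is bounded, the symbol weight at `tζ - s Φ` is at most a constant
times `(1 + |ζ|)^m`. Dividing by this is harmless, since arbitrary decay in `ζ` is available later.
-/
theorem TravelTimeModel.boundedFamily_amplitude {θ : Eu n → ℂ} (hθ : ContDiff ℝ ∞ θ)
    (hθc : HasCompactSupport θ) (x y ζ : ι → Eu n) {s t : ι → ℝ}
    (hs : ∀ i, 0 ≤ s i) (hs' : ∀ i, s i ≤ 1) (ht : ∀ i, 0 ≤ t i) (ht' : ∀ i, t i ≤ 1) {m : ℕ}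
    {b : ι → Eu n × Eu n → ℂ} (hb : WeightedFamily (fun _ p => (1 + ‖p.2‖) ^ m) b) :
    BoundedFamily fun i (p : Eu n × Eu n) => ((1 + ‖ζ i‖) ^ m)⁻¹ •
      (θ (p.1 + p.2) * b i (p.1, t i • ζ i - s i • M.quot (x i) (y i) p)) := by
  obtain ⟨B, hB, hquot⟩ := (M.boundedFamily_quot x y).norm_le
  have h1 := hb.comp (fun _ _ => by positivity)
    (M.boundedDerivFamily_argument x y ζ (t := t) hs hs')
  have h2 : BoundedFamily fun (_ : ι) (p : Eu n × Eu n) => θ (p.1 + p.2) := by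
    have := boundedFamily_translate (ι := ι) hθ hθc
      (ContinuousLinearMap.fst ℝ (Eu n) (Eu n) + ContinuousLinearMap.snd ℝ (Eu n) (Eu n))
      (fun _ => 0)
    simpa using this
  have h3 := WeightedFamily.bilin (ContinuousLinearMap.mul ℝ ℂ) (fun _ _ => zero_le_one)
    (fun _ _ => by positivity) h2 h1
  refine WeightedFamily.normalize (w := fun i => (1 + ‖ζ i‖) ^ m) (fun i => by positivity)
    (h3.mono (B := (1 + B) ^ m) (by positivity) fun i p => ?_)
  rw [one_mul, ← mul_pow]
  gcongr
  have h4 : ‖t i • ζ i - s i • M.quot (x i) (y i) p‖ ≤ 1 * ‖ζ i‖ + 1 * B := by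
    refine (norm_sub_le _ _).trans ?_
    rw [norm_smul, norm_smul, Real.norm_of_nonneg (hs i), Real.norm_of_nonneg (ht i)]
    gcongr
    · exact ht' i
    · exact hs' i
    · exact hquot i p
  nlinarith [norm_nonneg (ζ i)]

theorem ScaledPhase.inner {V : Type*} [NormedAddCommGroup V] [NormedSpace ℝ V] {Λ : ι → ℝ}
    (T : V →L[ℝ] Eu n) {C : ℝ} (hC : 0 ≤ C) {ζ : ι → Eu n} (hζ : ∀ i, ‖ζ i‖ ≤ C * Λ i)
    (hΛ : ∀ i, 0 ≤ Λ i) : ScaledPhase Λ fun i v => Inner.inner ℝ (ζ i) (T v) := by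
  have h : ∀ i, ‖(innerSL ℝ (ζ i)).comp T‖ ≤ (C * ‖T‖) * Λ i := fun i => by
    refine (ContinuousLinearMap.opNorm_comp_le _ _).trans ?_
    rw [innerSL_apply_norm]
    calc _ ≤ C * Λ i * ‖T‖ := by gcongr; exact hζ i
      _ = _ := by ring
  exact ScaledPhase.of_clm hΛ (by positivity) h

theorem fderiv_inner_clm {V : Type*} [NormedAddCommGroup V] [NormedSpace ℝ V]
    (T : V →L[ℝ] Eu n) (ζ : Eu n) (v h : V) :
    fderiv ℝ (fun v => inner ℝ ζ (T v)) v h = inner ℝ ζ (T h) := by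
  have h1 : HasFDerivAt (fun v => inner ℝ ζ (T v)) ((innerSL ℝ ζ).comp T) v :=
    ((innerSL ℝ ζ).comp T).hasFDerivAt
  rw [h1.fderiv]
  rfl

/-- The phase `l φ(z) + ζ·w`. -/
theorem TravelTimeModel.fderiv_shifted_phase (x y : Eu n) (l : ℝ) (ζ : Eu n)
    (p h : Eu n × Eu n) :
    fderiv ℝ (fun p : Eu n × Eu n => l * M.phase x y (ContinuousLinearMap.fst ℝ (Eu n) (Eu n) p) +
      inner ℝ ζ (ContinuousLinearMap.snd ℝ (Eu n) (Eu n) p)) p h =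
      l * inner ℝ (M.grad x y p.1) h.1 + inner ℝ ζ h.2 := by
  have hd1 : DifferentiableAt ℝ (fun p : Eu n × Eu n =>
      M.phase x y (ContinuousLinearMap.fst ℝ (Eu n) (Eu n) p)) p :=
    ((M.phase_contDiff x y).comp (ContinuousLinearMap.fst ℝ (Eu n) (Eu n)).contDiff).differentiable
      (by simp) p
  have hd2 : DifferentiableAt ℝ (fun p : Eu n × Eu n =>
      (inner ℝ ζ (ContinuousLinearMap.snd ℝ (Eu n) (Eu n) p) : ℝ)) p :=
    ((innerSL ℝ ζ).comp (ContinuousLinearMap.snd ℝ (Eu n) (Eu n))).differentiableAt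
  rw [fderiv_fun_add (hd1.const_mul l) hd2, fderiv_const_mul hd1, add_apply, smul_apply,
    M.fderiv_phase, fderiv_inner_clm]
  rfl

/-- Along `(sgn(l) ∇φ, -ζ/|ζ|)` the phase `l φ(z) - ζ·w` grows at the rate `|l| |∇φ|² + |ζ|`. For `ζ
= 0` the second component is `0`, as it should be. -/
theorem TravelTimeModel.shifted_phase_lower_bound {x y z : Eu n} (hx : x ∈ Q) (hy : y ∈ Q)
    (hz : z ∈ M.K') (l : ℝ) (ζ : Eu n) : min M.a 1 * (|l| + ‖ζ‖) ≤
      l * inner ℝ (M.grad x y z) ((if 0 ≤ l then (1 : ℝ) else -1) • M.grad x y z) +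
        inner ℝ (-ζ) (-(‖ζ‖⁻¹ • ζ)) := by
  have hσl : l * (if 0 ≤ l then (1 : ℝ) else -1) = |l| := by
    split_ifs with h
    · rw [mul_one, abs_of_nonneg h]
    · rw [abs_of_neg (not_le.1 h), mul_neg_one]
  rw [real_inner_smul_right, real_inner_self_eq_norm_sq, inner_neg_neg, real_inner_smul_right,
    real_inner_self_eq_norm_sq, ← mul_assoc, hσl]
  have h1 := M.le_norm_sq x hx y hy z hz
  have h2 : ‖ζ‖⁻¹ * ‖ζ‖ ^ 2 = ‖ζ‖ := by
    rcases (norm_nonneg ζ).eq_or_lt with h | h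
    · simp [← h]
    · field_simp
  rw [h2, mul_add]
  refine add_le_add ?_ ?_
  · rw [mul_comm]
    exact mul_le_mul_of_nonneg_left ((min_le_left _ _).trans h1) (abs_nonneg _)
  · exact (mul_le_mul_of_nonneg_right (min_le_right _ _) (norm_nonneg _)).trans (one_mul _).le

theorem TravelTimeModel.boundedFamily_direction (x y ζ : ι → Eu n) (l : ι → ℝ) :
    BoundedFamily fun i (p : Eu n × Eu n) =>
      ((if 0 ≤ l i then (1 : ℝ) else -1) •
        M.grad (x i) (y i) (ContinuousLinearMap.fst ℝ (Eu n) (Eu n) p), -(‖ζ i‖⁻¹ • ζ i)) := by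
  refine BoundedFamily.prodMk (BoundedFamily.smul (boundedFamily_const _ (C := 1) fun i => ?_)
    (M.boundedFamily_grad _ x y)) (boundedFamily_const _ (C := 1) fun i => ?_)
  · split_ifs <;> simp
  · rw [norm_neg, norm_smul, norm_inv, norm_norm]
    exact inv_mul_le_one

theorem TravelTimeModel.scaledPhase_shifted (x y ζ : ι → Eu n) (l : ι → ℝ) :
    ScaledPhase (fun i => |l i| + ‖ζ i‖) fun i (p : Eu n × Eu n) =>
      l i * M.phase (x i) (y i) (ContinuousLinearMap.fst ℝ (Eu n) (Eu n) p) +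
        inner ℝ (-ζ i) (ContinuousLinearMap.snd ℝ (Eu n) (Eu n) p) := by
  have h1 : ∀ i, |l i| ≤ |l i| + ‖ζ i‖ := fun i => le_add_of_nonneg_right (norm_nonneg _)
  have h2 : ∀ i, ‖-ζ i‖ ≤ 1 * (|l i| + ‖ζ i‖) := fun i => by
    rw [norm_neg, one_mul]
    exact le_add_of_nonneg_left (abs_nonneg _)
  exact (ScaledPhase.of_boundedFamily h1 (M.boundedFamily_phase _ x y)).add
    (ScaledPhase.inner _ zero_le_one h2 fun i => by positivity)

instance isAddHaarMeasure_volume_prod : (volume : Measure (Eu n × Eu n)).IsAddHaarMeasure :=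
  inferInstanceAs (Measure.prod (volume : Measure (Eu n)) volume).IsAddHaarMeasure

/-- Here `ζ` is a mere parameter, part of the index of the family. The amplitude lives on `z ∈ K'`,
`z + w ∈ K'`: the symbol controls the first condition and `θ` the second. -/
theorem TravelTimeModel.high_frequency_pointwise {θ : Eu n → ℂ} (hθ : ContDiff ℝ ∞ θ)
    (hθc : HasCompactSupport θ) (hθK : ∀ z ∉ M.K', θ z = 0) {x y : ι → Eu n}
    (hx : ∀ i, x i ∈ Q) (hy : ∀ i, y i ∈ Q) (l : ι → ℝ) (ζ : ι → Eu n) {s t : ι → ℝ}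
    (hs : ∀ i, 0 ≤ s i) (hs' : ∀ i, s i ≤ 1) (ht : ∀ i, 0 ≤ t i) (ht' : ∀ i, t i ≤ 1) {m : ℕ}
    {b : ι → Eu n × Eu n → ℂ} (hb : WeightedFamily (fun _ p => (1 + ‖p.2‖) ^ m) b)
    (hbK : ∀ i, ∀ z ∉ K, ∀ η, b i (z, η) = 0) (N : ℕ) : ∃ C : ℝ, 0 ≤ C ∧ ∀ i,
      (1 + (|l i| + ‖ζ i‖)) ^ N * ‖∫ p : Eu n × Eu n,
        Complex.exp (Complex.I * ((l i * M.phase (x i) (y i) p.1 - inner ℝ p.2 (ζ i) : ℝ) : ℂ)) *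
          (((1 + ‖ζ i‖) ^ m)⁻¹ •
            (θ (p.1 + p.2) * b i (p.1, t i • ζ i - s i • M.quot (x i) (y i) p)))‖ ≤ C := by
  have hA := M.boundedFamily_amplitude hθ hθc x y ζ hs hs' ht ht' hb
  have hΨ := M.scaledPhase_shifted x y ζ l
  have hX := M.boundedFamily_direction x y ζ l
  have key := nonstationary_phase_one_add M.isCompact_pairs (a := min M.a 1)
    (lt_min M.a_pos one_pos) (fun i => by positivity) hΨ.contDiff hΨ.bounded hX
    (fun i p hp => ?_) N hA
    (fun i p hp => ?_)
  · obtain ⟨C, hC, h⟩ := key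
    refine ⟨C, hC, fun i => ?_⟩
    have := h i
    have e : ∀ p : Eu n × Eu n, l i * M.phase (x i) (y i) p.1 - inner ℝ p.2 (ζ i) =
        l i * M.phase (x i) (y i) (ContinuousLinearMap.fst ℝ (Eu n) (Eu n) p) +
          inner ℝ (-ζ i) (ContinuousLinearMap.snd ℝ (Eu n) (Eu n) p) := fun p => by
      rw [inner_neg_left, real_inner_comm, sub_eq_add_neg]
      rfl
    simp only [e]
    exact this
  · rw [Set.mem_ofPred_eq] at hp
    rw [M.fderiv_shifted_phase]
    exact M.shifted_phase_lower_bound (hx i) (hy i) hp.1 (l i) (ζ i)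
  · rw [Set.mem_ofPred_eq, not_and_or] at hp
    rcases hp with hp | hp
    · rw [hbK i p.1 (fun hk => hp (interior_subset (M.subset_interior hk))), mul_zero, smul_zero]
    · rw [hθK _ hp, zero_mul, smul_zero]

end HighFrequency

end NearField

namespace NearField

/-! ### The change of variables and integration over `ζ` -/

section HighFrequency

variable {ι : Type*} {n : ℕ} {K Q : Set (Eu n)} (M : TravelTimeModel K Q)

theorem integral_prod_shear (f : Eu n × Eu n → ℂ) :
    ∫ p, f p = ∫ p : Eu n × Eu n, f (p.1, p.1 + p.2) :=
  ((measurePreserving_prod_add (volume : Measure (Eu n)) volume).integral_comp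
    (MeasurableEquiv.shearAddRight (Eu n)).measurableEmbedding f).symm

theorem TravelTimeModel.continuous_quot (x y : Eu n) : Continuous (M.quot x y) :=
  ((M.boundedFamily_quot (fun _ : Unit => x) (fun _ => y)).contDiff ()).continuous

theorem TravelTimeModel.exists_norm_quot_le (x y : Eu n) :
    ∃ B, 0 ≤ B ∧ ∀ p, ‖M.quot x y p‖ ≤ B := by
  obtain ⟨B, hB, h⟩ := (M.boundedFamily_quot (fun _ : Unit => x) (fun _ => y)).norm_le
  exact ⟨B, hB, h ()⟩

/-- The shift of the frequency contributes `k₂ Φ·w`, exactly `k₂ (φ(z + w) - φ(z))`. Only the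
difference `k₁ - k₂` of the wave numbers survives. -/
theorem TravelTimeModel.phase_shift {x y z w : Eu n} (hx : x ∈ Q) (hy : y ∈ Q)
    (hz : z ∈ M.K') (hzw : z + w ∈ M.K') (k₁ k₂ : ℝ) (ζ : Eu n) :
    k₁ * M.phase x y z - k₂ * M.phase x y (z + w) +
      inner ℝ (z - (z + w)) (ζ - k₂ • M.quot x y (z, w)) =
    (k₁ - k₂) * M.phase x y z - inner ℝ w ζ := by
  have h := M.phase_add_sub hx hy hz hzw
  rw [real_inner_comm] at h
  have e : z - (z + w) = -w := by abel
  rw [e, inner_neg_left, inner_sub_right, real_inner_smul_right, ← h]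
  ring

/-- The integrand after the change of variables `z₂ = z + w`, `ξ = ζ - k₂ Φ(z, w)`. -/
noncomputable def TravelTimeModel.shiftedIntegrand (M : TravelTimeModel K Q) (θ : Eu n → ℂ)
    (β : Eu n × Eu n → ℂ) (x y : Eu n) (k₁ k₂ : ℝ) (p : Eu n × Eu n) (ζ : Eu n) : ℂ :=
  Complex.exp (Complex.I * (((k₁ - k₂) * M.phase x y p.1 - inner ℝ p.2 ζ : ℝ) : ℂ)) *
    (θ (p.1 + p.2) * β (p.1, ζ - k₂ • M.quot x y p))

/-- The integrand of the regularized oscillatory integral. -/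
noncomputable def TravelTimeModel.integrand (M : TravelTimeModel K Q) (θ : Eu n → ℂ)
    (β : Eu n × Eu n → ℂ) (x y : Eu n) (k₁ k₂ : ℝ) (p : Eu n × Eu n) (ξ : Eu n) : ℂ :=
  Complex.exp (Complex.I * ((k₁ * M.phase x y p.1 - k₂ * M.phase x y p.2 +
    inner ℝ (p.1 - p.2) ξ : ℝ) : ℂ)) * (θ p.2 * β (p.1, ξ))

/-- The phase identity holds only where the model is correct; elsewhere `β` or `θ` makes both sides
zero. -/
theorem TravelTimeModel.integrand_shift {θ : Eu n → ℂ} (hθK : ∀ z ∉ M.K', θ z = 0)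
    {β : Eu n × Eu n → ℂ} (hβK : ∀ z ∉ K, ∀ η, β (z, η) = 0) {x y : Eu n} (hx : x ∈ Q) (hy : y ∈ Q)
    (k₁ k₂ : ℝ) (p : Eu n × Eu n) (ζ : Eu n) :
    M.integrand θ β x y k₁ k₂ (p.1, p.1 + p.2) (ζ - k₂ • M.quot x y p) =
      M.shiftedIntegrand θ β x y k₁ k₂ p ζ := by
  obtain ⟨z, w⟩ := p
  simp only [integrand, shiftedIntegrand]
  by_cases h1 : z ∈ K
  · by_cases h2 : z + w ∈ M.K'
    · rw [M.phase_shift hx hy (interior_subset (M.subset_interior h1)) h2]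
    · rw [hθK _ h2, zero_mul, mul_zero, mul_zero]
  · rw [hβK z h1, mul_zero, mul_zero, mul_zero]

theorem continuous_cexp_ofReal {X : Type*} [TopologicalSpace X] {f : X → ℝ} (hf : Continuous f) :
    Continuous fun x => Complex.exp (Complex.I * (f x : ℂ)) :=
  Complex.continuous_exp.comp (continuous_const.mul (Complex.continuous_ofReal.comp hf))

theorem TravelTimeModel.continuous_shiftedIntegrand {θ : Eu n → ℂ} (hθ : Continuous θ)
    {β : Eu n × Eu n → ℂ} (hβ : Continuous β) (x y : Eu n) (k₁ k₂ : ℝ) :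
    Continuous fun q : (Eu n × Eu n) × Eu n => M.shiftedIntegrand θ β x y k₁ k₂ q.1 q.2 := by
  have h1 : Continuous fun q : (Eu n × Eu n) × Eu n => M.phase x y q.1.1 :=
    (M.phase_contDiff x y).continuous.comp continuous_fst.fst
  have h2 : Continuous fun q : (Eu n × Eu n) × Eu n => (inner ℝ q.1.2 q.2 : ℝ) :=
    continuous_fst.snd.inner continuous_snd
  have h3 : Continuous fun q : (Eu n × Eu n) × Eu n =>
      (k₁ - k₂) * M.phase x y q.1.1 - inner ℝ q.1.2 q.2 := (continuous_const.mul h1).sub h2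
  have h4 : Continuous fun q : (Eu n × Eu n) × Eu n => θ (q.1.1 + q.1.2) :=
    hθ.comp (continuous_fst.fst.add continuous_fst.snd)
  have h5 : Continuous fun q : (Eu n × Eu n) × Eu n => q.2 - k₂ • M.quot x y q.1 :=
    continuous_snd.sub (((M.continuous_quot x y).comp continuous_fst).const_smul k₂)
  have h6 : Continuous fun q : (Eu n × Eu n) × Eu n => β (q.1.1, q.2 - k₂ • M.quot x y q.1) :=
    hβ.comp (continuous_fst.fst.prodMk h5)
  exact (continuous_cexp_ofReal h3).mul (h4.mul h6)

theorem TravelTimeModel.integrable_shiftedIntegrand {θ : Eu n → ℂ} (hθ : Continuous θ)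
    (hθK : ∀ z ∉ M.K', θ z = 0) {β : Eu n × Eu n → ℂ} (hβ : Continuous β)
    (hβK : ∀ z ∉ K, ∀ η, β (z, η) = 0) {R : ℝ} (hβR : ∀ z η, R < ‖η‖ → β (z, η) = 0)
    (x y : Eu n) (k₁ k₂ : ℝ) :
    Integrable (Function.uncurry (M.shiftedIntegrand θ β x y k₁ k₂))
      ((volume : Measure (Eu n × Eu n)).prod volume) := by
  have hc : Continuous (Function.uncurry (M.shiftedIntegrand θ β x y k₁ k₂)) :=
    M.continuous_shiftedIntegrand hθ hβ x y k₁ k₂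
  obtain ⟨B, hB, hquot⟩ := M.exists_norm_quot_le x y
  refine hc.integrable_of_hasCompactSupport (hasCompactSupport_of_forall_notMem
    (M.isCompact_pairs.prod (isCompact_closedBall (0 : Eu n) (R + |k₂| * B))) ?_)
  rintro ⟨p, ζ⟩ hq
  simp only [Function.uncurry, shiftedIntegrand]
  rw [Set.mem_prod, not_and_or, Set.mem_ofPred_eq, not_and_or] at hq
  rcases hq with (h | h) | h
  · rw [hβK p.1 (fun hk => h (interior_subset (M.subset_interior hk))), mul_zero, mul_zero]
  · rw [hθK _ h, zero_mul, mul_zero]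
  · rw [hβR p.1, mul_zero, mul_zero]
    rw [mem_closedBall_zero_iff, not_le] at h
    have h1 : ‖ζ‖ - ‖k₂ • M.quot x y p‖ ≤ ‖ζ - k₂ • M.quot x y p‖ := norm_sub_norm_le _ _
    rw [norm_smul, Real.norm_eq_abs] at h1
    have h2 := mul_le_mul_of_nonneg_left (hquot p) (abs_nonneg k₂)
    simp only at h ⊢
    linarith

/-- For fixed `(z, w)` the passage from `ξ` to `ζ` is a translation, so no Jacobian appears. The
regularization makes the integrand compactly supported, which justifies integrating over `(z, w)`
first. -/
theorem TravelTimeModel.integral_integrand_eq {θ : Eu n → ℂ} (hθ : Continuous θ)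
    (hθK : ∀ z ∉ M.K', θ z = 0) {β : Eu n × Eu n → ℂ} (hβ : Continuous β)
    (hβK : ∀ z ∉ K, ∀ η, β (z, η) = 0) {R : ℝ} (hβR : ∀ z η, R < ‖η‖ → β (z, η) = 0)
    {x y : Eu n} (hx : x ∈ Q) (hy : y ∈ Q) (k₁ k₂ : ℝ) :
    ∫ p, ∫ ξ, M.integrand θ β x y k₁ k₂ p ξ = ∫ ζ, ∫ p, M.shiftedIntegrand θ β x y k₁ k₂ p ζ := by
  rw [integral_prod_shear,
    ← integral_integral_swap (M.integrable_shiftedIntegrand hθ hθK hβ hβK hβR x y k₁ k₂)]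
  refine integral_congr_ae (.of_forall fun p => ?_)
  simp only
  rw [← integral_sub_right_eq_self _ (k₂ • M.quot x y p)]
  exact integral_congr_ae (.of_forall fun ζ => M.integrand_shift hθK hβK hx hy k₁ k₂ p ζ)

theorem TravelTimeModel.high_frequency {θ : Eu n → ℂ} (hθ : ContDiff ℝ ∞ θ)
    (hθc : HasCompactSupport θ) (hθK : ∀ z ∉ M.K', θ z = 0) {x y : ι → Eu n}
    (hx : ∀ i, x i ∈ Q) (hy : ∀ i, y i ∈ Q) {k₁ k₂ t R : ι → ℝ}
    (hs : ∀ i, 0 ≤ t i * k₂ i) (hs' : ∀ i, t i * k₂ i ≤ 1) (ht : ∀ i, 0 < t i)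
    (ht' : ∀ i, t i ≤ 1) {m : ℕ}
    {b : ι → Eu n × Eu n → ℂ} (hb : WeightedFamily (fun _ p => (1 + ‖p.2‖) ^ m) b)
    (hbK : ∀ i, ∀ z ∉ K, ∀ η, b i (z, η) = 0) (hbR : ∀ i z η, R i < ‖η‖ → b i (z, η) = 0) (N : ℕ) :
    ∃ C : ℝ, 0 ≤ C ∧ ∀ i, (1 + |k₁ i - k₂ i|) ^ N * ‖∫ p, ∫ ξ, M.integrand θ
      (fun p => b i (p.1, t i • p.2)) (x i) (y i) (k₁ i) (k₂ i) p ξ‖ ≤ C := by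
  -- The frequency joins the index, which makes the bound uniform in `ζ`. Of the exponent, `N` pays
  -- for the decay in `k₁ - k₂`, `m` for undoing the normalization of the amplitude, and `n + 1` for
  -- integrability in `ζ`.
  obtain ⟨C, hC, h⟩ := M.high_frequency_pointwise (ι := ι × Eu n) hθ hθc hθK
    (x := fun j => x j.1) (y := fun j => y j.1) (fun j => hx j.1) (fun j => hy j.1)
    (fun j => k₁ j.1 - k₂ j.1) (fun j => j.2) (s := fun j => t j.1 * k₂ j.1) (t := fun j => t j.1)
    (fun j => hs j.1) (fun j => hs' j.1) (fun j => (ht j.1).le) (fun j => ht' j.1)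
    (hb.reindex (fun j : ι × Eu n => j.1)) (fun j => hbK j.1) (N + (m + (n + 1)))
  have hintg : Integrable (fun ζ : Eu n => (1 + ‖ζ‖) ^ (-((n : ℝ) + 1))) :=
    integrable_one_add_norm_rpow (by linarith)
  refine ⟨C * ∫ ζ : Eu n, (1 + ‖ζ‖) ^ (-((n : ℝ) + 1)), by positivity, fun i => ?_⟩
  have hβ : Continuous fun p : Eu n × Eu n => b i (p.1, t i • p.2) :=
    (hb.contDiff i).continuous.comp (continuous_fst.prodMk (continuous_snd.const_smul (t i)))
  rw [M.integral_integrand_eq hθ.continuous hθK hβ (fun z hz η => hbK i z hz _) (R := R i / t i)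
    (fun z η hp => hbR i z _ (by
      rw [div_lt_iff₀ (ht i)] at hp
      simp only [norm_smul, Real.norm_of_nonneg (ht i).le]
      linarith)) (hx i) (hy i)]
  set P : ℝ := (1 + |k₁ i - k₂ i|) ^ N with hP
  have hP0 : 0 < P := by positivity
  have key : ∀ ζ, ‖∫ p, M.shiftedIntegrand θ (fun p => b i (p.1, t i • p.2)) (x i) (y i) (k₁ i)
      (k₂ i) p ζ‖ ≤ P⁻¹ * C * (1 + ‖ζ‖) ^ (-((n : ℝ) + 1)) := by
    intro ζ
    have h1 := h (i, ζ)
    simp only at h1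
    have e : ∀ p : Eu n × Eu n,
        M.shiftedIntegrand θ (fun p => b i (p.1, t i • p.2)) (x i) (y i) (k₁ i) (k₂ i) p ζ =
        ((1 + ‖ζ‖) ^ m : ℝ) • (Complex.exp (Complex.I *
          (((k₁ i - k₂ i) * M.phase (x i) (y i) p.1 - inner ℝ p.2 ζ : ℝ) : ℂ)) *
          (((1 + ‖ζ‖) ^ m)⁻¹ • (θ (p.1 + p.2) *
            b i (p.1, t i • ζ - (t i * k₂ i) • M.quot (x i) (y i) p)))) := by
      intro p
      rw [mul_smul_comm, smul_smul, mul_inv_cancel₀ (by positivity), one_smul]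
      simp only [shiftedIntegrand]
      rw [smul_sub, smul_smul]
    simp only [e]
    rw [integral_smul, norm_smul, Real.norm_of_nonneg (by positivity)]
    set Y := ‖∫ p : Eu n × Eu n, Complex.exp (Complex.I *
          (((k₁ i - k₂ i) * M.phase (x i) (y i) p.1 - inner ℝ p.2 ζ : ℝ) : ℂ)) *
          (((1 + ‖ζ‖) ^ m)⁻¹ • (θ (p.1 + p.2) *
            b i (p.1, t i • ζ - (t i * k₂ i) • M.quot (x i) (y i) p)))‖ with hY
    have hY0 : 0 ≤ Y := norm_nonneg _
    have h2 : P * ((1 + ‖ζ‖) ^ m * (1 + ‖ζ‖) ^ (n + 1)) ≤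
        (1 + (|k₁ i - k₂ i| + ‖ζ‖)) ^ (N + (m + (n + 1))) := by
      rw [hP, pow_add _ N, pow_add _ m (n + 1)]
      have := norm_nonneg ζ
      have := abs_nonneg (k₁ i - k₂ i)
      gcongr <;> linarith
    have h3 : P * ((1 + ‖ζ‖) ^ m * (1 + ‖ζ‖) ^ (n + 1)) * Y ≤ C :=
      (mul_le_mul_of_nonneg_right h2 hY0).trans h1
    have h4 : (1 + ‖ζ‖) ^ (-((n : ℝ) + 1)) = ((1 + ‖ζ‖) ^ (n + 1))⁻¹ := by
      rw [Real.rpow_neg (by positivity)]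
      norm_cast
    rw [h4, inv_mul_eq_div, ← div_eq_mul_inv, div_div, le_div_iff₀ (by positivity)]
    linarith
  have h5 : ‖∫ ζ, ∫ p, M.shiftedIntegrand θ (fun p => b i (p.1, t i • p.2)) (x i) (y i) (k₁ i)
      (k₂ i) p ζ‖ ≤ ∫ ζ : Eu n, P⁻¹ * C * (1 + ‖ζ‖) ^ (-((n : ℝ) + 1)) :=
    norm_integral_le_of_norm_le (hintg.const_mul _) (.of_forall key)
  rw [integral_const_mul] at h5
  calc _ ≤ P * (P⁻¹ * C * ∫ ζ : Eu n, (1 + ‖ζ‖) ^ (-((n : ℝ) + 1))) := by gcongr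
    _ = _ := by field_simp

end HighFrequency

end NearField

namespace NearField

/-! ### Frequencies small compared with `k₂` -/

section LowFrequency

variable {ι : Type*} {n : ℕ} {K Q : Set (Eu n)} (M : TravelTimeModel K Q)

theorem boundedFamily_product_amplitude {θ : Eu n → ℂ} (hθ : ContDiff ℝ ∞ θ)
    (hθc : HasCompactSupport θ) (ξ : ι → Eu n) {m : ℕ} {b : ι → Eu n × Eu n → ℂ}
    (hb : WeightedFamily (fun _ p => (1 + ‖p.2‖) ^ m) b) :
    BoundedFamily fun i (p : Eu n × Eu n) => ((1 + ‖ξ i‖) ^ m)⁻¹ • (θ p.2 * b i (p.1, ξ i)) := by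
  have h0 : BoundedDerivFamily fun i (p : Eu n × Eu n) => (p.1, ξ i) := by
    have := boundedDerivFamily_affine (fun _ : ι =>
        (ContinuousLinearMap.fst ℝ (Eu n) (Eu n)).prod (0 : Eu n × Eu n →L[ℝ] Eu n))
      (fun i => ((0 : Eu n), ξ i)) (C := _) fun _ => le_rfl
    simpa using this
  have h1 := hb.comp (fun _ _ => by positivity) h0
  have h2 : BoundedFamily fun (_ : ι) (p : Eu n × Eu n) => θ p.2 := by
    have := boundedFamily_translate (ι := ι) hθ hθc
      (ContinuousLinearMap.snd ℝ (Eu n) (Eu n)) (fun _ => 0)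
    simpa using this
  have h3 := WeightedFamily.bilin (ContinuousLinearMap.mul ℝ ℂ) (fun _ _ => zero_le_one)
    (fun _ _ => by positivity) h2 h1
  exact WeightedFamily.normalize (w := fun i => (1 + ‖ξ i‖) ^ m) (fun i => by positivity)
    (h3.mono (B := 1) zero_le_one fun i p => le_rfl)

theorem TravelTimeModel.scaledPhase_two_point (x y ξ : ι → Eu n) {k₁ k₂ : ι → ℝ}
    (hk₁ : ∀ i, 0 ≤ k₁ i) (hk₂ : ∀ i, 0 ≤ k₂ i) {δ : ℝ} (hδ : 0 ≤ δ)
    (hξ : ∀ i, ‖ξ i‖ ≤ δ * k₂ i) :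
    ScaledPhase (fun i => k₁ i + k₂ i) fun i (p : Eu n × Eu n) =>
      k₁ i * M.phase (x i) (y i) (ContinuousLinearMap.fst ℝ (Eu n) (Eu n) p) +
      -k₂ i * M.phase (x i) (y i) (ContinuousLinearMap.snd ℝ (Eu n) (Eu n) p) +
        inner ℝ (ξ i) ((ContinuousLinearMap.fst ℝ (Eu n) (Eu n) -
          ContinuousLinearMap.snd ℝ (Eu n) (Eu n)) p) := by
  have h1 : ∀ i, |k₁ i| ≤ k₁ i + k₂ i := fun i => by
    rw [abs_of_nonneg (hk₁ i)]
    exact le_add_of_nonneg_right (hk₂ i)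
  have h2 : ∀ i, |-k₂ i| ≤ k₁ i + k₂ i := fun i => by
    rw [abs_neg, abs_of_nonneg (hk₂ i)]
    exact le_add_of_nonneg_left (hk₁ i)
  have h3 : ∀ i, ‖ξ i‖ ≤ δ * (k₁ i + k₂ i) := fun i => by
    refine (hξ i).trans ?_
    gcongr
    exact le_add_of_nonneg_left (hk₁ i)
  exact ((ScaledPhase.of_boundedFamily h1 (M.boundedFamily_phase _ x y)).add
    (ScaledPhase.of_boundedFamily h2 (M.boundedFamily_phase _ x y))).add
    (ScaledPhase.inner _ hδ h3 fun i => add_nonneg (hk₁ i) (hk₂ i))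

theorem TravelTimeModel.fderiv_two_point_phase (x y ξ : Eu n) (k₁ k₂ : ℝ) (p h : Eu n × Eu n) :
    fderiv ℝ (fun p : Eu n × Eu n =>
      k₁ * M.phase x y (ContinuousLinearMap.fst ℝ (Eu n) (Eu n) p) +
      -k₂ * M.phase x y (ContinuousLinearMap.snd ℝ (Eu n) (Eu n) p) +
        inner ℝ ξ ((ContinuousLinearMap.fst ℝ (Eu n) (Eu n) -
          ContinuousLinearMap.snd ℝ (Eu n) (Eu n)) p)) p h =
      k₁ * inner ℝ (M.grad x y p.1) h.1 - k₂ * inner ℝ (M.grad x y p.2) h.2 +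
        inner ℝ ξ (h.1 - h.2) := by
  have hd : ∀ L : Eu n × Eu n →L[ℝ] Eu n,
      DifferentiableAt ℝ (fun p : Eu n × Eu n => M.phase x y (L p)) p := fun L =>
    ((M.phase_contDiff x y).comp L.contDiff).differentiable (by simp) p
  have hd3 : DifferentiableAt ℝ (fun p : Eu n × Eu n => (inner ℝ ξ
      ((ContinuousLinearMap.fst ℝ (Eu n) (Eu n) - ContinuousLinearMap.snd ℝ (Eu n) (Eu n)) p) : ℝ))
      p :=
    ((innerSL ℝ ξ).comp (ContinuousLinearMap.fst ℝ (Eu n) (Eu n) -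
      ContinuousLinearMap.snd ℝ (Eu n) (Eu n))).differentiableAt
  rw [fderiv_fun_add (((hd _).const_mul k₁).fun_add ((hd _).const_mul (-k₂))) hd3,
    fderiv_fun_add ((hd _).const_mul k₁) ((hd _).const_mul (-k₂)), fderiv_const_mul (hd _),
    fderiv_const_mul (hd _), add_apply, add_apply, smul_apply, smul_apply,
    M.fderiv_phase, M.fderiv_phase, fderiv_inner_clm, sub_eq_add_neg (k₁ * _), ← neg_mul]
  rfl

/-- The field moves only the point belonging to the larger wave number. This gains `a max(k₁, k₂)`,
of which `ξ` can destroy at most `(a / 2) k₂`; the remaining `(a / 2) max(k₁, k₂)` is at least `(a /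
4)(k₁ + k₂)`. No cancellation between `k₁` and `k₂` occurs. -/
theorem TravelTimeModel.two_point_phase_lower_bound {x y : Eu n} (hx : x ∈ Q) (hy : y ∈ Q)
    {δ : ℝ} (hδ : ∀ x y z, δ * ‖M.grad x y z‖ ≤ M.a / 2) {ξ : Eu n} {k₁ k₂ : ℝ} (hk₁ : 0 ≤ k₁)
    (hk₂ : 0 ≤ k₂) (hξ : ‖ξ‖ ≤ δ * k₂) {z₁ z₂ : Eu n} (hz₁ : z₁ ∈ M.K') (hz₂ : z₂ ∈ M.K') :
    M.a / 4 * (k₁ + k₂) ≤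
      k₁ * inner ℝ (M.grad x y z₁) ((if k₂ ≤ k₁ then (1 : ℝ) else 0) • M.grad x y z₁) -
        k₂ * inner ℝ (M.grad x y z₂) ((if k₂ ≤ k₁ then (0 : ℝ) else -1) • M.grad x y z₂) +
      inner ℝ ξ ((if k₂ ≤ k₁ then (1 : ℝ) else 0) • M.grad x y z₁ -
        (if k₂ ≤ k₁ then (0 : ℝ) else -1) • M.grad x y z₂) := by
  have ha := M.a_pos
  have key : ∀ z, -(M.a / 2 * k₂) ≤ inner ℝ ξ (M.grad x y z) := fun z => by
    have h1 : |inner ℝ ξ (M.grad x y z)| ≤ ‖ξ‖ * ‖M.grad x y z‖ := abs_real_inner_le_norm _ _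
    have h2 : ‖ξ‖ * ‖M.grad x y z‖ ≤ M.a / 2 * k₂ :=
      calc _ ≤ δ * k₂ * ‖M.grad x y z‖ := by gcongr
        _ = δ * ‖M.grad x y z‖ * k₂ := by ring
        _ ≤ _ := by gcongr; exact hδ x y z
    linarith [neg_abs_le (inner ℝ ξ (M.grad x y z))]
  split_ifs with h
  · simp only [one_smul, zero_smul, inner_zero_right, mul_zero, sub_zero]
    rw [real_inner_self_eq_norm_sq]
    have h1 := mul_le_mul_of_nonneg_left (M.le_norm_sq x hx y hy z₁ hz₁) hk₁
    have h2 : k₁ * ‖M.grad x y z₁‖ ^ 2 ≥ k₁ * M.a := h1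
    nlinarith [key z₁]
  · simp only [neg_smul, one_smul, zero_smul, inner_zero_right, mul_zero, inner_neg_right, zero_sub,
      neg_neg, mul_neg]
    rw [real_inner_self_eq_norm_sq]
    have h1 := mul_le_mul_of_nonneg_left (M.le_norm_sq x hx y hy z₂ hz₂) hk₂
    have h2 : k₂ * ‖M.grad x y z₂‖ ^ 2 ≥ k₂ * M.a := h1
    nlinarith [key z₂]

theorem TravelTimeModel.boundedFamily_two_point_direction (x y : ι → Eu n) (k₁ k₂ : ι → ℝ) :
    BoundedFamily fun i (p : Eu n × Eu n) =>
      ((if k₂ i ≤ k₁ i then (1 : ℝ) else 0) •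
        M.grad (x i) (y i) (ContinuousLinearMap.fst ℝ (Eu n) (Eu n) p),
      (if k₂ i ≤ k₁ i then (0 : ℝ) else -1) •
        M.grad (x i) (y i) (ContinuousLinearMap.snd ℝ (Eu n) (Eu n) p)) := by
  refine BoundedFamily.prodMk (BoundedFamily.smul (boundedFamily_const _ (C := 1) fun i => ?_)
    (M.boundedFamily_grad _ x y)) (BoundedFamily.smul (boundedFamily_const _ (C := 1) fun i => ?_)
    (M.boundedFamily_grad _ x y))
  · split_ifs <;> simp
  · split_ifs <;> simp

theorem TravelTimeModel.low_frequency_pointwise {θ : Eu n → ℂ} (hθ : ContDiff ℝ ∞ θ)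
    (hθc : HasCompactSupport θ) (hθK : ∀ z ∉ M.K', θ z = 0) {x y : ι → Eu n}
    (hx : ∀ i, x i ∈ Q) (hy : ∀ i, y i ∈ Q) {k₁ k₂ : ι → ℝ} (hk₁ : ∀ i, 0 ≤ k₁ i)
    (hk₂ : ∀ i, 0 ≤ k₂ i) {δ : ℝ} (hδ0 : 0 ≤ δ) (hδ : ∀ x y z, δ * ‖M.grad x y z‖ ≤ M.a / 2)
    {ξ : ι → Eu n} (hξ : ∀ i, ‖ξ i‖ ≤ δ * k₂ i) {m : ℕ} {b : ι → Eu n × Eu n → ℂ}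
    (hb : WeightedFamily (fun _ p => (1 + ‖p.2‖) ^ m) b)
    (hbK : ∀ i, ∀ z ∉ K, ∀ η, b i (z, η) = 0) (N : ℕ) : ∃ C : ℝ, 0 ≤ C ∧ ∀ i,
      (1 + (k₁ i + k₂ i)) ^ N * ‖∫ p : Eu n × Eu n,
        Complex.exp (Complex.I * ((k₁ i * M.phase (x i) (y i) p.1 - k₂ i * M.phase (x i) (y i) p.2 +
          inner ℝ (p.1 - p.2) (ξ i) : ℝ) : ℂ)) *
          (((1 + ‖ξ i‖) ^ m)⁻¹ • (θ p.2 * b i (p.1, ξ i)))‖ ≤ C := by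
  have hA := boundedFamily_product_amplitude hθ hθc ξ hb
  have hΨ := M.scaledPhase_two_point x y ξ hk₁ hk₂ hδ0 hξ
  have hX := M.boundedFamily_two_point_direction x y k₁ k₂
  have key := nonstationary_phase_one_add (M.isCompact.prod M.isCompact) (a := M.a / 4)
    (by linarith [M.a_pos]) (fun i => add_nonneg (hk₁ i) (hk₂ i)) hΨ.contDiff hΨ.bounded hX
    (fun i p hp => ?_) N hA (fun i p hp => ?_)
  · obtain ⟨C, hC, h⟩ := key
    refine ⟨C, hC, fun i => ?_⟩
    have := h i
    have e : ∀ p : Eu n × Eu n, k₁ i * M.phase (x i) (y i) p.1 -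
        k₂ i * M.phase (x i) (y i) p.2 + inner ℝ (p.1 - p.2) (ξ i) =
      k₁ i * M.phase (x i) (y i) (ContinuousLinearMap.fst ℝ (Eu n) (Eu n) p) +
      -k₂ i * M.phase (x i) (y i) (ContinuousLinearMap.snd ℝ (Eu n) (Eu n) p) +
        inner ℝ (ξ i) ((ContinuousLinearMap.fst ℝ (Eu n) (Eu n) -
          ContinuousLinearMap.snd ℝ (Eu n) (Eu n)) p) := fun p => by
      rw [real_inner_comm, sub_eq_add_neg (k₁ i * _), ← neg_mul]
      rfl
    simp only [e]
    exact this
  · rw [Set.mem_prod] at hp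
    rw [M.fderiv_two_point_phase]
    exact M.two_point_phase_lower_bound (hx i) (hy i) hδ (hk₁ i) (hk₂ i) (hξ i) hp.1 hp.2
  · rw [Set.mem_prod, not_and_or] at hp
    rcases hp with hp | hp
    · rw [hbK i p.1 (fun hk => hp (interior_subset (M.subset_interior hk))), mul_zero, smul_zero]
    · rw [hθK _ hp, zero_mul, smul_zero]

theorem TravelTimeModel.continuous_integrand {θ : Eu n → ℂ} (hθ : Continuous θ)
    {β : Eu n × Eu n → ℂ} (hβ : Continuous β) (x y : Eu n) (k₁ k₂ : ℝ) :
    Continuous fun q : (Eu n × Eu n) × Eu n => M.integrand θ β x y k₁ k₂ q.1 q.2 := by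
  have hφ := (M.phase_contDiff x y).continuous
  have h1 : Continuous fun q : (Eu n × Eu n) × Eu n => M.phase x y q.1.1 :=
    hφ.comp continuous_fst.fst
  have h1' : Continuous fun q : (Eu n × Eu n) × Eu n => M.phase x y q.1.2 :=
    hφ.comp continuous_fst.snd
  have h2 : Continuous fun q : (Eu n × Eu n) × Eu n => (inner ℝ (q.1.1 - q.1.2) q.2 : ℝ) :=
    (continuous_fst.fst.sub continuous_fst.snd).inner continuous_snd
  have h3 : Continuous fun q : (Eu n × Eu n) × Eu n => k₁ * M.phase x y q.1.1 -
      k₂ * M.phase x y q.1.2 + inner ℝ (q.1.1 - q.1.2) q.2 :=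
    ((continuous_const.mul h1).sub (continuous_const.mul h1')).add h2
  have h4 : Continuous fun q : (Eu n × Eu n) × Eu n => θ q.1.2 := hθ.comp continuous_fst.snd
  have h6 : Continuous fun q : (Eu n × Eu n) × Eu n => β (q.1.1, q.2) :=
    hβ.comp (continuous_fst.fst.prodMk continuous_snd)
  exact (continuous_cexp_ofReal h3).mul (h4.mul h6)

theorem TravelTimeModel.integrable_integrand {θ : Eu n → ℂ} (hθ : Continuous θ)
    (hθK : ∀ z ∉ M.K', θ z = 0) {β : Eu n × Eu n → ℂ} (hβ : Continuous β)
    (hβK : ∀ z ∉ K, ∀ η, β (z, η) = 0) {R : ℝ} (hβR : ∀ z η, R < ‖η‖ → β (z, η) = 0)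
    (x y : Eu n) (k₁ k₂ : ℝ) :
    Integrable (Function.uncurry (M.integrand θ β x y k₁ k₂))
      ((volume : Measure (Eu n × Eu n)).prod volume) := by
  have hc : Continuous (Function.uncurry (M.integrand θ β x y k₁ k₂)) :=
    M.continuous_integrand hθ hβ x y k₁ k₂
  refine hc.integrable_of_hasCompactSupport (hasCompactSupport_of_forall_notMem
    ((M.isCompact.prod M.isCompact).prod (isCompact_closedBall (0 : Eu n) R)) ?_)
  rintro ⟨p, ξ⟩ hq
  simp only [Function.uncurry, integrand]
  rw [Set.mem_prod, not_and_or, Set.mem_prod, not_and_or] at hq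
  rcases hq with (h | h) | h
  · rw [hβK p.1 (fun hk => h (interior_subset (M.subset_interior hk))), mul_zero, mul_zero]
  · rw [hθK _ h, zero_mul, mul_zero]
  · rw [mem_closedBall_zero_iff, not_le] at h
    rw [hβR p.1 _ h, mul_zero, mul_zero]

theorem TravelTimeModel.low_frequency {θ : Eu n → ℂ} (hθ : ContDiff ℝ ∞ θ)
    (hθc : HasCompactSupport θ) (hθK : ∀ z ∉ M.K', θ z = 0) {x y : ι → Eu n}
    (hx : ∀ i, x i ∈ Q) (hy : ∀ i, y i ∈ Q) {k₁ k₂ : ι → ℝ} (hk₁ : ∀ i, 0 ≤ k₁ i)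
    (hk₂ : ∀ i, 0 ≤ k₂ i) {δ : ℝ} (hδ0 : 0 ≤ δ) (hδ : ∀ x y z, δ * ‖M.grad x y z‖ ≤ M.a / 2)
    {m : ℕ} {b : ι → Eu n × Eu n → ℂ} (hb : WeightedFamily (fun _ p => (1 + ‖p.2‖) ^ m) b)
    (hbK : ∀ i, ∀ z ∉ K, ∀ η, b i (z, η) = 0)
    (hbR : ∀ i z η, δ * k₂ i < ‖η‖ → b i (z, η) = 0) (N : ℕ) :
    ∃ C : ℝ, 0 ≤ C ∧ ∀ i, (1 + (k₁ i + k₂ i)) ^ N * ‖∫ p, ∫ ξ, M.integrand θ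
      (b i) (x i) (y i) (k₁ i) (k₂ i) p ξ‖ ≤ C := by
  -- Only frequencies `|ξ| ≤ δ k₂` enter the index, since `b` vanishes beyond. The additional `m +
  -- (n + 1)` powers of `1 + k₁ + k₂` dominate the same powers of `1 + |ξ|` there.
  obtain ⟨C, hC, h⟩ := M.low_frequency_pointwise (ι := {j : ι × Eu n // ‖j.2‖ ≤ δ * k₂ j.1})
    hθ hθc hθK (x := fun j => x j.1.1) (y := fun j => y j.1.1) (fun j => hx j.1.1)
    (fun j => hy j.1.1) (k₁ := fun j => k₁ j.1.1) (k₂ := fun j => k₂ j.1.1) (fun j => hk₁ j.1.1)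
    (fun j => hk₂ j.1.1) hδ0 hδ (ξ := fun j => j.1.2) (fun j => j.2)
    (hb.reindex (fun j : {j : ι × Eu n // ‖j.2‖ ≤ δ * k₂ j.1} => j.1.1)) (fun j => hbK j.1.1)
    (N + (m + (n + 1)))
  have hintg : Integrable (fun ζ : Eu n => (1 + ‖ζ‖) ^ (-((n : ℝ) + 1))) :=
    integrable_one_add_norm_rpow (by linarith)
  refine ⟨C * (1 + δ) ^ (m + (n + 1)) * ∫ ζ : Eu n, (1 + ‖ζ‖) ^ (-((n : ℝ) + 1)), by positivity,
    fun i => ?_⟩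
  rw [integral_integral_swap (M.integrable_integrand hθ.continuous hθK (hb.contDiff i).continuous
    (hbK i) (hbR i) (x i) (y i) (k₁ i) (k₂ i))]
  have hk : 0 ≤ k₁ i + k₂ i := add_nonneg (hk₁ i) (hk₂ i)
  set P : ℝ := (1 + (k₁ i + k₂ i)) ^ N with hP
  have hP0 : 0 < P := by positivity
  have key : ∀ ξ, ‖∫ p, M.integrand θ (b i) (x i) (y i) (k₁ i) (k₂ i) p ξ‖ ≤
      P⁻¹ * (C * (1 + δ) ^ (m + (n + 1))) * (1 + ‖ξ‖) ^ (-((n : ℝ) + 1)) := by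
    intro ξ
    by_cases hξ : ‖ξ‖ ≤ δ * k₂ i
    swap
    · have e : ∀ p, M.integrand θ (b i) (x i) (y i) (k₁ i) (k₂ i) p ξ = 0 := fun p => by
        simp only [integrand]
        rw [hbR i _ _ (not_le.1 hξ), mul_zero, mul_zero]
      simp only [e, integral_zero, norm_zero]
      positivity
    have h1 := h ⟨(i, ξ), hξ⟩
    simp only at h1
    have e : ∀ p : Eu n × Eu n,
        M.integrand θ (b i) (x i) (y i) (k₁ i) (k₂ i) p ξ =
        ((1 + ‖ξ‖) ^ m : ℝ) • (Complex.exp (Complex.I * ((k₁ i * M.phase (x i) (y i) p.1 -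
          k₂ i * M.phase (x i) (y i) p.2 + inner ℝ (p.1 - p.2) ξ : ℝ) : ℂ)) *
          (((1 + ‖ξ‖) ^ m)⁻¹ • (θ p.2 * b i (p.1, ξ)))) := by
      intro p
      rw [mul_smul_comm, smul_smul, mul_inv_cancel₀ (by positivity), one_smul]
      rfl
    simp only [e]
    rw [integral_smul, norm_smul, Real.norm_of_nonneg (by positivity)]
    set Y := ‖∫ p : Eu n × Eu n, Complex.exp (Complex.I * ((k₁ i * M.phase (x i) (y i) p.1 -
          k₂ i * M.phase (x i) (y i) p.2 + inner ℝ (p.1 - p.2) ξ : ℝ) : ℂ)) *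
          (((1 + ‖ξ‖) ^ m)⁻¹ • (θ p.2 * b i (p.1, ξ)))‖ with hY
    have hY0 : 0 ≤ Y := norm_nonneg _
    have h0 : 1 + ‖ξ‖ ≤ (1 + δ) * (1 + (k₁ i + k₂ i)) := by
      nlinarith [hk₁ i, hk₂ i, mul_nonneg hδ0 (hk₁ i)]
    have h2 : P * ((1 + ‖ξ‖) ^ m * (1 + ‖ξ‖) ^ (n + 1)) ≤
        (1 + δ) ^ (m + (n + 1)) * (1 + (k₁ i + k₂ i)) ^ (N + (m + (n + 1))) := by
      rw [← pow_add, pow_add _ N, mul_left_comm, ← mul_pow]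
      gcongr
    have h3 : P * ((1 + ‖ξ‖) ^ m * (1 + ‖ξ‖) ^ (n + 1)) * Y ≤ C * (1 + δ) ^ (m + (n + 1)) := by
      refine (mul_le_mul_of_nonneg_right h2 hY0).trans ?_
      rw [mul_assoc, mul_comm C]
      exact mul_le_mul_of_nonneg_left h1 (by positivity)
    have h4 : (1 + ‖ξ‖) ^ (-((n : ℝ) + 1)) = ((1 + ‖ξ‖) ^ (n + 1))⁻¹ := by
      rw [Real.rpow_neg (by positivity)]
      norm_cast
    rw [h4, inv_mul_eq_div, ← div_eq_mul_inv, div_div, le_div_iff₀ (by positivity)]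
    linarith
  have h5 : ‖∫ ξ, ∫ p, M.integrand θ (b i) (x i) (y i) (k₁ i) (k₂ i) p ξ‖ ≤
      ∫ ξ : Eu n, P⁻¹ * (C * (1 + δ) ^ (m + (n + 1))) * (1 + ‖ξ‖) ^ (-((n : ℝ) + 1)) :=
    norm_integral_le_of_norm_le (hintg.const_mul _) (.of_forall key)
  rw [integral_const_mul] at h5
  calc _ ≤ P * (P⁻¹ * (C * (1 + δ) ^ (m + (n + 1))) *
        ∫ ζ : Eu n, (1 + ‖ζ‖) ^ (-((n : ℝ) + 1))) := by gcongr
    _ = _ := by field_simp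

end LowFrequency

end NearField

namespace NearField

/-! ### Symbols as weighted families -/

section SymbolFamilies

variable {ι : Type*} {n : ℕ} {r : ℝ} {c : Eu n → Eu n → ℂ}

theorem IsSymbol.weightedFamily (hc : IsSymbol r c) {m : ℕ} (hm : r ≤ m) :
    WeightedFamily (fun (_ : ι) (p : Eu n × Eu n) => (1 + ‖p.2‖) ^ m) (fun _ p => c p.1 p.2) := by
  refine ⟨fun _ => hc.contDiff, fun j => ?_⟩
  obtain ⟨C, hC, h⟩ := exists_norm_iteratedFDeriv_symbol_le hc one_pos le_rfl j
  refine ⟨C, hC, fun _ p => ?_⟩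
  have h1 := h 1 one_pos p (by linarith [norm_nonneg p.2])
  simp only [one_smul, one_mul] at h1
  refine h1.trans (mul_le_mul_of_nonneg_left ?_ hC)
  rw [← Real.rpow_natCast]
  exact Real.rpow_le_rpow_of_exponent_le (by linarith [norm_nonneg p.2]) hm

/-- Dilates of a cut-off form a bounded family. -/
theorem boundedFamily_dilate {χ : Eu n → ℝ} (hχ : ContDiff ℝ ∞ χ) (hχc : HasCompactSupport χ)
    {ε : ι → ℝ} (hε : ∀ i, 0 ≤ ε i) (hε' : ∀ i, ε i ≤ 1) :
    BoundedFamily fun i (p : Eu n × Eu n) => ((χ (ε i • p.2) : ℝ) : ℂ) := by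
  have h1 := boundedDerivFamily_affine (fun i => ε i • ContinuousLinearMap.snd ℝ (Eu n) (Eu n))
    (fun _ => 0) (C := ‖ContinuousLinearMap.snd ℝ (Eu n) (Eu n)‖) fun i => by
      rw [norm_smul, Real.norm_of_nonneg (hε i)]
      exact mul_le_of_le_one_left (norm_nonneg _) (hε' i)
  have h2 := ((boundedFamily_of_hasCompactSupport (ι := ι) hχ hχc).comp h1).clm Complex.ofRealCLM
  simpa using h2

theorem WeightedFamily.bounded_mul {V : Type*} [NormedAddCommGroup V] [NormedSpace ℝ V]
    {W : ι → V → ℝ} {F F' : ι → V → ℂ} (h' : WeightedFamily W F') (hW : ∀ i v, 0 ≤ W i v)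
    (h : BoundedFamily F) : WeightedFamily W (fun i v => F i v * F' i v) :=
  (WeightedFamily.bilin (ContinuousLinearMap.mul ℝ ℂ) (fun _ _ => zero_le_one) hW h h').mono
    zero_le_one fun _ _ => le_rfl

/-- The left side is `((1 + ks)/k)^r` with base between `c₀` and `1 + s`. The upper end serves `r ≥
0`, the lower end `r ≤ 0`. -/
theorem rpow_neg_mul_one_add_rpow_le {c₀ : ℝ} (hc₀ : 0 < c₀) {m : ℕ} (hm : r ≤ m) {k s : ℝ}
    (hk : 1 ≤ k) (hs : c₀ ≤ s) : k ^ (-r) * (1 + k * s) ^ r ≤ (1 + c₀ ^ r) * (1 + s) ^ m := by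
  have hk0 : 0 < k := by linarith
  have hs0 : 0 < s := by linarith
  have h1 : k ^ (-r) * (1 + k * s) ^ r = ((1 + k * s) / k) ^ r := by
    rw [Real.div_rpow (by positivity) hk0.le, Real.rpow_neg hk0.le]
    field_simp
  have h2 : c₀ ≤ (1 + k * s) / k := by
    rw [le_div_iff₀ hk0]
    nlinarith
  have h3 : (1 + k * s) / k ≤ 1 + s := by
    rw [div_le_iff₀ hk0]
    nlinarith
  have h4 : (1 : ℝ) ≤ (1 + s) ^ m := one_le_pow₀ (by linarith)
  have h5 : 0 < c₀ ^ r := Real.rpow_pos_of_pos hc₀ r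
  rw [h1]
  rcases le_total 0 r with hr | hr
  · calc _ ≤ (1 + s) ^ r := Real.rpow_le_rpow (by positivity) h3 hr
      _ ≤ (1 + s) ^ (m : ℝ) := Real.rpow_le_rpow_of_exponent_le (by linarith) hm
      _ = (1 + s) ^ m := Real.rpow_natCast _ _
      _ ≤ _ := by nlinarith
  · calc _ ≤ c₀ ^ r := Real.rpow_le_rpow_of_nonpos hc₀ h2 hr
      _ ≤ _ := by nlinarith

/-- Away from the zero frequency, the rescaled symbols `k^{-r} c(z, k η)` with `k ≥ 1` form a
bounded family. -/
theorem IsSymbol.weightedFamily_rescaled (hc : IsSymbol r c) {m : ℕ} (hm : r ≤ m) {c₀ : ℝ}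
    (hc₀ : 0 < c₀) (hc₁ : c₀ ≤ 1) {ρ : Eu n → ℝ} (hρ : ContDiff ℝ ∞ ρ)
    (hρc : HasCompactSupport ρ) (hρ1 : ∀ η, ‖η‖ ≤ c₀ → ρ η = 1) {k : ι → ℝ} (hk : ∀ i, 1 ≤ k i) :
    WeightedFamily (fun (_ : ι) (p : Eu n × Eu n) => (1 + ‖p.2‖) ^ m)
      (fun i p => ((k i) ^ (-r)) • c p.1 (k i • p.2) * ((1 - ρ p.2 : ℝ) : ℂ)) := by
  have hF' : BoundedFamily fun (_ : ι) (p : Eu n × Eu n) => ((1 - ρ p.2 : ℝ) : ℂ) := by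
    have h1 := (boundedFamily_dilate hρ hρc (ε := fun _ : ι => 1) (fun _ => zero_le_one)
      (fun _ => le_rfl)).clm (-ContinuousLinearMap.id ℝ ℂ)
    have h2 := (boundedFamily_const (V := Eu n × Eu n) (fun _ : ι => (1 : ℂ)) (C := 1)
      fun _ => by simp).add h1
    simpa [sub_eq_add_neg] using h2
  have hsupp : ∀ i : ι, ∀ p ∈ tsupport (fun p : Eu n × Eu n => ((1 - ρ p.2 : ℝ) : ℂ)),
      c₀ ≤ ‖p.2‖ := by
    intro i p hp
    have hcl : IsClosed {p : Eu n × Eu n | c₀ ≤ ‖p.2‖} :=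
      isClosed_le continuous_const continuous_snd.norm
    have hsub : tsupport (fun p : Eu n × Eu n => ((1 - ρ p.2 : ℝ) : ℂ)) ⊆
        {p : Eu n × Eu n | c₀ ≤ ‖p.2‖} := by
      refine closure_minimal (fun q hq => ?_) hcl
      by_contra hlt
      rw [Set.mem_ofPred_eq, not_le] at hlt
      rw [Function.mem_support] at hq
      exact hq (by rw [hρ1 _ hlt.le, sub_self, Complex.ofReal_zero])
    exact hsub hp
  have hsm : ∀ i, ContDiff ℝ ∞ fun p : Eu n × Eu n => c p.1 (k i • p.2) := fun i =>
    hc.contDiff.comp (contDiff_fst.prodMk (contDiff_snd.const_smul (k i)))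
  -- Near `η = 0` the derivatives of `c(z, k η)` are not controlled uniformly in `k`; on the support
  -- of `1 - ρ`, where `|η| ≥ c₀`, they are.
  have key := WeightedFamily.bilin_of_tsupport (ContinuousLinearMap.mul ℝ ℂ)
    (W := fun (_ : ι) (p : Eu n × Eu n) => (1 + ‖p.2‖) ^ m) (W' := fun _ _ => 1)
    (F := fun i (p : Eu n × Eu n) => ((k i) ^ (-r)) • c p.1 (k i • p.2))
    (fun _ _ => by positivity) (fun _ _ => zero_le_one) (fun i => (hsm i).const_smul _)
    (fun j => ?_) hF'
  · exact key.mono zero_le_one fun i p => by rw [one_mul, mul_one]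
  · obtain ⟨C, hC, h⟩ := exists_norm_iteratedFDeriv_symbol_le hc hc₀ hc₁ j
    refine ⟨C * (1 + c₀ ^ r), by positivity, fun i p hp => ?_⟩
    have hp' := hsupp i p hp
    have hki : 0 < k i := by linarith [hk i]
    rw [iteratedFDeriv_fun_const_smul (hsm i), norm_smul, Real.norm_of_nonneg (by positivity)]
    calc _ ≤ (k i) ^ (-r) * (C * (1 + k i * ‖p.2‖) ^ r) := by
          gcongr
          exact h (k i) hki p (by nlinarith)
      _ = C * ((k i) ^ (-r) * (1 + k i * ‖p.2‖) ^ r) := by ring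
      _ ≤ C * ((1 + c₀ ^ r) * (1 + ‖p.2‖) ^ m) :=
          mul_le_mul_of_nonneg_left (rpow_neg_mul_one_add_rpow_le hc₀ hm (hk i) hp') hC
      _ = _ := by ring

end SymbolFamilies

end NearField

namespace NearField

/-! ### Bounds for the regularized integrals, uniform in `ε` -/

section UniformBound

variable {n : ℕ} {K Q : Set (Eu n)} {r : ℝ} {c : Eu n → Eu n → ℂ} {χ : Eu n → ℝ}

/-- Sources, receivers, wave numbers, and admissible regularization parameters. -/
structure WaveParam {n : ℕ} (Q : Set (Eu n)) where
  x : Eu n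
  y : Eu n
  k₁ : ℝ
  k₂ : ℝ
  ε : ℝ
  x_mem : x ∈ Q
  y_mem : y ∈ Q
  k₁_pos : 0 < k₁
  k₂_pos : 0 < k₂
  ε_pos : 0 < ε
  ε_le : ε ≤ 1
  ε_mul_le : ε * k₂ ≤ 1

variable (M : TravelTimeModel K Q)

/-- This threshold separates low from high frequencies: for `|ξ| ≤ δ k₂` the linear phase takes away
at most half of the travel time gradient bound. -/
theorem TravelTimeModel.exists_delta : ∃ δ : ℝ, 0 < δ ∧ ∀ x y z, δ * ‖M.grad x y z‖ ≤ M.a / 2 := by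
  obtain ⟨B, hB, h⟩ := (M.boundedFamily_grad (ContinuousLinearMap.id ℝ (Eu n))
    (fun j : Eu n × Eu n => j.1) (fun j => j.2)).norm_le
  have ha := M.a_pos
  refine ⟨M.a / (2 * (B + 1)), by positivity, fun x y z => ?_⟩
  have h1 : ‖M.grad x y z‖ ≤ B := h (x, y) z
  rw [div_mul_eq_mul_div, div_le_div_iff₀ (by positivity) two_pos]
  nlinarith [norm_nonneg (M.grad x y z)]

theorem regSymbol_eq_zero_of_lt {R : ℝ} (hR : ∀ ξ, ξ ∈ tsupport χ → ‖ξ‖ ≤ R) {ε : ℝ} (hε : 0 < ε)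
    (z : Eu n) {ξ : Eu n} (hξ : R / ε < ‖ξ‖) : regSymbol c χ ε z ξ = 0 :=
  regSymbol_eq_zero hR hε z (by rwa [mem_closedBall_zero_iff, not_le])

theorem weightedFamily_regSymbol {ι : Type*} (hc : IsSymbol r c) (hχ : IsCutoff χ) {m : ℕ}
    (hm : r ≤ m) {ε : ι → ℝ} (hε : ∀ i, 0 ≤ ε i) (hε' : ∀ i, ε i ≤ 1) :
    WeightedFamily (fun (_ : ι) (p : Eu n × Eu n) => (1 + ‖p.2‖) ^ m)
      (fun i p => regSymbol c χ (ε i) p.1 p.2) :=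
  (hc.weightedFamily hm).bounded_mul (fun _ _ => by positivity)
    (boundedFamily_dilate hχ.contDiff hχ.hasCompactSupport hε hε')

theorem regSymbol_zero_of_notMem (hcK : ∀ z ∉ K, ∀ ξ, c z ξ = 0) {z : Eu n} (hz : z ∉ K) (ε : ℝ)
    (ξ : Eu n) : regSymbol c χ ε z ξ = 0 := by
  rw [regSymbol, hcK z hz, mul_zero]

/-- The regularized integrals at wave numbers `k₂ ≤ 1`. -/
theorem TravelTimeModel.bound_of_le_one (hc : IsSymbol r c) (hχ : IsCutoff χ)
    (hcK : ∀ z ∉ K, ∀ ξ, c z ξ = 0) {θ : Eu n → ℂ} (hθ : ContDiff ℝ ∞ θ)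
    (hθc : HasCompactSupport θ) (hθK : ∀ z ∉ M.K', θ z = 0) (N : ℕ) :
    ∃ C : ℝ, 0 ≤ C ∧ ∀ P : WaveParam Q, P.k₂ ≤ 1 → (1 + |P.k₁ - P.k₂|) ^ N * ‖∫ p, ∫ ξ,
      M.integrand θ (fun p => regSymbol c χ P.ε p.1 p.2) P.x P.y P.k₁ P.k₂ p ξ‖ ≤ C := by
  obtain ⟨m, hm⟩ := exists_nat_ge r
  obtain ⟨R, hR, hRχ⟩ := hχ.exists_radius
  -- No rescaling (`t = 1`) and no splitting of frequencies: the shift `k₂ Φ` is bounded for `k₂ ≤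
  -- 1`.
  obtain ⟨C, hC, h⟩ := M.high_frequency (ι := {P : WaveParam Q // P.k₂ ≤ 1}) hθ hθc hθK
    (x := fun P => P.1.x) (y := fun P => P.1.y) (fun P => P.1.x_mem) (fun P => P.1.y_mem)
    (k₁ := fun P => P.1.k₁) (k₂ := fun P => P.1.k₂) (t := fun _ => 1) (R := fun P => R / P.1.ε)
    (fun P => by simpa using P.1.k₂_pos.le) (fun P => by simpa using P.2) (fun _ => one_pos)
    (fun _ => le_rfl) (weightedFamily_regSymbol hc hχ hm (fun P => P.1.ε_pos.le)
      (fun P => P.1.ε_le)) (fun P z hz η => regSymbol_zero_of_notMem hcK hz _ _)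
    (fun P z η hη => regSymbol_eq_zero_of_lt hRχ P.1.ε_pos z hη) N
  refine ⟨C, hC, fun P hP => ?_⟩
  have h1 := h ⟨P, hP⟩
  simp only [one_smul] at h1
  exact h1

theorem TravelTimeModel.integrand_decompose (θ : Eu n → ℂ) {β β₁ β₂ : Eu n × Eu n → ℂ} {a : ℝ}
    (h : ∀ p, β p = a • β₁ p + β₂ p) (x y : Eu n) (k₁ k₂ : ℝ) (p : Eu n × Eu n) (ξ : Eu n) :
    M.integrand θ β x y k₁ k₂ p ξ =
      a • M.integrand θ β₁ x y k₁ k₂ p ξ + M.integrand θ β₂ x y k₁ k₂ p ξ := by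
  simp only [integrand, h, Complex.real_smul]
  ring

theorem TravelTimeModel.norm_integral_decompose_le {θ : Eu n → ℂ} (hθ : Continuous θ)
    (hθK : ∀ z ∉ M.K', θ z = 0) {β β₁ β₂ : Eu n × Eu n → ℂ} {a : ℝ} (ha : 0 ≤ a)
    (h : ∀ p, β p = a • β₁ p + β₂ p) (hβ₁ : Continuous β₁) (hβ₂ : Continuous β₂)
    (hβK₁ : ∀ z ∉ K, ∀ η, β₁ (z, η) = 0) (hβK₂ : ∀ z ∉ K, ∀ η, β₂ (z, η) = 0) {R : ℝ}
    (hβR₁ : ∀ z η, R < ‖η‖ → β₁ (z, η) = 0) (hβR₂ : ∀ z η, R < ‖η‖ → β₂ (z, η) = 0)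
    (x y : Eu n) (k₁ k₂ : ℝ) :
    ‖∫ p, ∫ ξ, M.integrand θ β x y k₁ k₂ p ξ‖ ≤
      a * ‖∫ p, ∫ ξ, M.integrand θ β₁ x y k₁ k₂ p ξ‖ +
        ‖∫ p, ∫ ξ, M.integrand θ β₂ x y k₁ k₂ p ξ‖ := by
  have h1 := M.integrable_integrand hθ hθK hβ₁ hβK₁ hβR₁ x y k₁ k₂
  have h2 := M.integrable_integrand hθ hθK hβ₂ hβK₂ hβR₂ x y k₁ k₂
  have h3 : Integrable (fun q : (Eu n × Eu n) × Eu n => a • M.integrand θ β₁ x y k₁ k₂ q.1 q.2)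
      ((volume : Measure (Eu n × Eu n)).prod volume) := h1.smul a
  have e := integral_integral_add h3 h2
  simp only [Function.uncurry, integral_smul] at e
  simp only [M.integrand_decompose θ h]
  rw [e]
  refine (norm_add_le _ _).trans ?_
  rw [norm_smul, Real.norm_of_nonneg ha]

/-- The regularized integrals at wave numbers `k₂ ≥ 1`. -/
theorem TravelTimeModel.bound_of_one_le (hc : IsSymbol r c) (hχ : IsCutoff χ)
    (hcK : ∀ z ∉ K, ∀ ξ, c z ξ = 0) {θ : Eu n → ℂ} (hθ : ContDiff ℝ ∞ θ)
    (hθc : HasCompactSupport θ) (hθK : ∀ z ∉ M.K', θ z = 0) (N : ℕ) :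
    ∃ C : ℝ, 0 ≤ C ∧ ∀ P : WaveParam Q, 1 ≤ P.k₂ → (1 + |P.k₁ - P.k₂|) ^ N * ‖∫ p, ∫ ξ,
      M.integrand θ (fun p => regSymbol c χ P.ε p.1 p.2) P.x P.y P.k₁ P.k₂ p ξ‖ ≤
        C * P.k₂ ^ r := by
  -- `|r|` and not `r`: `m` bounds the order of the symbol and also ensures `k₂^m k₂^r ≥ 1`.
  obtain ⟨m, hm⟩ := exists_nat_ge |r|
  have hrm : r ≤ m := (le_abs_self r).trans hm
  obtain ⟨R, hR, hRχ⟩ := hχ.exists_radius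
  obtain ⟨δ, hδ, hδM⟩ := M.exists_delta
  -- Below `δ`, so that `ρ` can be `1` on `|η| ≤ c₀` and supported in `|η| < δ`; at most `1`, as the
  -- rescaled symbol estimate requires.
  set c₀ : ℝ := min 1 (δ / 2) with hc₀
  have hc₀p : 0 < c₀ := lt_min one_pos (by positivity)
  have hc₀1 : c₀ ≤ 1 := min_le_left _ _
  obtain ⟨ρ, hρ, hρc, hρs, hρ1, -⟩ := exists_contDiff_cutoff
    (isCompact_closedBall (0 : Eu n) c₀) (Metric.isOpen_ball (x := (0 : Eu n)) (ε := δ))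
    (Metric.closedBall_subset_ball ((min_le_right _ _).trans_lt (by linarith)))
  have hρ1' : ∀ η, ‖η‖ ≤ c₀ → ρ η = 1 := fun η hη =>
    hρ1.self_of_nhdsSet η (by rwa [mem_closedBall_zero_iff])
  have hρ0 : ∀ η, δ ≤ ‖η‖ → ρ η = 0 := fun η hη =>
    image_eq_zero_of_notMem_tsupport fun h => by
      have := hρs h
      rw [mem_ball_zero_iff] at this
      linarith
  let J := {P : WaveParam Q // 1 ≤ P.k₂}
  have hkpos : ∀ P : J, 0 < P.1.k₂ := fun P => P.1.k₂_pos
  -- The high part is written in the variable `η = ξ / k₂`, the low part in `ξ`. The cut-off becomes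
  -- `χ(ε k₂ η)`, and the restriction `ε k₂ ≤ 1` on the parameters keeps these dilates bounded.
  let bH : J → Eu n × Eu n → ℂ := fun P p => ((χ ((P.1.ε * P.1.k₂) • p.2) : ℝ) : ℂ) *
    ((P.1.k₂ ^ (-r)) • c p.1 (P.1.k₂ • p.2) * ((1 - ρ p.2 : ℝ) : ℂ))
  let bL : J → Eu n × Eu n → ℂ := fun P p => ((ρ (P.1.k₂⁻¹ • p.2) : ℝ) : ℂ) *
    regSymbol c χ P.1.ε p.1 p.2
  have hbH : WeightedFamily (fun (_ : J) (p : Eu n × Eu n) => (1 + ‖p.2‖) ^ m) bH :=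
    (hc.weightedFamily_rescaled hrm hc₀p hc₀1 hρ hρc hρ1' (k := fun P : J => P.1.k₂)
      (fun P => P.2)).bounded_mul (fun _ _ => by positivity)
      (boundedFamily_dilate hχ.contDiff hχ.hasCompactSupport
        (fun P : J => mul_nonneg P.1.ε_pos.le P.1.k₂_pos.le) (fun P => P.1.ε_mul_le))
  have hbL : WeightedFamily (fun (_ : J) (p : Eu n × Eu n) => (1 + ‖p.2‖) ^ m) bL :=
    (weightedFamily_regSymbol hc hχ hrm (fun P : J => P.1.ε_pos.le)
      (fun P => P.1.ε_le)).bounded_mul (fun _ _ => by positivity)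
      (boundedFamily_dilate hρ hρc (fun P : J => (inv_pos.2 (hkpos P)).le)
        (fun P => inv_le_one_of_one_le₀ P.2))
  have hbHK : ∀ P, ∀ z ∉ K, ∀ η, bH P (z, η) = 0 := fun P z hz η => by
    simp only [bH, hcK z hz, smul_zero, zero_mul, mul_zero]
  have hbLK : ∀ P, ∀ z ∉ K, ∀ η, bL P (z, η) = 0 := fun P z hz η => by
    simp only [bL]
    rw [regSymbol_zero_of_notMem hcK hz, mul_zero]
  have hbHR : ∀ P z η, R / (P.1.ε * P.1.k₂) < ‖η‖ → bH P (z, η) = 0 := fun P z η hη => by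
    have hpos : 0 < P.1.ε * P.1.k₂ := mul_pos P.1.ε_pos P.1.k₂_pos
    rw [div_lt_iff₀ hpos] at hη
    have h0 : χ ((P.1.ε * P.1.k₂) • η) = 0 := image_eq_zero_of_notMem_tsupport fun h => by
      have h1 := hRχ _ h
      rw [norm_smul, Real.norm_of_nonneg hpos.le] at h1
      linarith
    simp only [bH]
    rw [h0, Complex.ofReal_zero, zero_mul]
  have hbLR : ∀ P z η, δ * P.1.k₂ < ‖η‖ → bL P (z, η) = 0 := fun P z η hη => by
    have h0 : ρ (P.1.k₂⁻¹ • η) = 0 := hρ0 _ (by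
      rw [norm_smul, norm_inv, Real.norm_of_nonneg (hkpos P).le, le_inv_mul_iff₀ (hkpos P)]
      linarith)
    simp only [bL]
    rw [h0, Complex.ofReal_zero, zero_mul]
  obtain ⟨C, hC, h⟩ := M.high_frequency (ι := J) hθ hθc hθK
    (x := fun P => P.1.x) (y := fun P => P.1.y) (fun P => P.1.x_mem) (fun P => P.1.y_mem)
    (k₁ := fun P => P.1.k₁) (k₂ := fun P => P.1.k₂) (t := fun P => P.1.k₂⁻¹)
    (fun P => by rw [inv_mul_cancel₀ (hkpos P).ne']; exact zero_le_one)
    (fun P => by rw [inv_mul_cancel₀ (hkpos P).ne']) (fun P => inv_pos.2 (hkpos P))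
    (fun P => inv_le_one_of_one_le₀ P.2) hbH hbHK hbHR N
  -- The low part has no factor `k₂^r` of its own; the `m` additional powers of `1 + k₁ + k₂` supply
  -- it even for negative `r`.
  obtain ⟨C', hC', h'⟩ := M.low_frequency (ι := J) hθ hθc hθK
    (x := fun P => P.1.x) (y := fun P => P.1.y) (fun P => P.1.x_mem) (fun P => P.1.y_mem)
    (k₁ := fun P => P.1.k₁) (k₂ := fun P => P.1.k₂) (fun P => P.1.k₁_pos.le)
    (fun P => P.1.k₂_pos.le) hδ.le hδM hbL hbLK hbLR (N + m)
  refine ⟨C + C', by positivity, fun P hP => ?_⟩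
  have h1 := h ⟨P, hP⟩
  have h2 := h' ⟨P, hP⟩
  simp only at h1 h2
  have hk := P.k₂_pos
  have hdec : ∀ p : Eu n × Eu n, regSymbol c χ P.ε p.1 p.2 =
      (P.k₂ ^ r) • bH ⟨P, hP⟩ (p.1, P.k₂⁻¹ • p.2) + bL ⟨P, hP⟩ p := by
    intro p
    have e1 : P.k₂ • P.k₂⁻¹ • p.2 = p.2 := smul_inv_smul₀ hk.ne' _
    have e2 : (P.ε * P.k₂) • P.k₂⁻¹ • p.2 = P.ε • p.2 := by rw [mul_smul, e1]
    have e3 : ((P.k₂ ^ r : ℝ) : ℂ) * ((P.k₂ ^ (-r) : ℝ) : ℂ) = 1 := by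
      rw [← Complex.ofReal_mul, ← Real.rpow_add hk, add_neg_cancel, Real.rpow_zero,
        Complex.ofReal_one]
    simp only [bH, bL, e1, e2, regSymbol, Complex.real_smul]
    push_cast
    linear_combination (-(χ (P.ε • p.2) : ℂ) * c p.1 p.2 * (1 - (ρ (P.k₂⁻¹ • p.2) : ℂ))) * e3
  have hcH : Continuous fun p : Eu n × Eu n => bH ⟨P, hP⟩ (p.1, P.k₂⁻¹ • p.2) :=
    (hbH.contDiff _).continuous.comp (continuous_fst.prodMk (continuous_snd.const_smul P.k₂⁻¹))
  have h3 := M.norm_integral_decompose_le hθ.continuous hθK (Real.rpow_nonneg hk.le r) hdec hcH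
    (hbL.contDiff _).continuous (fun z hz η => hbHK _ z hz _) (hbLK _)
    (R := max (R / P.ε) (δ * P.k₂)) (fun z η hη => hbHR _ z _ (by
      rw [norm_smul, norm_inv, Real.norm_of_nonneg hk.le, ← div_eq_inv_mul,
        ← div_div]
      exact div_lt_div_of_pos_right ((le_max_left _ _).trans_lt hη) hk))
    (fun z η hη => hbLR _ z _ ((le_max_right _ _).trans_lt hη)) P.x P.y P.k₁ P.k₂
  set YH := ‖∫ p, ∫ ξ, M.integrand θ (fun p => bH ⟨P, hP⟩ (p.1, P.k₂⁻¹ • p.2))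
    P.x P.y P.k₁ P.k₂ p ξ‖
  set YL := ‖∫ p, ∫ ξ, M.integrand θ (bL ⟨P, hP⟩) P.x P.y P.k₁ P.k₂ p ξ‖ with hYL
  have hYL0 : 0 ≤ YL := norm_nonneg _
  have hkr : 0 < P.k₂ ^ r := Real.rpow_pos_of_pos hk r
  have hk1 := P.k₁_pos
  have h4 : (1 + |P.k₁ - P.k₂|) ^ N ≤ (1 + (P.k₁ + P.k₂)) ^ (N + m) * P.k₂ ^ r := by
    have h5 : |P.k₁ - P.k₂| ≤ P.k₁ + P.k₂ := abs_le.2 ⟨by linarith, by linarith⟩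
    have h6 : (1 : ℝ) ≤ P.k₂ ^ (m : ℝ) * P.k₂ ^ r := by
      rw [← Real.rpow_add hk]
      exact Real.one_le_rpow hP (by linarith [neg_abs_le r])
    have h7 : P.k₂ ^ (m : ℝ) ≤ (1 + (P.k₁ + P.k₂)) ^ m := by
      rw [Real.rpow_natCast]
      gcongr
      linarith
    rw [pow_add, mul_assoc]
    calc (1 + |P.k₁ - P.k₂|) ^ N = (1 + |P.k₁ - P.k₂|) ^ N * 1 := (mul_one _).symm
      _ ≤ (1 + (P.k₁ + P.k₂)) ^ N * ((1 + (P.k₁ + P.k₂)) ^ m * P.k₂ ^ r) := by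
        gcongr
        exact h6.trans (by gcongr)
  calc _ ≤ (1 + |P.k₁ - P.k₂|) ^ N * (P.k₂ ^ r * YH + YL) := by gcongr
    _ = ((1 + |P.k₁ - P.k₂|) ^ N * YH) * P.k₂ ^ r + (1 + |P.k₁ - P.k₂|) ^ N * YL := by ring
    _ ≤ C * P.k₂ ^ r + (1 + (P.k₁ + P.k₂)) ^ (N + m) * P.k₂ ^ r * YL := by gcongr
    _ = C * P.k₂ ^ r + ((1 + (P.k₁ + P.k₂)) ^ (N + m) * YL) * P.k₂ ^ r := by ring
    _ ≤ C * P.k₂ ^ r + C' * P.k₂ ^ r := by gcongr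
    _ = _ := by ring

end UniformBound

end NearField

namespace NearField

/-! ### Existence and size of the oscillatory integral -/

section OscillatoryIntegral

variable {n : ℕ} {K Q : Set (Eu n)} {r : ℝ} {c : Eu n → Eu n → ℂ} {χ : Eu n → ℝ}
variable (M : TravelTimeModel K Q)

/-- The first factor `e^{i k φ}` of the amplitude. -/
noncomputable def TravelTimeModel.wave (M : TravelTimeModel K Q) (x y : Eu n) (k : ℝ)
    (z : Eu n) : ℂ :=
  Complex.exp (Complex.I * ((k * M.phase x y z : ℝ) : ℂ))

theorem TravelTimeModel.wave_contDiff (x y : Eu n) (k : ℝ) : ContDiff ℝ ∞ (M.wave x y k) :=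
  contDiff_cexp_phase (contDiff_const.mul (M.phase_contDiff x y))

theorem TravelTimeModel.norm_wave (x y : Eu n) (k : ℝ) (z : Eu n) : ‖M.wave x y k z‖ = 1 :=
  norm_cexp_I_mul_ofReal _

theorem TravelTimeModel.regKernel_integral_eq (θ : Eu n → ℂ) (x y : Eu n) (k₁ k₂ ε : ℝ) :
    ∫ z : Eu n × Eu n, M.wave x y k₁ z.1 * (θ z.2 * M.wave x y (-k₂) z.2) *
      regKernel c χ ε z.1 z.2 =
    ∫ z, ∫ ξ, M.integrand θ (fun p => regSymbol c χ ε p.1 p.2) x y k₁ k₂ z ξ := by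
  refine integral_congr_ae (.of_forall fun z => ?_)
  simp only
  rw [regKernel_eq, ← integral_const_mul]
  refine integral_congr_ae (.of_forall fun ξ => ?_)
  simp only [wave, integrand]
  have e : Complex.exp (Complex.I * ((k₁ * M.phase x y z.1 - k₂ * M.phase x y z.2 +
      inner ℝ (z.1 - z.2) ξ : ℝ) : ℂ)) =
      Complex.exp (Complex.I * ((k₁ * M.phase x y z.1 : ℝ) : ℂ)) *
      Complex.exp (Complex.I * ((-k₂ * M.phase x y z.2 : ℝ) : ℂ)) *
      Complex.exp (Complex.I * ((inner ℝ (z.1 - z.2) ξ : ℝ) : ℂ)) := by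
    rw [← Complex.exp_add, ← Complex.exp_add]
    push_cast
    congr 1
    ring
  rw [e]
  ring

/-- The value of the oscillatory integral. -/
noncomputable def TravelTimeModel.value (M : TravelTimeModel K Q) (c : Eu n → Eu n → ℂ)
    (θ : Eu n → ℂ) (x y : Eu n) (k₁ k₂ : ℝ) : ℂ :=
  ∫ q, symbolPairing c (M.wave x y k₁) (fun z => θ z * M.wave x y (-k₂) z) q

theorem TravelTimeModel.tendsto_value (hK : IsCompact K) (hc : IsSymbol r c) (hχ : IsCutoff χ)
    (hcK : ∀ z ∉ K, ∀ ξ, c z ξ = 0) {θ : Eu n → ℂ} (hθ : ContDiff ℝ ∞ θ)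
    (hθc : HasCompactSupport θ) (x y : Eu n) (k₁ k₂ : ℝ) :
    Tendsto (fun ε : ℝ => ∫ z : Eu n × Eu n, M.wave x y k₁ z.1 *
      (θ z.2 * M.wave x y (-k₂) z.2) * regKernel c χ ε z.1 z.2) (𝓝[>] 0)
      (𝓝 (M.value c θ x y k₁ k₂)) := by
  have hu : ContDiff ℝ ∞ fun z => θ z * M.wave x y (-k₂) z := hθ.mul (M.wave_contDiff x y (-k₂))
  have huc : HasCompactSupport fun z => θ z * M.wave x y (-k₂) z :=
    hasCompactSupport_of_forall_notMem hθc.isCompact fun z hz => by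
      rw [image_eq_zero_of_notMem_tsupport hz, zero_mul]
  have hp : Continuous (M.wave x y k₁) := (M.wave_contDiff x y k₁).continuous
  have hpB : ∀ z, ‖M.wave x y k₁ z‖ ≤ 1 := fun z => (M.norm_wave x y k₁ z).le
  have hpc : ∀ z ∉ K, ∀ ξ, M.wave x y k₁ z * c z ξ = 0 := fun z hz ξ => by rw [hcK z hz, mul_zero]
  have h := tendsto_integral_mul_regKernel hc hχ hK hp hpB hpc hu huc
  rw [value]
  exact h

/-- The value does not involve the cut-off, so one fixed `χ` suffices. The regularized bounds hold
for `ε < min(1, 1/k₂)`; this range shrinks with `k₂`, but the constants do not change, and the bound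
survives the limit. -/
theorem TravelTimeModel.norm_value_le (hK : IsCompact K) (hc : IsSymbol r c)
    (hcK : ∀ z ∉ K, ∀ ξ, c z ξ = 0) {θ : Eu n → ℂ} (hθ : ContDiff ℝ ∞ θ)
    (hθc : HasCompactSupport θ) (hθK : ∀ z ∉ M.K', θ z = 0) (N : ℕ) :
    ∃ C : ℝ, 0 ≤ C ∧ ∀ x ∈ Q, ∀ y ∈ Q, ∀ k₁ k₂ : ℝ, 0 < k₁ → 0 < k₂ →
      (1 + |k₁ - k₂|) ^ N * ‖M.value c θ x y k₁ k₂‖ ≤ C * (max 1 k₂) ^ r := by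
  obtain ⟨χ, hχ⟩ := exists_isCutoff n
  obtain ⟨C, hC, h⟩ := M.bound_of_le_one hc hχ hcK hθ hθc hθK N
  obtain ⟨C', hC', h'⟩ := M.bound_of_one_le hc hχ hcK hθ hθc hθK N
  refine ⟨C + C', by positivity, fun x hx y hy k₁ k₂ hk₁ hk₂ => ?_⟩
  have hlim := ((M.tendsto_value hK hc hχ hcK hθ hθc x y k₁ k₂).norm).const_mul
    ((1 + |k₁ - k₂|) ^ N)
  refine le_of_tendsto hlim ?_
  have hmem : Set.Ioo (0 : ℝ) (min 1 k₂⁻¹) ∈ 𝓝[>] (0 : ℝ) :=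
    Ioo_mem_nhdsGT (lt_min one_pos (inv_pos.2 hk₂))
  filter_upwards [hmem] with ε hε
  have hε1 : ε ≤ 1 := hε.2.le.trans (min_le_left _ _)
  have hε2 : ε * k₂ ≤ 1 := by
    have := hε.2.le.trans (min_le_right _ _)
    rwa [← one_div, le_div_iff₀ hk₂] at this
  rw [M.regKernel_integral_eq]
  let P : WaveParam Q := ⟨x, y, k₁, k₂, ε, hx, hy, hk₁, hk₂, hε.1, hε1, hε2⟩
  rcases le_total k₂ 1 with hk | hk
  · have h1 := h P hk
    rw [max_eq_left hk, Real.one_rpow, mul_one]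
    exact h1.trans (le_add_of_nonneg_right hC')
  · have h1 := h' P hk
    rw [max_eq_right hk]
    refine h1.trans ?_
    have : 0 ≤ k₂ ^ r := Real.rpow_nonneg hk₂.le r
    exact mul_le_mul_of_nonneg_right (le_add_of_nonneg_left hC) this

theorem continuous_travelTimeFactor (x y : Eu n) (k₁ k₂ : ℝ) :
    Continuous (travelTimeFactor x y k₁ k₂) := by
  refine continuous_cexp_ofReal ?_
  fun_prop

theorem norm_travelTimeFactor (x y : Eu n) (k₁ k₂ : ℝ) (z : Eu n × Eu n) :
    ‖travelTimeFactor x y k₁ k₂ z‖ = 1 :=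
  norm_cexp_I_mul_ofReal _

/-- The second factor of the amplitude, with the exact travel time. -/
noncomputable def exactWave (x y : Eu n) (k : ℝ) (z : Eu n) : ℂ :=
  Complex.exp (Complex.I * ((k * (‖x - z‖ + ‖z - y‖) : ℝ) : ℂ))

theorem continuous_exactWave (x y : Eu n) (k : ℝ) : Continuous (exactWave x y k) := by
  refine continuous_cexp_ofReal ?_
  fun_prop

theorem norm_exactWave (x y : Eu n) (k : ℝ) (z : Eu n) : ‖exactWave x y k z‖ = 1 :=
  norm_cexp_I_mul_ofReal _

theorem travelTimeFactor_eq (x y : Eu n) (k₁ k₂ : ℝ) (z : Eu n × Eu n) :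
    travelTimeFactor x y k₁ k₂ z = exactWave x y k₁ z.1 * exactWave x y (-k₂) z.2 := by
  simp only [travelTimeFactor, exactWave]
  rw [← Complex.exp_add]
  push_cast
  congr 1
  ring

theorem TravelTimeModel.wave_eq {x y z : Eu n} (hx : x ∈ Q) (hy : y ∈ Q) (hz : z ∈ M.K') (k : ℝ) :
    M.wave x y k z = exactWave x y k z := by
  rw [wave, exactWave, M.phase_eq hx hy hz]

/-- Splitting by `θ(z₂) + (1 - θ(z₂))`. The smooth phase may replace the exact one except in the `1
- θ(z₂)` factor, which can reach the singularities at `x` and `y`. In the second term `θ(z₁) = 1` is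
inserted on `K` to give the compactly supported first factor that the tail estimate needs. -/
theorem TravelTimeModel.travelTimeFactor_mul_regKernel (hcK : ∀ z ∉ K, ∀ ξ, c z ξ = 0)
    {θ : Eu n → ℂ} (hθK : ∀ z ∉ M.K', θ z = 0) (hθ1 : ∀ z ∈ K, θ z = 1) {x y : Eu n}
    (hx : x ∈ Q) (hy : y ∈ Q) (k₁ k₂ ε : ℝ) (z : Eu n × Eu n) :
    travelTimeFactor x y k₁ k₂ z * regKernel c χ ε z.1 z.2 =
      M.wave x y k₁ z.1 * (θ z.2 * M.wave x y (-k₂) z.2) * regKernel c χ ε z.1 z.2 +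
      θ z.1 * M.wave x y k₁ z.1 * (exactWave x y (-k₂) z.2 * (1 - θ z.2)) *
        regKernel c χ ε z.1 z.2 := by
  by_cases hz : z.1 ∈ K
  · have h1 : M.wave x y k₁ z.1 = exactWave x y k₁ z.1 :=
      M.wave_eq hx hy (interior_subset (M.subset_interior hz)) k₁
    have h2 : θ z.2 * M.wave x y (-k₂) z.2 = θ z.2 * exactWave x y (-k₂) z.2 := by
      by_cases h : z.2 ∈ M.K'
      · rw [M.wave_eq hx hy h]
      · rw [hθK _ h, zero_mul, zero_mul]
    rw [travelTimeFactor_eq, h2, h1, hθ1 _ hz]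
    ring
  · rw [regKernel_eq_zero (hcK _ hz)]
    simp

/-- The term cut off by `θ(z₂)` converges to the value, and the other one tends to zero because `1 -
θ` vanishes near `closure D`. -/
theorem TravelTimeModel.hasOscIntegral {D : Set (Eu n)} (M : TravelTimeModel (closure D) Q)
    (hD : Bornology.IsBounded D) (hC : KernelSupportedIn c (closure D ×ˢ closure D))
    (hc : IsSymbol r c) (hcK : ∀ z ∉ closure D, ∀ ξ, c z ξ = 0) {θ : Eu n → ℂ}
    (hθ : ContDiff ℝ ∞ θ) (hθc : HasCompactSupport θ) (hθK : ∀ z ∉ M.K', θ z = 0)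
    (hθ1 : ∀ᶠ z in 𝓝ˢ (closure D), θ z = 1) {x y : Eu n} (hx : x ∈ Q) (hy : y ∈ Q) (k₁ k₂ : ℝ) :
    HasOscIntegral c (travelTimeFactor x y k₁ k₂) (M.value c θ x y k₁ k₂) := by
  intro χ hχ
  have hK : IsCompact (closure D) := hD.isCompact_closure
  obtain ⟨B, hB⟩ : ∃ B, ∀ z, ‖θ z‖ ≤ B := hθc.exists_bound_of_continuous hθ.continuous
  have hw := fun k => (M.wave_contDiff x y k).continuous
  have hq : Continuous fun z => exactWave x y (-k₂) z * (1 - θ z) :=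
    (continuous_exactWave x y (-k₂)).mul (continuous_const.sub hθ.continuous)
  have hqB : ∀ z, ‖exactWave x y (-k₂) z * (1 - θ z)‖ ≤ 1 + B := fun z => by
    rw [norm_mul, norm_exactWave, one_mul]
    refine (norm_sub_le _ _).trans ?_
    rw [norm_one]
    exact add_le_add_right (hB z) 1
  have hB0 : 0 ≤ B := (norm_nonneg _).trans (hB 0)
  refine ⟨fun ε hε => integrable_mul_regKernel hc hχ hε hK (continuous_travelTimeFactor x y k₁ k₂)
    (fun z => (norm_travelTimeFactor x y k₁ k₂ z).le)
    (fun z hz _ ξ => by rw [hcK z hz, mul_zero]), ?_⟩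
  have hα : ContDiff ℝ ∞ fun z => θ z * M.wave x y k₁ z := hθ.mul (M.wave_contDiff x y k₁)
  have hαc : HasCompactSupport fun z => θ z * M.wave x y k₁ z :=
    hasCompactSupport_of_forall_notMem hθc.isCompact fun z hz => by
      rw [image_eq_zero_of_notMem_tsupport hz, zero_mul]
  have hqD : ∀ᶠ z in 𝓝ˢ (closure D), exactWave x y (-k₂) z * (1 - θ z) = 0 := by
    filter_upwards [hθ1] with z hz
    rw [hz, sub_self, mul_zero]
  have hlim := (M.tendsto_value hK hc hχ hcK hθ hθc x y k₁ k₂).add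
    (tendsto_integral_mul_regKernel_tail hc hχ hD hC hα hαc hq hqB hqD)
  rw [add_zero] at hlim
  refine hlim.congr' ?_
  filter_upwards [self_mem_nhdsWithin] with ε hε
  have hε' : 0 < ε := hε
  have hg1 : Continuous fun z : Eu n × Eu n =>
      M.wave x y k₁ z.1 * (θ z.2 * M.wave x y (-k₂) z.2) :=
    ((hw k₁).comp continuous_fst).mul ((hθ.continuous.comp continuous_snd).mul
      ((hw (-k₂)).comp continuous_snd))
  have hi1 := integrable_mul_regKernel hc hχ hε' hK hg1 (B := B)
    (fun z => by
      rw [norm_mul, norm_mul, M.norm_wave, M.norm_wave, one_mul, mul_one]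
      exact hB _)
    (fun z hz _ ξ => by rw [hcK z hz, mul_zero])
  have hg2 : Continuous fun z : Eu n × Eu n =>
      θ z.1 * M.wave x y k₁ z.1 * (exactWave x y (-k₂) z.2 * (1 - θ z.2)) :=
    (hα.continuous.comp continuous_fst).mul (hq.comp continuous_snd)
  have hi2 := integrable_mul_regKernel hc hχ hε' hK hg2 (B := B * (1 + B))
    (fun z => by
      rw [norm_mul]
      refine mul_le_mul ?_ (hqB _) (norm_nonneg _) hB0
      rw [norm_mul, M.norm_wave, mul_one]
      exact hB _)
    (fun z hz _ ξ => by rw [hcK z hz, mul_zero])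
  rw [← integral_add hi1 hi2]
  refine integral_congr_ae (.of_forall fun z => ?_)
  exact (M.travelTimeFactor_mul_regKernel hcK hθK (fun z hz => hθ1.self_of_nhdsSet z hz)
    hx hy k₁ k₂ ε z).symm

end OscillatoryIntegral

/-! ### Comparison of the weights -/

section Weights

theorem one_le_japaneseBracket (t : ℝ) : 1 ≤ japaneseBracket t := by
  rw [japaneseBracket, Real.one_le_sqrt]
  nlinarith [sq_nonneg t]

theorem japaneseBracket_le (t : ℝ) : japaneseBracket t ≤ 1 + |t| := by
  rw [japaneseBracket, Real.sqrt_le_left (by positivity)]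
  nlinarith [abs_nonneg t, sq_abs t]

/-- For `m ≥ 0`, `k₁ + k₂ ≤ 2 (1 + |k₁ - k₂|) max(1, k₂)`, so large `k₁` is paid for by the
off-diagonal weight. For `m < 0`, `max(1, k₂) ≤ (1 + 1/κ)(k₁ + k₂)`; here small wave numbers must be
excluded, since `(k₁ + k₂)^(-m)` tends to `0` with `k₁ + k₂`. -/
theorem exists_max_rpow_le (m : ℝ) {κ : ℝ} (hκ : 0 < κ) {q : ℕ} (hq : |m| ≤ q) :
    ∃ B : ℝ, 0 < B ∧ ∀ k₁ k₂ : ℝ, 0 < k₁ → 0 < k₂ → (m < 0 → κ ≤ k₁ + k₂) →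
      (max 1 k₂) ^ (-m) ≤ B * (1 + |k₁ - k₂|) ^ q * (k₁ + k₂) ^ (-m) := by
  rcases le_or_gt 0 m with hm | hm
  · refine ⟨2 ^ m, by positivity, fun k₁ k₂ hk₁ hk₂ _ => ?_⟩
    have hx0 : 0 < max 1 k₂ := lt_max_of_lt_left one_pos
    have h1 : k₁ + k₂ ≤ 2 * (1 + |k₁ - k₂|) * max 1 k₂ := by
      have h2 : k₁ - k₂ ≤ |k₁ - k₂| := le_abs_self _
      have h3 : (1 : ℝ) ≤ max 1 k₂ := le_max_left _ _
      have h4 : k₂ ≤ max 1 k₂ := le_max_right _ _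
      nlinarith [abs_nonneg (k₁ - k₂)]
    have h5 : (k₁ + k₂) ^ m ≤ 2 ^ m * (1 + |k₁ - k₂|) ^ q * (max 1 k₂) ^ m := by
      refine (Real.rpow_le_rpow (by positivity) h1 hm).trans ?_
      rw [Real.mul_rpow (by positivity) hx0.le, Real.mul_rpow two_pos.le (by positivity)]
      gcongr
      rw [← Real.rpow_natCast]
      exact Real.rpow_le_rpow_of_exponent_le (by linarith [abs_nonneg (k₁ - k₂)])
        ((le_abs_self m).trans hq)
    rw [Real.rpow_neg hx0.le, Real.rpow_neg (by positivity), ← div_eq_mul_inv,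
      le_div_iff₀ (by positivity), inv_mul_le_iff₀ (by positivity)]
    linarith
  · refine ⟨(1 + κ⁻¹) ^ (-m), by positivity, fun k₁ k₂ hk₁ hk₂ h => ?_⟩
    have hκ' := h hm
    have h1 : max 1 k₂ ≤ (1 + κ⁻¹) * (k₁ + k₂) := by
      have h2 : 1 ≤ κ⁻¹ * (k₁ + k₂) := by
        rw [le_inv_mul_iff₀ hκ]
        linarith
      refine max_le (by nlinarith) (by nlinarith)
    have h3 : (1 : ℝ) ≤ (1 + |k₁ - k₂|) ^ q :=
      one_le_pow₀ (by linarith [abs_nonneg (k₁ - k₂)])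
    calc _ ≤ ((1 + κ⁻¹) * (k₁ + k₂)) ^ (-m) :=
          Real.rpow_le_rpow (le_max_of_le_left zero_le_one) h1 (by linarith)
      _ = (1 + κ⁻¹) ^ (-m) * 1 * (k₁ + k₂) ^ (-m) := by
          rw [Real.mul_rpow (by positivity) (by positivity), mul_one]
      _ ≤ _ := by gcongr

end Weights

end NearField

/-! ### The main estimate -/

theorem proposition3p5 (n : ℕ) (m : ℝ)
    (c : EuclideanSpace ℝ (Fin n) → EuclideanSpace ℝ (Fin n) → ℂ)
    (hc : NearField.IsSymbol (-m) c)
    (D U : Set (EuclideanSpace ℝ (Fin n)))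
    (hD : Bornology.IsBounded D) (hU : Bornology.IsBounded U)
    (hC : NearField.KernelSupportedIn c (closure D ×ˢ closure D))
    (hUD : ∀ x ∈ closure U, ∀ y ∈ closure U, Disjoint (segment ℝ x y) (closure D)) :
    ∃ I : EuclideanSpace ℝ (Fin n) → EuclideanSpace ℝ (Fin n) → ℝ → ℝ → ℂ,
      (∀ x ∈ U, ∀ y ∈ U, ∀ k₁ k₂ : ℝ, 0 < k₁ → 0 < k₂ →
        NearField.HasOscIntegral c (NearField.travelTimeFactor x y k₁ k₂) (I x y k₁ k₂)) ∧
      ∀ N : ℕ, ∀ κ : ℝ, 0 < κ → ∃ C : ℝ, 0 < C ∧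
        ∀ x ∈ U, ∀ y ∈ U, ∀ k₁ k₂ : ℝ, 0 < k₁ → 0 < k₂ → (m < 0 → κ ≤ k₁ + k₂) →
          ‖I x y k₁ k₂‖ ≤
            C * NearField.japaneseBracket (k₁ - k₂) ^ (-(N : ℝ)) * (k₁ + k₂) ^ (-m) := by
  have hK : IsCompact (closure D) := hD.isCompact_closure
  obtain ⟨M⟩ := NearField.exists_travelTimeModel hK hU.isCompact_closure hUD
  have hcK : ∀ z ∉ closure D, ∀ ξ, c z ξ = 0 := fun z hz ξ => NearField.symbol_eq_zero hc hC hz ξ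
  obtain ⟨θ, hθ, hθc, hθO, hθ1, -⟩ :=
    NearField.exists_contDiff_cutoff hK isOpen_interior M.subset_interior
  have hϑ : ContDiff ℝ ∞ fun z => (θ z : ℂ) := Complex.ofRealCLM.contDiff.comp hθ
  have hϑ0 : ∀ z ∉ tsupport θ, (θ z : ℂ) = 0 := fun z hz => by
    rw [image_eq_zero_of_notMem_tsupport hz, Complex.ofReal_zero]
  have hϑc : HasCompactSupport fun z => (θ z : ℂ) :=
    NearField.hasCompactSupport_of_forall_notMem hθc.isCompact hϑ0
  have hϑK : ∀ z ∉ M.K', (θ z : ℂ) = 0 := fun z hz =>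
    hϑ0 z fun h => hz (interior_subset (hθO h))
  have hϑ1 : ∀ᶠ z in 𝓝ˢ (closure D), (θ z : ℂ) = 1 := by
    filter_upwards [hθ1] with z hz
    rw [hz, Complex.ofReal_one]
  refine ⟨M.value c fun z => (θ z : ℂ), fun x hx y hy k₁ k₂ _ _ =>
    M.hasOscIntegral hD hC hc hcK hϑ hϑc hϑK hϑ1 (subset_closure hx) (subset_closure hy) k₁ k₂,
    fun N κ hκ => ?_⟩
  obtain ⟨q, hq⟩ := exists_nat_ge |m|
  -- The `q` additional powers of `1 + |k₁ - k₂|` are spent on replacing `max(1, k₂)` by `k₁ + k₂`.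
  obtain ⟨C, hC0, h⟩ := M.norm_value_le hK hc hcK hϑ hϑc hϑK (N + q)
  obtain ⟨B, hB, hBk⟩ := NearField.exists_max_rpow_le m hκ hq
  -- `C` may be zero; the `+ 1` makes the constant strictly positive.
  refine ⟨C * B + 1, by positivity, fun x hx y hy k₁ k₂ hk₁ hk₂ hm => ?_⟩
  have h1 := h x (subset_closure hx) y (subset_closure hy) k₁ k₂ hk₁ hk₂
  have h2 := hBk k₁ k₂ hk₁ hk₂ hm
  set Y := ‖M.value c (fun z => (θ z : ℂ)) x y k₁ k₂‖
  set L := 1 + |k₁ - k₂| with hL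
  have hL0 : 0 < L := by positivity
  have hJ1 : 0 < NearField.japaneseBracket (k₁ - k₂) :=
    one_pos.trans_le (NearField.one_le_japaneseBracket _)
  have hs : 0 < (k₁ + k₂) ^ (-m) := by positivity
  have h3 : L ^ q * (L ^ N * Y) ≤ L ^ q * (C * B * (k₁ + k₂) ^ (-m)) :=
    calc _ = L ^ (N + q) * Y := by ring
      _ ≤ C * (B * L ^ q * (k₁ + k₂) ^ (-m)) := h1.trans (by gcongr)
      _ = _ := by ring
  have h4 : L ^ N * Y ≤ C * B * (k₁ + k₂) ^ (-m) := le_of_mul_le_mul_left h3 (by positivity)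
  have h5 : NearField.japaneseBracket (k₁ - k₂) ^ N * Y ≤ L ^ N * Y := by
    gcongr
    exact NearField.japaneseBracket_le _
  rw [Real.rpow_neg hJ1.le, Real.rpow_natCast, mul_right_comm, ← div_eq_mul_inv,
    le_div_iff₀ (by positivity)]
  nlinarith
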